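/- \textbf{Setting.} For finite types $\sigma$ (built from $0$ by $\to$), let $\mathbf F(0)=\mathbb N$ and let $\mathbf F(\sigma_1,\dots,\sigma_n\to0)$ be the set of all functions $\mathbf F(\sigma_1)\times\dots\times\mathbf F(\sigma_n)\to\mathbb N$; let $\mathbf P(\sigma)$ be defined in the same way with values in $\mathbb N\cup\{\bot\}$ (partial functionals with total arguments), ordered by extension $\preceq$. Terms are built from typed variables of rank $\le 3$, $0$, successor, predecessor, definition by cases on a number (only the selected branch has to be defined), application, $\lambda x.t$ (of rank $\le 3$) and $\mu x.t$ (of rank $\le 3$). They are interpreted as partial functionals, monotone in the values of the free variables: an application $ts$ is nowhere defined unless $s$ is total, and $\mu x.t$ is the least fixed point. A partial functional $\psi$ is \emph{computable in} $\phi_1,\dots,\phi_n$ if $\psi\preceq[[s(\phi_1,\dots,\phi_n)]]$ for some term $s$. Kleene's $\exists^2$ is the type $2$ functional with $\exists^2(f)=0$ if $(\exists n)(f(n)=0)$ and $\exists^2(f)=1$ otherwise; `modulo $\exists^2$' means that $\exists^2$ is added to the list of functionals in which one computes. Real numbers are coded by fast converging Cauchy sequences of rationals, finite sequences of type $1$ objects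 by type $1$ objects, and sets and functions into $\mathbb N$ by type $2$ objects that are extensional on the codes of points. A functional given by a description stands for the class of all partial functionals that are defined exactly on the described inputs and have the described outputs there. Let $D$ be any of the domains $\mathbb N^{\mathbb N}$, $2^{\mathbb N}$, $[0,1]$, $\mathbb R$. For $X\subseteq D$, $\Omega_1(X)$ is defined if $X=\{p\}$, and outputs $p$; $\Omega(X)$ is defined if $|X|\le1$, and outputs a finite sequence that includes all elements of $X$. A partial functional is in the $\Omega$-cluster (resp. the $\Omega_1$-cluster) if, modulo $\exists^2$, it computes some functional in the class $\Omega$ (resp. $\Omega_1$) and is computable in every functional in that class. A class of functionals is in a cluster if, modulo $\exists^2$, each of its elements computes some functional in the class $\Omega$ (resp. $\Omega_1$), and at least one of its elements belongs to the cluster. For $X\subseteq[0,1]$, the functionals $\Omega_n$, $\Omega_{\le n}$, $\Omega_{\mathsf{fin}}$ are defined if $|X|=n$, if $|X|\le n$, if $X$ is finite, respectively, and output a finite sequence in $[0,1]$ that includes all elements of $X$; $\Omega_{\#,\mathsf{fin}}$ and $\Omega_{\ge\#,\mathsf{fin}}$ are defined if $X$ is finite, and output $|X|$, respectively some $n\ge|X|$.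 An enumeration functional (resp. an $\Omega_{\mathsf{BW}}$-functional) takes as input $A\subseteq[0,1]$ and $Y:[0,1]\to\mathbb N$ injective on $A$, and outputs an enumeration of $A$ (a sequence whose terms are exactly the elements of $A$; for $A=\emptyset$ the special null sequence) (resp. $\sup A$, taken in $[0,1]$, so that $\sup\emptyset=0$). The weak versions are defined only if $Y$ moreover maps $A$ onto $\mathbb N$. \textbf{Theorem} (First cluster theorem). For each of these choices of $D$: \begin{itemize} \item The $\Omega_1$-cluster contains $\Omega_n$ for each $n\ge1$, a weak enumeration functional, and the weak $\Omega_{\mathsf{BW}}$-functional. \item The $\Omega$-cluster contains $\Omega_{\mathsf{fin}}$, $\Omega_{\le n}$ for each $n\ge1$, $\Omega_{\#,\mathsf{fin}}$, $\Omega_{\ge\#,\mathsf{fin}}$, an enumeration functional, and $\Omega_{\mathsf{BW}}$. \end{itemize} -/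

import Mathlib

namespace HigherType

/-! ### Finite types, total objects and partial objects -/

/-- Finite types, in curried form: `(σ₁, …, σₙ → 0)` is `σ₁ ⇒ (σ₂ ⇒ ⋯ (σₙ ⇒ 0))`. -/
inductive Ty : Type
  | nat : Ty
  | arr : Ty → Ty → Ty

infixr:60 " ⇒ " => Ty.arr

/-- The rank of a type; for `σ = (σ₁, …, σₙ → 0)` with `n ≥ 1` it is `max (rank σᵢ + 1)`. -/
def Ty.rank : Ty → ℕ
  | .nat => 0
  | .arr σ τ => max (σ.rank + 1) τ.rank

/-- The pure types `1` and `2`. -/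
abbrev Ty.one : Ty := Ty.nat ⇒ Ty.nat
abbrev Ty.two : Ty := Ty.one ⇒ Ty.nat

/-- The total functionals of type `σ`: all set-theoretic functionals. -/
def Tot : Ty → Type
  | .nat => ℕ
  | .arr σ τ => Tot σ → Tot τ

/-- The partial functionals of type `σ`: they accept total arguments only, and take
values in `ℕ ∪ {⊥}`. -/
def Par : Ty → Type
  | .nat => Part ℕ
  | .arr σ τ => Tot σ → Par τ

/-- The extension order on partial functionals: at type `0` the flat order (`Part.none` below
everything, distinct numbers incomparable), at higher types the pointwise order. -/
instance Par.partialOrder : (σ : Ty) → PartialOrder (Par σ)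
  | .nat => inferInstanceAs (PartialOrder (Part ℕ))
  | .arr σ τ =>
    letI := Par.partialOrder τ
    inferInstanceAs (PartialOrder (Tot σ → Par τ))

/-- The nowhere defined functional. -/
instance Par.orderBot : (σ : Ty) → OrderBot (Par σ)
  | .nat => inferInstanceAs (OrderBot (Part ℕ))
  | .arr σ τ =>
    letI := Par.orderBot τ
    inferInstanceAs (OrderBot (Tot σ → Par τ))

/-- A total functional regarded as a partial one. -/
def toPar : {σ : Ty} → Tot σ → Par σ
  | .nat, n => Part.some (show ℕ from n)
  | .arr _ _, f => fun x => toPar (f x)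

open Classical in
/-- Application of a partial functional to a partial argument: nowhere defined unless the
argument is total. -/
noncomputable def Par.app {σ τ : Ty} (u : Par (σ ⇒ τ)) (v : Par σ) : Par τ :=
  if h : ∃ x : Tot σ, toPar x = v then u h.choose else ⊥

open Classical in
/-- The least fixed point of `f`, which exists for every monotone `f`
(see `Par.exists_least_fixedPoint`). -/
noncomputable def Par.lfp {σ : Ty} (f : Par σ → Par σ) : Par σ :=
  if h : ∃ x, IsLeast {y | f y = y} x then h.choose else ⊥

/-- Definition by cases: `t` if the value of `c` is `0`, and `e` if it is a successor. Only the
selected branch has to be defined. -/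
def caseNat (c t e : Part ℕ) : Part ℕ :=
  c.bind fun z => if z = 0 then t else e

/-! ### The term language and its interpretation -/

/-- Variables (typed de Bruijn indices) in a context. -/
inductive Var : List Ty → Ty → Type
  | zero {Γ : List Ty} {σ : Ty} : Var (σ :: Γ) σ
  | succ {Γ : List Ty} {σ τ : Ty} : Var Γ σ → Var (τ :: Γ) σ

/-- Terms without secondary constants, whose free variables are listed in the context `Γ`.
The constant `case` is a term former, because its last two arguments
need not both be defined. -/
inductive Term : List Ty → Ty → Type
  | var {Γ : List Ty} {σ : Ty} : Var Γ σ → Term Γ σ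
  | zero {Γ : List Ty} : Term Γ Ty.nat
  | suc {Γ : List Ty} : Term Γ (Ty.nat ⇒ Ty.nat)
  | pred {Γ : List Ty} : Term Γ (Ty.nat ⇒ Ty.nat)
  | caseOf {Γ : List Ty} : Term Γ Ty.nat → Term Γ Ty.nat → Term Γ Ty.nat → Term Γ Ty.nat
  | app {Γ : List Ty} {σ τ : Ty} : Term Γ (σ ⇒ τ) → Term Γ σ → Term Γ τ
  | lam {Γ : List Ty} {σ τ : Ty} : (σ ⇒ τ).rank ≤ 3 → Term (σ :: Γ) τ → Term Γ (σ ⇒ τ)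
  | mu {Γ : List Ty} {σ : Ty} : σ.rank ≤ 3 → Term (σ :: Γ) σ → Term Γ σ

/-- Assignments of partial functionals to the variables of a context. -/
def Env : List Ty → Type
  | [] => Unit
  | σ :: Γ => Par σ × Env Γ

def Env.get : {Γ : List Ty} → {σ : Ty} → Var Γ σ → Env Γ → Par σ
  | _, _, .zero, ρ => ρ.1
  | _, _, .succ x, ρ => Env.get x ρ.2

/-- The interpretation of terms. -/
noncomputable def Term.eval : {Γ : List Ty} → {σ : Ty} → Term Γ σ → Env Γ → Par σ
  | _, _, .var x, ρ => Env.get x ρ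
  | _, _, .zero, _ => Part.some 0
  | _, _, .suc, _ => fun n : ℕ => Part.some (n + 1)
  | _, _, .pred, _ => fun n : ℕ => Part.some (n - 1)
  | _, _, .caseOf c t e, ρ => caseNat (c.eval ρ) (t.eval ρ) (e.eval ρ)
  | _, _, .app t s, ρ => Par.app (t.eval ρ) (s.eval ρ)
  | _, _, .lam _ t, ρ => fun x => t.eval (toPar x, ρ)
  | _, _, .mu _ t, ρ => Par.lfp fun y => t.eval (y, ρ)

/-! ### The interpretation is monotone, so that the least fixed points in it exist -/

theorem Par.exists_isLUB_of_isChain : (σ : Ty) → (c : Set (Par σ)) → IsChain (· ≤ ·) c →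
    ∃ x, IsLUB c x
  | .nat, c, hc => by
    by_cases h : ∃ n : ℕ, (show Par .nat from Part.some n) ∈ c
    · obtain ⟨n, hn⟩ := h
      refine ⟨Part.some n, fun x hx => ?_, fun y hy => hy hn⟩
      rcases hc.total hx hn with h | h
      · exact h
      · exact le_of_eq (Part.eq_some_iff.2 (h n (Part.mem_some n)))
    · refine ⟨Part.none, fun x hx => ?_, fun y _ => bot_le (α := Part ℕ)⟩
      intro m hm
      exact absurd ⟨m, (Part.eq_some_iff.2 hm) ▸ hx⟩ h
  | .arr σ τ, c, hc => by
    have key : ∀ a : Tot σ, ∃ x, IsLUB ((fun u : Par (σ ⇒ τ) => (u a : Par τ)) '' c) x := by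
      intro a
      apply Par.exists_isLUB_of_isChain τ
      rintro _ ⟨u, hu, rfl⟩ _ ⟨v, hv, rfl⟩ _
      exact (hc.total hu hv).imp (fun h => h a) (fun h => h a)
    choose g hg using key
    refine ⟨g, fun u hu a => (hg a).1 ⟨u, hu, rfl⟩, fun v hv a => (hg a).2 ?_⟩
    rintro _ ⟨u, hu, rfl⟩
    exact hv hu a

theorem Par.exists_least_prefixedPoint {σ : Ty} {f : Par σ → Par σ} (hf : Monotone f) :
    ∃ x, f x = x ∧ ∀ y, f y ≤ y → x ≤ y := by
  obtain ⟨m, -, hm⟩ := zorn_le_nonempty₀ {x : Par σ | x ≤ f x ∧ ∀ y, f y ≤ y → x ≤ y}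
    (fun c hcS hc _ _ => by
      obtain ⟨s, hs⟩ := Par.exists_isLUB_of_isChain σ c hc
      exact ⟨s, ⟨hs.2 fun x hx => (hcS hx).1.trans (hf (hs.1 hx)),
        fun y hy => hs.2 fun x hx => (hcS hx).2 y hy⟩, hs.1⟩)
    ⊥ ⟨bot_le, fun _ _ => bot_le⟩
  have hmem : f m ∈ {x : Par σ | x ≤ f x ∧ ∀ y, f y ≤ y → x ≤ y} :=
    ⟨hf hm.prop.1, fun y hy => (hf (hm.prop.2 y hy)).trans hy⟩
  exact ⟨m, (hm.eq_of_le hmem hm.prop.1).symm, hm.prop.2⟩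

theorem Par.exists_least_fixedPoint {σ : Ty} {f : Par σ → Par σ} (hf : Monotone f) :
    ∃ x, IsLeast {y | f y = y} x :=
  (Par.exists_least_prefixedPoint hf).imp fun _ h => ⟨h.1, fun _ hy => h.2 _ (le_of_eq hy)⟩

theorem Par.isLeast_lfp {σ : Ty} {f : Par σ → Par σ} (hf : Monotone f) :
    IsLeast {y | f y = y} (Par.lfp f) := by
  have h := Par.exists_least_fixedPoint hf
  rw [Par.lfp, dif_pos h]
  exact h.choose_spec

theorem Par.lfp_mono {σ : Ty} {f g : Par σ → Par σ} (hf : Monotone f) (hg : Monotone g)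
    (hfg : ∀ x, f x ≤ g x) : Par.lfp f ≤ Par.lfp g := by
  obtain ⟨x, hx, hle⟩ := Par.exists_least_prefixedPoint hf
  have h1 : Par.lfp f = x := (Par.isLeast_lfp hf).unique ⟨hx, fun y hy => hle y (le_of_eq hy)⟩
  rw [h1]
  exact hle _ ((hfg _).trans (le_of_eq (Par.isLeast_lfp hg).1))

theorem eq_of_toPar_le : {σ : Ty} → (x : Tot σ) → (v : Par σ) → toPar x ≤ v → v = toPar x
  | .nat, x, _, h => Part.eq_some_iff.2 (h x (Part.mem_some (α := ℕ) x))
  | .arr _ _, x, v, h => funext fun a => eq_of_toPar_le (x a) (v a) (h a)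

theorem Par.app_mono {σ τ : Ty} {u u' : Par (σ ⇒ τ)} {v v' : Par σ} (hu : u ≤ u')
    (hv : v ≤ v') : Par.app u v ≤ Par.app u' v' := by
  by_cases h : ∃ x : Tot σ, toPar x = v
  · have hvv : v' = v := by
      obtain ⟨x, rfl⟩ := h
      exact eq_of_toPar_le x v' hv
    subst hvv
    rw [Par.app, Par.app, dif_pos h, dif_pos h]
    exact hu _
  · rw [Par.app, dif_neg h]
    exact bot_le

theorem caseNat_mono {c c' t t' e e' : Part ℕ} (hc : c ≤ c') (ht : t ≤ t') (he : e ≤ e') :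
    caseNat c t e ≤ caseNat c' t' e' := by
  intro m hm
  obtain ⟨z, hz, hm⟩ := Part.mem_bind_iff.1 hm
  refine Part.mem_bind_iff.2 ⟨z, hc z hz, ?_⟩
  by_cases h0 : z = 0
  · rw [if_pos h0] at hm ⊢
    exact ht m hm
  · rw [if_neg h0] at hm ⊢
    exact he m hm

/-- The pointwise extension order on assignments. -/
def Env.Le : {Γ : List Ty} → Env Γ → Env Γ → Prop
  | [], _, _ => True
  | _ :: _, ρ, ρ' => ρ.1 ≤ ρ'.1 ∧ Env.Le ρ.2 ρ'.2

theorem Env.Le.rfl : {Γ : List Ty} → (ρ : Env Γ) → Env.Le ρ ρ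
  | [], _ => trivial
  | _ :: _, ρ => ⟨le_rfl, Env.Le.rfl ρ.2⟩

theorem Env.get_mono {Γ : List Ty} {σ : Ty} (x : Var Γ σ) :
    ∀ {ρ ρ' : Env Γ}, Env.Le ρ ρ' → Env.get x ρ ≤ Env.get x ρ' := by
  induction x with
  | zero => exact fun h => h.1
  | succ x ih => exact fun h => ih h.2

theorem Term.eval_mono {Γ : List Ty} {σ : Ty} (t : Term Γ σ) :
    ∀ {ρ ρ' : Env Γ}, Env.Le ρ ρ' → t.eval ρ ≤ t.eval ρ' := by
  induction t with
  | var x => exact fun h => Env.get_mono x h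
  | zero => exact fun _ => le_rfl
  | suc => exact fun _ => le_rfl
  | pred => exact fun _ => le_rfl
  | caseOf c t e ihc iht ihe =>
    exact fun h => caseNat_mono (ihc h) (iht h) (ihe h)
  | app t s iht ihs => exact fun h => Par.app_mono (iht h) (ihs h)
  | lam _ t ih => exact fun h x => ih ⟨le_rfl, h⟩
  | mu _ t ih =>
    intro ρ ρ' h
    exact Par.lfp_mono (fun _ _ hxy => ih ⟨hxy, Env.Le.rfl ρ⟩)
      (fun _ _ hxy => ih ⟨hxy, Env.Le.rfl ρ'⟩) fun x => ih ⟨le_rfl, h⟩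

/-! ### Computability modulo `∃²` -/

/-- `ψ` is computable in the functionals listed by the assignment `ρ`. -/
def ComputableIn {Γ : List Ty} (ρ : Env Γ) {τ : Ty} (ψ : Par τ) : Prop :=
  ∃ s : Term Γ τ, ψ ≤ s.eval ρ

open Classical in
/-- Kleene's quantifier `∃²`. -/
noncomputable def existsTwo : Tot Ty.two :=
  fun f : ℕ → ℕ => if ∃ n, f n = 0 then (0 : ℕ) else (1 : ℕ)

/-- `ψ` is computable in `φ` and `∃²`. -/
def ComputableModE2 {σ τ : Ty} (ψ : Par τ) (φ : Par σ) : Prop :=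
  ComputableIn (Γ := [σ, Ty.two]) (φ, toPar existsTwo, ()) ψ

/-- The cluster of a class `B` of functionals, all of which satisfy the (incomplete) description
of one functional, such as `Ω`. A functional `Φ` belongs to the cluster if, modulo `∃²`, it
computes an instance of `B` and is computable in each instance of `B`. (Any two members of the
cluster compute each other; if `B` has only one instance, the cluster is its equivalence class.) -/
def Cluster {σ : Ty} (B : Set (Par σ)) (τ : Ty) : Set (Par τ) :=
  {Φ | (∃ b ∈ B, ComputableModE2 b Φ) ∧ ∀ b ∈ B, ComputableModE2 Φ b}

/-- A class `C` of functionals is in the cluster of `B` if each element of `C` computes `B` modulo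
`∃²`, and at least one element of `C` belongs to the cluster. -/
def InCluster {σ τ : Ty} (B : Set (Par σ)) (C : Set (Par τ)) : Prop :=
  (∀ c ∈ C, ∃ b ∈ B, ComputableModE2 b c) ∧ ∃ c ∈ C, c ∈ Cluster B τ

/-! ### The domains `ℕ^ℕ`, `2^ℕ`, `[0,1]` and `ℝ`, and their coding by type `1` objects -/

/-- The rational coded by a number: all quotients `(a - b) / (c + 1)`. -/
def ratOf (m : ℕ) : ℚ :=
  ((m.unpair.1.unpair.1 : ℚ) - (m.unpair.1.unpair.2 : ℚ)) / ((m.unpair.2 : ℚ) + 1)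

/-- `x` is a fast converging Cauchy sequence of rationals with limit `r`. -/
def CodesReal (x : ℕ → ℕ) (r : ℝ) : Prop :=
  (∀ n i : ℕ, |ratOf (x n) - ratOf (x (n + i))| < 1 / 2 ^ n) ∧
    Filter.Tendsto (fun n => (ratOf (x n) : ℝ)) Filter.atTop (nhds r)

inductive Dom : Type
  | baire | cantor | unit | line

/-- The points of a domain. -/
def Dom.Pt : Dom → Type
  | .baire => ℕ → ℕ
  | .cantor => ℕ → Bool
  | .unit => unitInterval
  | .line => ℝ

/-- `D.Names x p`: the type `1` object `x` represents the point `p`. -/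
def Dom.Names : (D : Dom) → (ℕ → ℕ) → D.Pt → Prop
  | .baire, x, p => x = p
  | .cantor, x, p => ∀ n, x n = Bool.toNat (p n)
  | .unit, x, p => CodesReal x (p : unitInterval).1
  | .line, x, p => CodesReal x p

/-- The type `2` object `G` represents the function `g` from the domain to `ℕ`. -/
def Dom.RepFun (D : Dom) (G : Tot Ty.two) (g : D.Pt → ℕ) : Prop :=
  ∀ (x : ℕ → ℕ) (p : D.Pt), D.Names x p → G x = g p

/-- The type `2` object `G` represents the characteristic function of the set `X`. -/
def Dom.RepSet (D : Dom) (G : Tot Ty.two) (X : Set D.Pt) : Prop :=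
  D.RepFun G (X.indicator fun _ => 1)

/-- The `i`-th entry of the finite sequence of type `1` objects coded by `s`. -/
def entry (s : ℕ → ℕ) (i : ℕ) : ℕ → ℕ := fun k => s (Nat.pair i k + 1)

/-- `s` codes a finite sequence of type `1` objects (its length is `s 0`)
that represents the finite sequence `l` of points. -/
def Dom.NamesList (D : Dom) (s : ℕ → ℕ) (l : List D.Pt) : Prop :=
  s 0 = l.length ∧ ∀ (i : ℕ) (h : i < l.length), D.Names (entry s i) l[i]

/-- `s` codes a finite sequence of points that includes all elements of `X`. -/
def Dom.Lists (D : Dom) (X : Set D.Pt) (s : Tot Ty.one) : Prop :=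
  ∃ l : List D.Pt, D.NamesList s l ∧ ∀ p ∈ X, p ∈ l

/-- `e` is an enumeration of `A`: a sequence of one-element sequences `⟨xₙ⟩` where the `xₙ` are
exactly the elements of `A`; the enumeration of the empty set is the null sequence, all of whose
terms are the empty sequence `⟨⟩`. -/
def Dom.Enumerates (D : Dom) (A : Set D.Pt) (e : Tot (Ty.nat ⇒ Ty.one)) : Prop :=
  (∃ x : ℕ → D.Pt, Set.range x = A ∧ ∀ n : ℕ, D.NamesList (e n) [x n]) ∨
    (A = ∅ ∧ ∀ n : ℕ, D.NamesList (e n) [])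

/-! ### Functionals on sets of points -/

/-- The partial functionals `Φ(X)` of a set `X`, defined exactly when `dom X` holds, and whose
value `y` then satisfies `out X y`. -/
def Dom.SetFunctional (D : Dom) (τ : Ty) (dom : Set D.Pt → Prop)
    (out : Set D.Pt → Tot τ → Prop) : Set (Par (Ty.two ⇒ τ)) :=
  {Φ | ∀ G : Tot Ty.two,
    (∀ X, D.RepSet G X → dom X → ∃ y : Tot τ, Φ G = toPar y ∧ out X y) ∧
    ((∀ X, D.RepSet G X → ¬ dom X) → Φ G = ⊥)}

/-- The same for functionals `Φ(A, Y)` of a set `A` and a function `Y` into `ℕ`. -/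
def Dom.SetFunFunctional (D : Dom) (τ : Ty) (dom : Set D.Pt → (D.Pt → ℕ) → Prop)
    (out : Set D.Pt → Tot τ → Prop) : Set (Par (Ty.two ⇒ Ty.two ⇒ τ)) :=
  {Φ | ∀ G H : Tot Ty.two,
    (∀ A Y, D.RepSet G A → D.RepFun H Y → dom A Y → ∃ y : Tot τ, Φ G H = toPar y ∧ out A y) ∧
    ((∀ A Y, D.RepSet G A → D.RepFun H Y → ¬ dom A Y) → Φ G H = ⊥)}

/-- `Ω₁`: defined on singletons `{p}`, with value `p`. -/
def OmegaOne (D : Dom) : Set (Par (Ty.two ⇒ Ty.one)) :=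
  D.SetFunctional Ty.one (fun X => ∃ p, X = {p}) (fun X y => ∃ p, X = {p} ∧ D.Names y p)

/-- `Ω`: defined if `|X| ≤ 1`, outputs a finite sequence that includes all elements of `X`. -/
def Omega (D : Dom) : Set (Par (Ty.two ⇒ Ty.one)) :=
  D.SetFunctional Ty.one (fun X => X.encard ≤ 1) D.Lists

/-- `Ω_n` on `[0,1]`. -/
def OmegaEq (n : ℕ) : Set (Par (Ty.two ⇒ Ty.one)) :=
  Dom.unit.SetFunctional Ty.one (fun X => X.encard = n) Dom.unit.Lists

/-- `Ω_{≤n}` on `[0,1]`. -/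
def OmegaLe (n : ℕ) : Set (Par (Ty.two ⇒ Ty.one)) :=
  Dom.unit.SetFunctional Ty.one (fun X => X.encard ≤ n) Dom.unit.Lists

/-- `Ω_fin` on `[0,1]`. -/
def OmegaFin : Set (Par (Ty.two ⇒ Ty.one)) :=
  Dom.unit.SetFunctional Ty.one (fun X => X.Finite) Dom.unit.Lists

/-- `Ω_{#,fin}` on `[0,1]`: outputs the cardinality of a finite set. -/
def OmegaCard : Set (Par (Ty.two ⇒ Ty.nat)) :=
  Dom.unit.SetFunctional Ty.nat (fun X => X.Finite) (fun X (n : ℕ) => X.encard = n)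

/-- `Ω_{≥#,fin}` on `[0,1]`: outputs an upper bound on the cardinality of a finite set. -/
def OmegaCardBound : Set (Par (Ty.two ⇒ Ty.nat)) :=
  Dom.unit.SetFunctional Ty.nat (fun X => X.Finite) (fun X (n : ℕ) => X.encard ≤ n)

/-- Enumeration functionals: the input is `A ⊆ [0,1]` and `Y` injective on `A`. -/
def EnumerationFunctional : Set (Par (Ty.two ⇒ Ty.two ⇒ Ty.nat ⇒ Ty.one)) :=
  Dom.unit.SetFunFunctional (Ty.nat ⇒ Ty.one) (fun A Y => Set.InjOn Y A) Dom.unit.Enumerates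

/-- Weak enumeration functionals: moreover, `Y` maps `A` onto `ℕ`. -/
def WeakEnumerationFunctional : Set (Par (Ty.two ⇒ Ty.two ⇒ Ty.nat ⇒ Ty.one)) :=
  Dom.unit.SetFunFunctional (Ty.nat ⇒ Ty.one)
    (fun A Y => Set.InjOn Y A ∧ Set.SurjOn Y A Set.univ) Dom.unit.Enumerates

/-- `y` represents the supremum of `A` in the ordered set `[0,1]` (in particular `sup ∅ = 0`). -/
def NamesSup (A : Set Dom.unit.Pt) (y : Tot Ty.one) : Prop :=
  ∃ p : unitInterval, IsLUB (show Set unitInterval from A) p ∧ Dom.unit.Names y p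

/-- `Ω_BW`: the input is `A ⊆ [0,1]` and `Y` injective on `A`, the output is `sup A`. -/
def OmegaBW : Set (Par (Ty.two ⇒ Ty.two ⇒ Ty.one)) :=
  Dom.unit.SetFunFunctional Ty.one (fun A Y => Set.InjOn Y A) NamesSup

/-- The weak `Ω_BW`: moreover, `Y` maps `A` onto `ℕ`. -/
def WeakOmegaBW : Set (Par (Ty.two ⇒ Ty.two ⇒ Ty.one)) :=
  Dom.unit.SetFunFunctional Ty.one
    (fun A Y => Set.InjOn Y A ∧ Set.SurjOn Y A Set.univ) NamesSup

end HigherType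

namespace HigherType

/-! ### Renaming and substitution -/

/-! Every class is compared with a few functionals on subsets of the Baire space, the hubs. For
`Omega` these are `nonemptyHub`, `subsingletonHub` and `finiteHub`; for `OmegaOne` they are `bitHub`
and `singletonHub`. By `inCluster_of_hubs` three facts suffice: the weakest hub is computable in
every functional of each class, some element of each class is computable in the strongest hub, and
the strongest hub is computable in the weakest one. Since `Omega D` and `OmegaOne D` are compared
with the same hubs for all `D`, the choice of the domain does not matter.

Collapse of the hubs. The element of a set with at most one element is read off from the
nonemptiness of its intersections with the basic sets `x j = m` (`subsingletonHub_le`). A finite set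
is listed by a recursion on its cardinality (`finiteHub_le`): its sorted code is the only element of
a set of type 1 objects whose characteristic function is decided by the values at the smaller sets
`X \ {x}`. For singletons, prefixing the element with one bit of information about its graph lets
`bitHub` reveal every value (`singletonHub_le`).

Transfer between domains. `DomCode` provides canonical names, computable in `∃²` from arbitrary
names, and an embedding of the Baire space with a computable decoding. A subset of the Baire space
is pushed into the domain by `push`; a subset of the domain is replaced by its set of canonical
names by `canon`.

Lower bounds come from pushing a modified set: tagged copies adjust the cardinality, or make a
coordinate function injective or surjective on the set, while the wanted bit stays readable from the
output. Upper bounds come from applying a hub to the canonical names of the input, or to each fibre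
of `Y`, and postprocessing the answers with `∃²`. -/

/-- Lifting of a renaming under a binder. -/
def Var.liftRen {Γ Δ : List Ty} (r : ∀ σ, Var Γ σ → Var Δ σ) (α : Ty) :
    ∀ σ, Var (α :: Γ) σ → Var (α :: Δ) σ
  | _, .zero => .zero
  | _, .succ x => .succ (r _ x)

/-- Renaming of the free variables of a term. -/
noncomputable def Term.rename {Γ : List Ty} {σ : Ty} (t : Term Γ σ) :
    ∀ {Δ : List Ty}, (∀ σ, Var Γ σ → Var Δ σ) → Term Δ σ := by
  induction t with
  | var x => exact fun r => .var (r _ x)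
  | zero => exact fun _ => .zero
  | suc => exact fun _ => .suc
  | pred => exact fun _ => .pred
  | caseOf _ _ _ c t e => exact fun r => .caseOf (c r) (t r) (e r)
  | app _ _ t s => exact fun r => .app (t r) (s r)
  | lam h _ t => exact fun r => .lam h (t (Var.liftRen r _))
  | mu h _ t => exact fun r => .mu h (t (Var.liftRen r _))

theorem Term.eval_rename {Γ : List Ty} {σ : Ty} (t : Term Γ σ) :
    ∀ {Δ : List Ty} (r : ∀ σ, Var Γ σ → Var Δ σ) (ρ : Env Γ) (ρ' : Env Δ),
      (∀ σ (x : Var Γ σ), Env.get (r σ x) ρ' = Env.get x ρ) →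
        (t.rename r).eval ρ' = t.eval ρ := by
  have lift : ∀ {Γ Δ : List Ty} {α : Ty} {r : ∀ σ, Var Γ σ → Var Δ σ} {ρ : Env Γ} {ρ' : Env Δ},
      (∀ σ (x : Var Γ σ), Env.get (r σ x) ρ' = Env.get x ρ) → ∀ (a : Par α) σ
        (x : Var (α :: Γ) σ), Env.get (Γ := α :: Δ) (Var.liftRen r α σ x) (a, ρ') =
          Env.get (Γ := α :: Γ) x (a, ρ) := by
    intro Γ Δ α r ρ ρ' h a σ x
    cases x with
    | zero => rfl
    | succ x => exact h _ x
  induction t with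
  | var x => exact fun r ρ ρ' h => h _ x
  | zero => exact fun _ _ _ _ => rfl
  | suc => exact fun _ _ _ _ => rfl
  | pred => exact fun _ _ _ _ => rfl
  | caseOf _ _ _ c t e =>
    intro Δ r ρ ρ' h
    show caseNat _ _ _ = caseNat _ _ _
    exact congr (congr (congrArg _ (c r ρ ρ' h)) (t r ρ ρ' h)) (e r ρ ρ' h)
  | app _ _ t s =>
    intro Δ r ρ ρ' h
    exact congr (congrArg Par.app (t r ρ ρ' h)) (s r ρ ρ' h)
  | lam _ _ t =>
    intro Δ r ρ ρ' h
    exact funext fun x => t _ _ _ (lift h (toPar x))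
  | mu _ _ t =>
    intro Δ r ρ ρ' h
    exact congrArg Par.lfp (funext fun y => t _ _ _ (lift h y))

/-- Weakening by one variable. -/
noncomputable def Term.wk {Γ : List Ty} {σ α : Ty} (t : Term Γ σ) : Term (α :: Γ) σ :=
  t.rename fun _ x => .succ x

@[simp]
theorem Term.eval_wk {Γ : List Ty} {σ α : Ty} (t : Term Γ σ) (a : Par α) (ρ : Env Γ) :
    (t.wk (α := α)).eval (a, ρ) = t.eval ρ :=
  t.eval_rename _ _ _ fun _ _ => rfl

/-- Lifting of a substitution under a binder. -/
noncomputable def Term.liftSub {Γ Δ : List Ty} (r : ∀ σ, Var Γ σ → Term Δ σ) (α : Ty) :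
    ∀ σ, Var (α :: Γ) σ → Term (α :: Δ) σ
  | _, .zero => .var .zero
  | _, .succ x => (r _ x).wk

/-- Simultaneous substitution of terms for the free variables of a term. -/
noncomputable def Term.subst {Γ : List Ty} {σ : Ty} (t : Term Γ σ) :
    ∀ {Δ : List Ty}, (∀ σ, Var Γ σ → Term Δ σ) → Term Δ σ := by
  induction t with
  | var x => exact fun r => r _ x
  | zero => exact fun _ => .zero
  | suc => exact fun _ => .suc
  | pred => exact fun _ => .pred
  | caseOf _ _ _ c t e => exact fun r => .caseOf (c r) (t r) (e r)
  | app _ _ t s => exact fun r => .app (t r) (s r)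
  | lam h _ t => exact fun r => .lam h (t (Term.liftSub r _))
  | mu h _ t => exact fun r => .mu h (t (Term.liftSub r _))

theorem Term.eval_subst {Γ : List Ty} {σ : Ty} (t : Term Γ σ) :
    ∀ {Δ : List Ty} (r : ∀ σ, Var Γ σ → Term Δ σ) (ρ : Env Γ) (ρ' : Env Δ),
      (∀ σ (x : Var Γ σ), (r σ x).eval ρ' = Env.get x ρ) →
        (t.subst r).eval ρ' = t.eval ρ := by
  have lift : ∀ {Γ Δ : List Ty} {α : Ty} {r : ∀ σ, Var Γ σ → Term Δ σ} {ρ : Env Γ} {ρ' : Env Δ},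
      (∀ σ (x : Var Γ σ), (r σ x).eval ρ' = Env.get x ρ) → ∀ (a : Par α) σ
        (x : Var (α :: Γ) σ), (Term.liftSub r α σ x).eval (a, ρ') =
          Env.get (Γ := α :: Γ) x (a, ρ) := by
    intro Γ Δ α r ρ ρ' h a σ x
    cases x with
    | zero => rfl
    | succ x => exact (Term.eval_wk _ _ _).trans (h _ x)
  induction t with
  | var x => exact fun r ρ ρ' h => h _ x
  | zero => exact fun _ _ _ _ => rfl
  | suc => exact fun _ _ _ _ => rfl
  | pred => exact fun _ _ _ _ => rfl
  | caseOf _ _ _ c t e =>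
    intro Δ r ρ ρ' h
    show caseNat _ _ _ = caseNat _ _ _
    exact congr (congr (congrArg _ (c r ρ ρ' h)) (t r ρ ρ' h)) (e r ρ ρ' h)
  | app _ _ t s =>
    intro Δ r ρ ρ' h
    exact congr (congrArg Par.app (t r ρ ρ' h)) (s r ρ ρ' h)
  | lam _ _ t =>
    intro Δ r ρ ρ' h
    exact funext fun x => t _ _ _ (lift h (toPar x))
  | mu _ _ t =>
    intro Δ r ρ ρ' h
    exact congrArg Par.lfp (funext fun y => t _ _ _ (lift h y))

/-- The term for `ψ` is substituted for the oracle variable. Its value may properly extend `ψ`,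
which is harmless because the interpretation is monotone. -/
theorem ComputableModE2.trans {σ τ υ : Ty} {χ : Par υ} {ψ : Par τ} {φ : Par σ}
    (h₁ : ComputableModE2 χ ψ) (h₂ : ComputableModE2 ψ φ) : ComputableModE2 χ φ := by
  obtain ⟨s, hs⟩ := h₁
  obtain ⟨t, ht⟩ := h₂
  let r : ∀ α, Var [τ, Ty.two] α → Term [σ, Ty.two] α := fun α x =>
    match α, x with
    | _, .zero => t
    | _, .succ y => .var (.succ y)
  refine ⟨s.subst r, hs.trans ?_⟩
  have key := s.eval_subst r
    ((t.eval ((φ, toPar existsTwo, ()) : Env [σ, Ty.two]), toPar existsTwo, ()) : Env [τ, Ty.two])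
    ((φ, toPar existsTwo, ()) : Env [σ, Ty.two]) (by
      intro α x
      cases x with
      | zero => rfl
      | succ y => rfl)
  rw [key]
  exact s.eval_mono ⟨ht, le_rfl, trivial⟩

/-! ### Application and fixed points -/

theorem toPar_injective : {σ : Ty} → Function.Injective (toPar : Tot σ → Par σ)
  | .nat => fun x y h => Part.some_injective (show (Part.some (x : ℕ)) = Part.some (y : ℕ) from h)
  | .arr _ _ => fun _ _ h => funext fun a => toPar_injective (congrFun h a)

@[simp]
theorem Par.app_toPar {σ τ : Ty} (u : Par (σ ⇒ τ)) (x : Tot σ) : Par.app u (toPar x) = u x := by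
  have h : ∃ y : Tot σ, toPar y = toPar x := ⟨x, rfl⟩
  rw [Par.app, dif_pos h, toPar_injective h.choose_spec]

theorem caseNat_some (n : ℕ) (t e : Part ℕ) :
    caseNat (Part.some n) t e = if n = 0 then t else e := by
  simp [caseNat]

theorem Term.eval_app {Γ : List Ty} {σ τ : Ty} {t : Term Γ (σ ⇒ τ)} {s : Term Γ σ} {ρ : Env Γ}
    {u : Par (σ ⇒ τ)} {x : Tot σ} (ht : t.eval ρ = u) (hs : s.eval ρ = toPar x) :
    (Term.app t s).eval ρ = u x := by
  show Par.app (t.eval ρ) (s.eval ρ) = _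
  rw [ht, hs, Par.app_toPar]

theorem Term.eval_caseOf_zero {Γ : List Ty} {c t e : Term Γ Ty.nat} {ρ : Env Γ} {n : ℕ}
    (hc : c.eval ρ = toPar (σ := Ty.nat) n) (hn : n = 0) :
    (Term.caseOf c t e).eval ρ = t.eval ρ := by
  show caseNat (c.eval ρ) (t.eval ρ) (e.eval ρ) = _
  rw [hc]
  exact (caseNat_some n _ _).trans (if_pos hn)

theorem Term.eval_caseOf_pos {Γ : List Ty} {c t e : Term Γ Ty.nat} {ρ : Env Γ} {n : ℕ}
    (hc : c.eval ρ = toPar (σ := Ty.nat) n) (hn : n ≠ 0) :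
    (Term.caseOf c t e).eval ρ = e.eval ρ := by
  show caseNat (c.eval ρ) (t.eval ρ) (e.eval ρ) = _
  rw [hc]
  exact (caseNat_some n _ _).trans (if_neg hn)

theorem Term.eval_mu {Γ : List Ty} {σ : Ty} (h : σ.rank ≤ 3) (t : Term (σ :: Γ) σ) (ρ : Env Γ) :
    (Term.mu h t).eval ρ = t.eval ((Term.mu h t).eval ρ, ρ) :=
  (Par.isLeast_lfp fun _ _ hxy => t.eval_mono ⟨hxy, Env.Le.rfl ρ⟩).1.symm

/-! ### Total functionals that are computable in `∃²` -/

/-- Assignments of total functionals to the variables of a context. -/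
def TEnv : List Ty → Type
  | [] => Unit
  | σ :: Γ => Tot σ × TEnv Γ

/-- The assignment of partial functionals given by a total assignment and `∃²`. -/
noncomputable def TEnv.toEnv : {Γ : List Ty} → TEnv Γ → Env (Γ ++ [Ty.two])
  | [], _ => (toPar existsTwo, ())
  | _ :: _, ρ => (toPar ρ.1, TEnv.toEnv ρ.2)

/-- The total functional `f` of the parameters in `Γ` is defined by a term in `∃²`. -/
def Rec {Γ : List Ty} {τ : Ty} (f : TEnv Γ → Tot τ) : Prop :=
  ∃ t : Term (Γ ++ [Ty.two]) τ, ∀ ρ, t.eval ρ.toEnv = toPar (f ρ)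

abbrev RecN {Γ : List Ty} (f : TEnv Γ → ℕ) : Prop := Rec (τ := Ty.nat) f
abbrev RecF {Γ : List Ty} (f : TEnv Γ → ℕ → ℕ) : Prop := Rec (τ := Ty.one) f

open Classical in
/-- The truth value of a proposition. -/
noncomputable def ind (p : Prop) : ℕ := if p then 1 else 0

theorem ind_true {p : Prop} (h : p) : ind p = 1 := if_pos h
theorem ind_false {p : Prop} (h : ¬ p) : ind p = 0 := if_neg h
@[simp] theorem ind_eq_one {p : Prop} : ind p = 1 ↔ p := by unfold ind; split_ifs <;> simp [*]
@[simp] theorem ind_eq_zero {p : Prop} : ind p = 0 ↔ ¬ p := by unfold ind; split_ifs <;> simp [*]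
theorem ind_congr {p q : Prop} (h : p ↔ q) : ind p = ind q := by rw [propext h]

abbrev RecP {Γ : List Ty} (p : TEnv Γ → Prop) : Prop := RecN fun ρ => ind (p ρ)

/-! ### Closure properties: recursion, arithmetic, number quantifiers and search -/

section Closure

variable {Γ : List Ty} {σ τ υ : Ty}

theorem Rec.of_eq {f g : TEnv Γ → Tot τ} (hf : Rec f) (h : ∀ ρ, f ρ = g ρ) : Rec g := by
  rwa [← funext h]

theorem RecN.of_eq {f g : TEnv Γ → ℕ} (hf : RecN f) (h : ∀ ρ, f ρ = g ρ) : RecN g :=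
  Rec.of_eq hf h

theorem RecP.of_iff {p q : TEnv Γ → Prop} (hp : RecP p) (h : ∀ ρ, p ρ ↔ q ρ) : RecP q :=
  Rec.of_eq hp fun ρ => ind_congr (h ρ)

theorem Rec.v0 : Rec (fun ρ : TEnv (σ :: Γ) => ρ.1) :=
  ⟨.var .zero, fun _ => rfl⟩

theorem Rec.wk {f : TEnv Γ → Tot τ} (hf : Rec f) : Rec (fun ρ : TEnv (σ :: Γ) => f ρ.2) := by
  obtain ⟨t, ht⟩ := hf
  exact ⟨t.wk, fun ρ => (t.eval_wk _ _).trans (ht ρ.2)⟩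

theorem Rec.const {F : Tot τ} (hF : Rec (Γ := []) fun _ => F) :
    ∀ {Γ : List Ty}, Rec fun _ : TEnv Γ => F
  | [] => hF
  | _ :: _ => (Rec.const hF).wk

theorem Rec.app {f : TEnv Γ → Tot σ → Tot τ} {g : TEnv Γ → Tot σ}
    (hf : Rec (τ := σ ⇒ τ) f) (hg : Rec g) : Rec fun ρ => f ρ (g ρ) := by
  obtain ⟨t, ht⟩ := hf
  obtain ⟨s, hs⟩ := hg
  exact ⟨.app t s, fun ρ => Term.eval_app (ht ρ) (hs ρ)⟩

theorem Rec.lam {f : TEnv Γ → Tot σ → Tot τ} (hf : Rec fun ρ : TEnv (σ :: Γ) => f ρ.2 ρ.1)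
    (h : (σ ⇒ τ).rank ≤ 3 := by decide) : Rec (τ := σ ⇒ τ) f := by
  obtain ⟨t, ht⟩ := hf
  exact ⟨.lam h t, fun ρ => funext fun x => ht (x, ρ)⟩

theorem RecF.app {f : TEnv Γ → ℕ → ℕ} {n : TEnv Γ → ℕ} (hf : RecF f) (hn : RecN n) :
    RecN fun ρ => f ρ (n ρ) :=
  Rec.app (σ := Ty.nat) (τ := Ty.nat) hf hn

theorem RecF.lam {f : TEnv Γ → ℕ → ℕ} (hf : RecN (Γ := Ty.nat :: Γ) fun ρ => f ρ.2 ρ.1) :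
    RecF f :=
  Rec.lam (σ := Ty.nat) (τ := Ty.nat) hf

theorem RecN.zero : RecN fun _ : TEnv Γ => 0 := ⟨.zero, fun _ => rfl⟩

theorem RecN.succ {f : TEnv Γ → ℕ} (hf : RecN f) : RecN fun ρ => f ρ + 1 :=
  RecF.app (f := fun _ n => n + 1) ⟨.suc, fun _ => rfl⟩ hf

theorem RecN.pred {f : TEnv Γ → ℕ} (hf : RecN f) : RecN fun ρ => f ρ - 1 :=
  RecF.app (f := fun _ n => n - 1) ⟨.pred, fun _ => rfl⟩ hf

theorem RecN.const : ∀ n : ℕ, RecN fun _ : TEnv Γ => n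
  | 0 => .zero
  | n + 1 => (RecN.const n).succ

theorem RecN.cond {c a b : TEnv Γ → ℕ} (hc : RecN c) (ha : RecN a) (hb : RecN b) :
    RecN fun ρ => if c ρ = 0 then a ρ else b ρ := by
  obtain ⟨c', hc⟩ := hc
  obtain ⟨a', ha⟩ := ha
  obtain ⟨b', hb⟩ := hb
  refine ⟨.caseOf c' a' b', fun ρ => ?_⟩
  by_cases h : c ρ = 0
  · exact (Term.eval_caseOf_zero (hc ρ) h).trans
      ((ha ρ).trans (congrArg (toPar (σ := Ty.nat)) (if_pos h).symm))
  · exact (Term.eval_caseOf_pos (hc ρ) h).trans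
      ((hb ρ).trans (congrArg (toPar (σ := Ty.nat)) (if_neg h).symm))

/-- Primitive recursion is the least fixed point of `F ↦ λ m, case m of a | h (m - 1) (F (m - 1))`;
one unfolding by `Term.eval_mu` for each step evaluates it at every number. -/
theorem RecN.natRec {a n : TEnv Γ → ℕ} {h : TEnv Γ → ℕ → ℕ → ℕ} (ha : RecN a)
    (hh : RecN (Γ := Ty.nat :: Ty.nat :: Γ) fun ρ => h ρ.2.2 ρ.2.1 ρ.1) (hn : RecN n) :
    RecN fun ρ => Nat.rec (a ρ) (h ρ) (n ρ) := by
  obtain ⟨a', ha⟩ := ha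
  obtain ⟨h', hh⟩ := Rec.lam (σ := Ty.nat) (τ := Ty.one) (f := h)
    (Rec.lam (σ := Ty.nat) (τ := Ty.nat) (f := fun (ρ : TEnv (Ty.nat :: Γ)) => h ρ.2 ρ.1) hh)
  have hF : RecF (Γ := Γ) fun ρ m => Nat.rec (a ρ) (h ρ) m := by
    let v : Term (Ty.nat :: Ty.one :: (Γ ++ [Ty.two])) Ty.nat := .app .pred (.var .zero)
    let M : Term (Γ ++ [Ty.two]) Ty.one := .mu (by decide) (.lam (by decide)
      (.caseOf (.var .zero) a'.wk.wk (.app (.app h'.wk.wk v) (.app (.var (.succ .zero)) v))))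
    refine ⟨M, fun ρ => funext fun m => ?_⟩
    change ℕ at m
    induction m with
    | zero =>
      rw [Term.eval_mu]
      refine (Term.eval_caseOf_zero (n := 0) rfl rfl).trans ?_
      exact ((Term.eval_wk _ _ _).trans (Term.eval_wk _ _ _)).trans (ha ρ)
    | succ m ih =>
      rw [Term.eval_mu]
      refine (Term.eval_caseOf_pos (n := m + 1) rfl m.succ_ne_zero).trans ?_
      have hv : ∀ F, v.eval (toPar (σ := Ty.nat) (m + 1 : ℕ), F, ρ.toEnv) =
          toPar (σ := Ty.nat) m := fun F =>
        Term.eval_app (σ := Ty.nat) (x := (m + 1 : ℕ)) rfl rfl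
      have hr := (Term.eval_app (t := .var (.succ .zero)) (u := M.eval ρ.toEnv) rfl
        (hv (M.eval ρ.toEnv))).trans ih
      have hhm := Term.eval_app (((Term.eval_wk h'.wk (toPar (σ := Ty.nat) (m + 1 : ℕ)) _).trans
        (Term.eval_wk h' _ _)).trans (hh ρ)) (hv (M.eval ρ.toEnv))
      exact Term.eval_app (u := toPar (σ := Ty.one) (h ρ m)) hhm hr
  exact hF.app hn

theorem RecN.add {f g : TEnv Γ → ℕ} (hf : RecN f) (hg : RecN g) : RecN fun ρ => f ρ + g ρ := by
  refine (RecN.natRec (h := fun _ _ m => m + 1) hf (RecN.succ Rec.v0) hg).of_eq fun ρ => ?_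
  induction g ρ with
  | zero => rfl
  | succ n ih => exact congrArg Nat.succ ih

theorem RecN.mul {f g : TEnv Γ → ℕ} (hf : RecN f) (hg : RecN g) : RecN fun ρ => f ρ * g ρ := by
  refine (RecN.natRec (h := fun ρ _ m => m + f ρ) .zero (RecN.add Rec.v0 hf.wk.wk) hg).of_eq
    fun ρ => ?_
  induction g ρ with
  | zero => rfl
  | succ n ih => exact congrArg (· + f ρ) ih

theorem RecN.pow {f g : TEnv Γ → ℕ} (hf : RecN f) (hg : RecN g) : RecN fun ρ => f ρ ^ g ρ := by
  refine (RecN.natRec (h := fun ρ _ m => m * f ρ) (.const 1) (RecN.mul Rec.v0 hf.wk.wk) hg).of_eq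
    fun ρ => ?_
  induction g ρ with
  | zero => rfl
  | succ n ih => exact congrArg (· * f ρ) ih

theorem RecN.sub {f g : TEnv Γ → ℕ} (hf : RecN f) (hg : RecN g) : RecN fun ρ => f ρ - g ρ := by
  refine (RecN.natRec (h := fun _ _ m => m - 1) hf (RecN.pred Rec.v0) hg).of_eq fun ρ => ?_
  induction g ρ with
  | zero => rfl
  | succ n ih => exact congrArg Nat.pred ih

theorem RecP.eq_zero {f : TEnv Γ → ℕ} (hf : RecN f) : RecP fun ρ => f ρ = 0 :=
  (hf.cond (.const 1) .zero).of_eq fun _ => by unfold ind; congr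

theorem RecP.not {p : TEnv Γ → Prop} (hp : RecP p) : RecP fun ρ => ¬ p ρ :=
  (RecP.eq_zero hp).of_iff fun _ => ind_eq_zero

theorem RecP.and {p q : TEnv Γ → Prop} (hp : RecP p) (hq : RecP q) : RecP fun ρ => p ρ ∧ q ρ :=
  (RecN.mul hp hq).of_eq fun ρ => by unfold ind; split_ifs <;> simp_all

theorem RecP.or {p q : TEnv Γ → Prop} (hp : RecP p) (hq : RecP q) : RecP fun ρ => p ρ ∨ q ρ :=
  (hp.not.and hq.not).not.of_iff fun _ => by tauto

theorem RecP.imp {p q : TEnv Γ → Prop} (hp : RecP p) (hq : RecP q) : RecP fun ρ => p ρ → q ρ :=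
  (hp.not.or hq).of_iff fun _ => by tauto

theorem RecP.le {f g : TEnv Γ → ℕ} (hf : RecN f) (hg : RecN g) : RecP fun ρ => f ρ ≤ g ρ :=
  (RecP.eq_zero (hf.sub hg)).of_iff fun _ => Nat.sub_eq_zero_iff_le

theorem RecP.lt {f g : TEnv Γ → ℕ} (hf : RecN f) (hg : RecN g) : RecP fun ρ => f ρ < g ρ :=
  RecP.le hf.succ hg

theorem RecP.eq {f g : TEnv Γ → ℕ} (hf : RecN f) (hg : RecN g) : RecP fun ρ => f ρ = g ρ :=
  ((RecP.le hf hg).and (RecP.le hg hf)).of_iff fun _ => le_antisymm_iff.symm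

open Classical in
theorem RecN.ite {p : TEnv Γ → Prop} {f g : TEnv Γ → ℕ} (hp : RecP p) (hf : RecN f)
    (hg : RecN g) : RecN fun ρ => if p ρ then f ρ else g ρ :=
  (RecN.cond hp hg hf).of_eq fun ρ => by simp only [ind_eq_zero, ite_not]

theorem Rec.existsTwo : ∀ {Γ : List Ty}, Rec (τ := Ty.two) fun _ : TEnv Γ => existsTwo
  | [] => ⟨.var .zero, fun _ => rfl⟩
  | _ :: _ => Rec.existsTwo.wk

theorem RecP.ex {p : TEnv Γ → ℕ → Prop} (hp : RecP (Γ := Ty.nat :: Γ) fun ρ => p ρ.2 ρ.1) :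
    RecP fun ρ => ∃ n, p ρ n := by
  -- `∃²` looks for a zero and signals success by `0`, hence the negation here and the test for `0`
  -- below.
  have h1 : RecF fun ρ n => ind (¬ p ρ n) := RecF.lam (RecP.not hp)
  refine (RecP.eq_zero (f := fun ρ => HigherType.existsTwo fun n : ℕ => ind (¬ p ρ n))
    (Rec.app (σ := Ty.one) (τ := Ty.nat) Rec.existsTwo h1)).of_iff fun ρ => ?_
  by_cases h : ∃ n, p ρ n
  · simp [HigherType.existsTwo, h]
  · simp [HigherType.existsTwo, h]

theorem RecP.all {p : TEnv Γ → ℕ → Prop} (hp : RecP (Γ := Ty.nat :: Γ) fun ρ => p ρ.2 ρ.1) :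
    RecP fun ρ => ∀ n, p ρ n :=
  (RecP.ex (p := fun ρ n => ¬ p ρ n) (RecP.not hp)).not.of_iff fun _ => by simp

/-- Unbounded search, with default value `0`. -/
theorem RecN.sInf {p : TEnv Γ → ℕ → Prop} (hp : RecP (Γ := Ty.nat :: Γ) fun ρ => p ρ.2 ρ.1) :
    RecN fun ρ => sInf {n | p ρ n} := by
  obtain ⟨e, he⟩ := RecP.ex hp
  obtain ⟨q, hq⟩ := RecF.lam (f := fun ρ n => ind (p ρ n)) hp
  -- The search `S n = if p n then n else S (n + 1)`; the first branch of `caseOf` is the one for `p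
  -- n` false.
  let S : Term (Γ ++ [Ty.two]) Ty.one := .mu (by decide) (.lam (by decide)
    (.caseOf (.app q.wk.wk (.var .zero)) (.app (.var (.succ .zero)) (.app .suc (.var .zero)))
      (.var .zero)))
  have hc : ∀ {ρ : TEnv Γ} (F : Par Ty.one) (n : ℕ), (Term.app q.wk.wk (.var .zero)).eval
      ((toPar (σ := Ty.nat) n, F, ρ.toEnv) : Env (Ty.nat :: Ty.one :: (Γ ++ [Ty.two]))) =
        toPar (σ := Ty.nat) (ind (p ρ n)) := fun {ρ} F n =>
    Term.eval_app (u := toPar (σ := Ty.one) fun n => ind (p ρ n)) (x := n)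
      (((Term.eval_wk _ _ _).trans (Term.eval_wk _ _ _)).trans (hq ρ)) rfl
  have hS : ∀ ρ : TEnv Γ, ∀ k n : ℕ, p ρ (n + k) → (∀ i < k, ¬ p ρ (n + i)) →
      S.eval ρ.toEnv n = toPar (σ := Ty.nat) (n + k : ℕ) := by
    intro ρ k
    induction k with
    | zero =>
      intro n hn _
      rw [Term.eval_mu]
      exact Term.eval_caseOf_pos (hc _ n) (by rw [Ne, ind_eq_zero]; exact not_not.2 hn)
    | succ k ih =>
      intro n hn hlt
      rw [Term.eval_mu]
      refine (Term.eval_caseOf_zero (hc _ n) (ind_eq_zero.2 (hlt 0 k.succ_pos))).trans ?_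
      refine (Term.eval_app rfl (Term.eval_app (σ := Ty.nat) (x := n) rfl rfl)).trans ?_
      rw [← Nat.add_assoc, Nat.add_right_comm] at hn ⊢
      refine ih (n + 1) hn fun i hi => ?_
      rw [Nat.add_right_comm]
      exact hlt (i + 1) (Nat.succ_lt_succ hi)
  -- `∃²` decides in advance whether the search succeeds, so the divergent one is never evaluated
  -- and the default `0` agrees with `sInf ∅`.
  refine ⟨.caseOf e .zero (.app S .zero), fun ρ => ?_⟩
  by_cases h : ∃ n, p ρ n
  · refine (Term.eval_caseOf_pos (he ρ) (by rw [Ne, ind_eq_zero]; exact not_not.2 h)).trans ?_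
    refine (Term.eval_app (σ := Ty.nat) (x := (0 : ℕ)) rfl rfl).trans ?_
    have h0 := hS ρ (InfSet.sInf {n | p ρ n}) 0 (by rw [Nat.zero_add]; exact Nat.sInf_mem h)
      (fun i hi => by rw [Nat.zero_add]; exact Nat.notMem_of_lt_sInf hi)
    rwa [Nat.zero_add] at h0
  · refine (Term.eval_caseOf_zero (he ρ) (ind_eq_zero.2 h)).trans ?_
    have : {n | p ρ n} = ∅ := Set.eq_empty_of_forall_notMem fun n hn => h ⟨n, hn⟩
    exact congrArg (toPar (σ := Ty.nat)) ((congrArg InfSet.sInf this).trans Nat.sInf_empty).symm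

open Classical in
theorem RecN.pair {f g : TEnv Γ → ℕ} (hf : RecN f) (hg : RecN g) :
    RecN fun ρ => Nat.pair (f ρ) (g ρ) :=
  (RecN.ite (RecP.lt hf hg) ((hg.mul hg).add hf) (((hf.mul hf).add hf).add hg)).of_eq fun ρ => by
    unfold Nat.pair; congr

theorem RecN.left {f : TEnv Γ → ℕ} (hf : RecN f) : RecN fun ρ => (f ρ).unpair.1 := by
  refine (RecN.sInf (p := fun ρ a => ∃ b, Nat.pair a b = f ρ)
    (RecP.ex (p := fun (ρ : TEnv (Ty.nat :: Γ)) b => Nat.pair ρ.1 b = f ρ.2)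
      (RecP.eq (RecN.pair (Rec.wk Rec.v0) Rec.v0) hf.wk.wk))).of_eq fun ρ => ?_
  have : {a | ∃ b, Nat.pair a b = f ρ} = {(f ρ).unpair.1} := by
    ext a
    constructor
    · rintro ⟨b, hb⟩
      simp [← hb]
    · rintro rfl
      exact ⟨_, Nat.pair_unpair _⟩
  rw [this, csInf_singleton]

theorem RecN.right {f : TEnv Γ → ℕ} (hf : RecN f) : RecN fun ρ => (f ρ).unpair.2 := by
  refine (RecN.sInf (p := fun ρ b => ∃ a, Nat.pair a b = f ρ)
    (RecP.ex (p := fun (ρ : TEnv (Ty.nat :: Γ)) a => Nat.pair a ρ.1 = f ρ.2)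
      (RecP.eq (RecN.pair Rec.v0 (Rec.wk Rec.v0)) hf.wk.wk))).of_eq fun ρ => ?_
  have : {b | ∃ a, Nat.pair a b = f ρ} = {(f ρ).unpair.2} := by
    ext a
    constructor
    · rintro ⟨b, hb⟩
      simp [← hb]
    · rintro rfl
      exact ⟨_, Nat.pair_unpair _⟩
  rw [this, csInf_singleton]

theorem RecP.funEq {f g : TEnv Γ → ℕ → ℕ} (hf : RecF f) (hg : RecF g) :
    RecP fun ρ => f ρ = g ρ :=
  (RecP.all (p := fun ρ n => f ρ n = g ρ n)
    (RecP.eq (RecF.app hf.wk Rec.v0) (RecF.app hg.wk Rec.v0))).of_iff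
    fun _ => funext_iff.symm

end Closure

/-! ### Computations with a partial functional as oracle -/

/-- The total functional `F` is computable in `∃²`. -/
abbrev IsRec {τ : Ty} (F : Tot τ) : Prop := Rec (Γ := []) fun _ => F

/-- A reduction need only be correct where the target is defined; elsewhere it may return anything.
-/
theorem Par.le_of_ne_bot {σ τ : Ty} {u v : Par (σ ⇒ τ)} (h : ∀ x, u x ≠ ⊥ → u x ≤ v x) :
    u ≤ v := fun x => by
  by_cases hx : u x = ⊥
  · rw [hx]
    exact bot_le
  · exact h x hx

/-- Reduction of `ψ` to `φ` by countably many queries in parallel. -/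
theorem computable_of_queries {α τ : Ty} {φ : Par (Ty.two ⇒ α)} {ψ : Par (Ty.two ⇒ τ)}
    {prep : Tot (Ty.two ⇒ Ty.nat ⇒ Ty.two)} {post : Tot (Ty.two ⇒ (Ty.nat ⇒ α) ⇒ τ)}
    (hprep : IsRec prep) (hpost : IsRec post)
    (h : ∀ G, ψ G ≠ ⊥ → ∃ y : Tot (Ty.nat ⇒ α),
      (∀ n, φ (prep G n) = toPar (y n)) ∧ ψ G = toPar (post G y))
    (hα : (Ty.nat ⇒ α).rank ≤ 3 := by decide) (hτ : (Ty.two ⇒ τ).rank ≤ 3 := by decide) :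
    ComputableModE2 ψ φ := by
  obtain ⟨p, hp⟩ := hprep
  obtain ⟨q, hq⟩ := hpost
  refine ⟨.lam hτ (.app (.app q.wk.wk (.var .zero)) (.lam hα (.app (.var (.succ (.succ .zero)))
    (.app (.app p.wk.wk.wk (.var (.succ .zero))) (.var .zero))))), Par.le_of_ne_bot fun G hG => ?_⟩
  obtain ⟨y, hy, hψ⟩ := h G hG
  rw [hψ]
  refine le_of_eq (Eq.symm (Term.eval_app (u := toPar (post G)) (x := y) ?_ ?_))
  · exact Term.eval_app (u := toPar post) (x := G)
      (((Term.eval_wk _ _ _).trans (Term.eval_wk _ _ _)).trans (hq ())) rfl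
  -- Every query is answered, so the sequence of answers is a total object; otherwise the
  -- application of `post` would be undefined.
  · refine funext fun n => Eq.trans ?_ (hy n)
    refine Term.eval_app (u := φ) (x := prep G n) rfl ?_
    refine Term.eval_app (u := toPar (prep G)) (x := n) ?_ rfl
    exact Term.eval_app (u := toPar prep) (x := G) (((Term.eval_wk _ _ _).trans
      ((Term.eval_wk _ _ _).trans (Term.eval_wk _ _ _))).trans (hp ())) rfl

theorem computable_of_queries₂ {α τ : Ty} {φ : Par (Ty.two ⇒ α)} {ψ : Par (Ty.two ⇒ Ty.two ⇒ τ)}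
    {prep : Tot (Ty.two ⇒ Ty.two ⇒ Ty.nat ⇒ Ty.two)}
    {post : Tot (Ty.two ⇒ Ty.two ⇒ (Ty.nat ⇒ α) ⇒ τ)}
    (hprep : IsRec prep) (hpost : IsRec post)
    (h : ∀ G H, ψ G H ≠ ⊥ → ∃ y : Tot (Ty.nat ⇒ α),
      (∀ n, φ (prep G H n) = toPar (y n)) ∧ ψ G H = toPar (post G H y))
    (hα : (Ty.nat ⇒ α).rank ≤ 3 := by decide)
    (hτ : (Ty.two ⇒ Ty.two ⇒ τ).rank ≤ 3 := by decide)
    (hτ' : (Ty.two ⇒ τ).rank ≤ 3 := by decide) :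
    ComputableModE2 ψ φ := by
  obtain ⟨p, hp⟩ := hprep
  obtain ⟨q, hq⟩ := hpost
  refine ⟨.lam hτ (.lam hτ' (.app (.app (.app q.wk.wk.wk (.var (.succ .zero))) (.var .zero))
    (.lam hα (.app (.var (.succ (.succ (.succ .zero)))) (.app (.app (.app p.wk.wk.wk.wk
      (.var (.succ (.succ .zero)))) (.var (.succ .zero))) (.var .zero)))))),
    fun G => Par.le_of_ne_bot fun H hGH => ?_⟩
  obtain ⟨y, hy, hψ⟩ := h G H hGH
  rw [hψ]
  refine le_of_eq (Eq.symm (Term.eval_app (u := toPar (post G H)) (x := y) ?_ ?_))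
  · refine Term.eval_app (u := toPar (post G)) (x := H) ?_ rfl
    exact Term.eval_app (u := toPar post) (x := G) (((Term.eval_wk _ _ _).trans
      ((Term.eval_wk _ _ _).trans (Term.eval_wk _ _ _))).trans (hq ())) rfl
  · refine funext fun n => Eq.trans ?_ (hy n)
    refine Term.eval_app (u := φ) (x := prep G H n) rfl ?_
    refine Term.eval_app (u := toPar (prep G H)) (x := n) ?_ rfl
    refine Term.eval_app (u := toPar (prep G)) (x := H) ?_ rfl
    exact Term.eval_app (u := toPar prep) (x := G) (((Term.eval_wk _ _ _).trans
      ((Term.eval_wk _ _ _).trans ((Term.eval_wk _ _ _).trans (Term.eval_wk _ _ _)))).trans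
        (hp ())) rfl

/-- Reduction of `ψ` to a functional `φ` with two arguments, by one query. -/
theorem computable_of_query₂ {α τ : Ty} {φ : Par (Ty.two ⇒ Ty.two ⇒ α)} {ψ : Par (Ty.two ⇒ τ)}
    {prep₁ : Tot (Ty.two ⇒ Ty.two)} {prep₂ : Tot Ty.two} {post : Tot (α ⇒ τ)}
    (hprep₁ : IsRec prep₁) (hprep₂ : IsRec prep₂) (hpost : IsRec post)
    (h : ∀ G, ψ G ≠ ⊥ → ∃ y : Tot α, φ (prep₁ G) prep₂ = toPar y ∧ ψ G = toPar (post y))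
    (hτ : (Ty.two ⇒ τ).rank ≤ 3 := by decide) :
    ComputableModE2 ψ φ := by
  obtain ⟨p₁, hp₁⟩ := hprep₁
  obtain ⟨p₂, hp₂⟩ := hprep₂
  obtain ⟨q, hq⟩ := hpost
  refine ⟨.lam hτ (.app q.wk.wk (.app (.app (.var (.succ .zero)) (.app p₁.wk.wk (.var .zero)))
    p₂.wk.wk)), Par.le_of_ne_bot fun G hG => ?_⟩
  obtain ⟨y, hy, hψ⟩ := h G hG
  rw [hψ]
  refine le_of_eq (Eq.symm (Term.eval_app (u := toPar post) (x := y)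
    (((Term.eval_wk _ _ _).trans (Term.eval_wk _ _ _)).trans (hq ())) (Eq.trans ?_ hy)))
  refine Term.eval_app (u := φ (prep₁ G)) (x := prep₂) ?_
    (((Term.eval_wk _ _ _).trans (Term.eval_wk _ _ _)).trans (hp₂ ()))
  refine Term.eval_app (u := φ) (x := prep₁ G) rfl ?_
  exact Term.eval_app (u := toPar prep₁) (x := G)
    (((Term.eval_wk _ _ _).trans (Term.eval_wk _ _ _)).trans (hp₁ ())) rfl

/-- Reduction of `ψ` to `φ` by a well-founded recursion: the query made for `G` depends on the
values at the smaller inputs `rem G s`. -/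
theorem computable_of_recursion {φ ψ : Par (Ty.two ⇒ Ty.one)}
    {A : Tot Ty.two → Tot Ty.one → ℕ} {rem : Tot (Ty.two ⇒ Ty.one ⇒ Ty.two)}
    {B : Tot Ty.one → Tot Ty.one → ℕ} {post : Tot (Ty.one ⇒ Ty.one)}
    (hA : IsRec (τ := Ty.two ⇒ Ty.one ⇒ Ty.nat) A) (hrem : IsRec rem)
    (hB : IsRec (τ := Ty.one ⇒ Ty.one ⇒ Ty.nat) B) (hpost : IsRec post) (dom : Tot Ty.two → Prop) (μ : Tot Ty.two → ℕ)
    (val : Tot Ty.two → Tot Ty.one)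
    (hrec : ∀ G, dom G → ∀ s, A G s ≠ 0 → dom (rem G s) ∧ μ (rem G s) < μ G)
    (hval : ∀ G, dom G → ∃ y, φ (fun s => if A G s = 0 then (0 : ℕ) else
      B s (val (rem G s))) = toPar y ∧ val G = post y)
    (hψ : ∀ G, ψ G ≠ ⊥ → dom G ∧ ψ G = toPar (val G)) : ComputableModE2 ψ φ := by
  obtain ⟨a, ha⟩ := hA
  obtain ⟨r, hr⟩ := hrem
  obtain ⟨b, hb⟩ := hB
  obtain ⟨q, hq⟩ := hpost
  let M : Term [Ty.two ⇒ Ty.one, Ty.two] (Ty.two ⇒ Ty.one) := .mu (by decide) (.lam (by decide)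
    (.app q.wk.wk.wk (.app (.var (.succ (.succ .zero))) (.lam (by decide) (.caseOf
      (.app (.app a.wk.wk.wk.wk (.var (.succ .zero))) (.var .zero)) .zero
      (.app (.app b.wk.wk.wk.wk (.var .zero)) (.app (.var (.succ (.succ .zero)))
        (.app (.app r.wk.wk.wk.wk (.var (.succ .zero))) (.var .zero)))))))))
  -- Induction on a bound for the measure, with one unfolding of the fixed point in each step.
  have key : ∀ n : ℕ, ∀ G, dom G → μ G < n →
      M.eval ((φ, toPar existsTwo, ()) : Env [Ty.two ⇒ Ty.one, Ty.two]) G = toPar (val G) := by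
    intro n
    induction n with
    | zero => exact fun G _ h => absurd h (Nat.not_lt_zero _)
    | succ n ih =>
      intro G hG hn
      obtain ⟨y, hy, hv⟩ := hval G hG
      rw [hv]
      refine (congrFun (Term.eval_mu _ _ _) G).trans ?_
      refine Term.eval_app (u := toPar post) (x := y) (((Term.eval_wk _ _ _).trans
        ((Term.eval_wk _ _ _).trans (Term.eval_wk _ _ _))).trans (hq ())) (Eq.trans ?_ hy)
      refine Term.eval_app (u := φ) rfl (funext fun s => ?_)
      have hAs : Term.eval (.app (.app a.wk.wk.wk.wk (.var (.succ .zero))) (.var .zero))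
          ((toPar s, toPar G, M.eval ((φ, toPar existsTwo, ()) : Env [Ty.two ⇒ Ty.one, Ty.two]),
            φ, toPar existsTwo, ()) :
            Env [Ty.one, Ty.two, Ty.two ⇒ Ty.one, Ty.two ⇒ Ty.one, Ty.two]) =
          toPar (σ := Ty.nat) (A G s) := by
        refine Term.eval_app (u := toPar (σ := Ty.one ⇒ Ty.nat) (A G)) (x := s) ?_ rfl
        exact Term.eval_app (u := toPar (σ := Ty.two ⇒ Ty.one ⇒ Ty.nat) A) (x := G) (((Term.eval_wk _ _ _).trans
          ((Term.eval_wk _ _ _).trans ((Term.eval_wk _ _ _).trans (Term.eval_wk _ _ _)))).trans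
            (ha ())) rfl
      -- The recursive call sits in the branch `A G s ≠ 0`, the only place where `hrec` guarantees a
      -- value; so the query is a total type 2 object.
      by_cases h0 : A G s = 0
      · exact (Term.eval_caseOf_zero hAs h0).trans
          (congrArg (toPar (σ := Ty.nat)) (if_pos h0).symm)
      · refine (Term.eval_caseOf_pos hAs h0).trans
          (Eq.trans ?_ (congrArg (toPar (σ := Ty.nat)) (if_neg h0).symm))
        have hrs := hrec G hG s h0
        refine Term.eval_app (u := toPar (σ := Ty.one ⇒ Ty.nat) (B s)) (x := val (rem G s)) ?_ ?_
        · exact Term.eval_app (u := toPar (σ := Ty.one ⇒ Ty.one ⇒ Ty.nat) B) (x := s) (((Term.eval_wk _ _ _).trans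
            ((Term.eval_wk _ _ _).trans ((Term.eval_wk _ _ _).trans (Term.eval_wk _ _ _)))).trans
              (hb ())) rfl
        · refine (Term.eval_app (t := .var (.succ (.succ .zero))) (u := M.eval ((φ, toPar existsTwo, ()) :
            Env [Ty.two ⇒ Ty.one, Ty.two])) (x := rem G s) rfl ?_).trans
              (ih _ hrs.1 (lt_of_lt_of_le hrs.2 (Nat.lt_succ_iff.1 hn)))
          refine Term.eval_app (u := toPar (rem G)) (x := s) ?_ rfl
          exact Term.eval_app (u := toPar rem) (x := G) (((Term.eval_wk _ _ _).trans
            ((Term.eval_wk _ _ _).trans ((Term.eval_wk _ _ _).trans (Term.eval_wk _ _ _)))).trans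
              (hr ())) rfl
  refine ⟨M, Par.le_of_ne_bot fun G hG => ?_⟩
  obtain ⟨hd, hG⟩ := hψ G hG
  rw [hG]
  exact le_of_eq (key _ G hd (Nat.lt_succ_self _)).symm

/-! ### Names of real numbers -/

section Arithmetic

variable {Γ : List Ty}

/-- Denominators are cleared and negative parts moved to the other side, which leaves an inequality
of natural numbers without subtraction. -/
theorem ratOf_lt_add_iff (a b c : ℕ) : ratOf a < ratOf b + ratOf c ↔
    a.unpair.1.unpair.1 * ((b.unpair.2 + 1) * (c.unpair.2 + 1)) +
      b.unpair.1.unpair.2 * ((a.unpair.2 + 1) * (c.unpair.2 + 1)) +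
      c.unpair.1.unpair.2 * ((a.unpair.2 + 1) * (b.unpair.2 + 1)) <
    a.unpair.1.unpair.2 * ((b.unpair.2 + 1) * (c.unpair.2 + 1)) +
      b.unpair.1.unpair.1 * ((a.unpair.2 + 1) * (c.unpair.2 + 1)) +
      c.unpair.1.unpair.1 * ((a.unpair.2 + 1) * (b.unpair.2 + 1)) := by
  unfold ratOf
  rw [div_add_div _ _ (by positivity) (by positivity), div_lt_div_iff₀ (by positivity)
    (by positivity), ← Nat.cast_lt (α := ℚ)]
  push_cast
  constructor <;> intro h <;> linarith

theorem RecP.ratLt {a b c : TEnv Γ → ℕ} (ha : RecN a) (hb : RecN b) (hc : RecN c) :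
    RecP fun ρ => ratOf (a ρ) < ratOf (b ρ) + ratOf (c ρ) := by
  have h1 : ∀ {f : TEnv Γ → ℕ}, RecN f → RecN fun ρ => (f ρ).unpair.1.unpair.1 :=
    fun h => h.left.left
  have h2 : ∀ {f : TEnv Γ → ℕ}, RecN f → RecN fun ρ => (f ρ).unpair.1.unpair.2 :=
    fun h => h.left.right
  have h3 : ∀ {f g : TEnv Γ → ℕ}, RecN f → RecN g →
      RecN fun ρ => ((f ρ).unpair.2 + 1) * ((g ρ).unpair.2 + 1) :=
    fun h h' => h.right.succ.mul h'.right.succ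
  exact (RecP.lt ((((h1 ha).mul (h3 hb hc)).add ((h2 hb).mul (h3 ha hc))).add
    ((h2 hc).mul (h3 ha hb))) ((((h2 ha).mul (h3 hb hc)).add ((h1 hb).mul (h3 ha hc))).add
    ((h1 hc).mul (h3 ha hb)))).of_iff fun ρ => (ratOf_lt_add_iff _ _ _).symm

/-- The code of the fraction `k / d`. -/
def frac (k d : ℕ) : ℕ := Nat.pair (Nat.pair k 0) (d - 1)

theorem ratOf_frac (k : ℕ) {d : ℕ} (hd : 0 < d) : ratOf (frac k d) = k / d := by
  have : ((d - 1 : ℕ) : ℚ) + 1 = d := by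
    rw [← Nat.cast_succ, Nat.succ_eq_add_one, Nat.sub_add_cancel hd]
  simp [ratOf, frac, this]

theorem RecN.frac {k d : TEnv Γ → ℕ} (hk : RecN k) (hd : RecN d) :
    RecN fun ρ => frac (k ρ) (d ρ) :=
  RecN.pair (hk.pair .zero) hd.pred

theorem RecN.twoPow {n : TEnv Γ → ℕ} (hn : RecN n) : RecN fun ρ => 2 ^ n ρ :=
  RecN.pow (.const 2) hn

theorem RecN.threePow {n : TEnv Γ → ℕ} (hn : RecN n) : RecN fun ρ => 3 ^ n ρ :=
  RecN.pow (.const 3) hn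

end Arithmetic

/-- Fast converging Cauchy sequences of rationals. -/
def IsFast (x : ℕ → ℕ) : Prop :=
  ∀ n i : ℕ, |ratOf (x n) - ratOf (x (n + i))| < 1 / 2 ^ n

theorem IsFast.exists_codesReal {x : ℕ → ℕ} (h : IsFast x) : ∃ r, CodesReal x r := by
  have hc : CauchySeq fun n => (ratOf (x n) : ℝ) := by
    refine cauchySeq_of_le_geometric (1 / 2) 1 (by norm_num) fun n => ?_
    rw [Real.dist_eq, one_mul, one_div_pow, ← Rat.cast_sub, ← Rat.cast_abs]
    have := (Rat.cast_lt (K := ℝ)).2 (h n 1)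
    push_cast at this ⊢
    exact this.le
  obtain ⟨r, hr⟩ := cauchySeq_tendsto_of_complete hc
  exact ⟨r, h, hr⟩

theorem CodesReal.abs_sub_le {x : ℕ → ℕ} {r : ℝ} (h : CodesReal x r) (n : ℕ) :
    |(ratOf (x n) : ℝ) - r| ≤ 1 / 2 ^ n := by
  have ht : Filter.Tendsto (fun i => |(ratOf (x n) : ℝ) - ratOf (x (i + n))|) Filter.atTop
      (nhds |(ratOf (x n) : ℝ) - r|) :=
    (tendsto_const_nhds.sub ((Filter.tendsto_add_atTop_iff_nat n).2 h.2)).abs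
  refine le_of_tendsto' ht fun i => ?_
  have := (Rat.cast_lt (K := ℝ)).2 (h.1 n i)
  push_cast at this
  rw [add_comm i n]
  exact this.le

theorem CodesReal.unique {x : ℕ → ℕ} {r s : ℝ} (hr : CodesReal x r) (hs : CodesReal x s) :
    r = s :=
  tendsto_nhds_unique hr.2 hs.2

theorem tendsto_two_div_two_pow :
    Filter.Tendsto (fun n : ℕ => (2 : ℝ) / 2 ^ n) Filter.atTop (nhds 0) := by
  have := (tendsto_pow_atTop_nhds_zero_of_lt_one (r := (1 / 2 : ℝ)) (by norm_num)
    (by norm_num)).const_mul 2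
  rw [mul_zero] at this
  exact this.congr fun n => by rw [one_div_pow, mul_one_div]

/-- The `k`-th term is off by at most `1 / 2 ^ k`, and doubling this error makes the inequality
strict. When `s` is rational, the comparison becomes a number quantifier over strict rational
inequalities, which `∃²` decides. -/
theorem CodesReal.le_iff {x : ℕ → ℕ} {r : ℝ} (h : CodesReal x r) (s : ℝ) :
    r ≤ s ↔ ∀ k, (ratOf (x k) : ℝ) < s + 2 / 2 ^ k := by
  constructor
  · intro hs k
    have h1 := (abs_le.1 (h.abs_sub_le k)).2
    have h2 : (0 : ℝ) < 1 / 2 ^ k := by positivity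
    have h3 : (2 : ℝ) / 2 ^ k = 1 / 2 ^ k + 1 / 2 ^ k := by ring
    linarith
  · intro hk
    have := tendsto_two_div_two_pow.const_add s
    rw [add_zero] at this
    exact le_of_tendsto_of_tendsto' h.2 this fun k => (hk k).le

theorem CodesReal.ge_iff {x : ℕ → ℕ} {r : ℝ} (h : CodesReal x r) (s : ℝ) :
    s ≤ r ↔ ∀ k, s < ratOf (x k) + 2 / 2 ^ k := by
  constructor
  · intro hs k
    have h1 := (abs_le.1 (h.abs_sub_le k)).1
    have h2 : (0 : ℝ) < 1 / 2 ^ k := by positivity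
    have h3 : (2 : ℝ) / 2 ^ k = 1 / 2 ^ k + 1 / 2 ^ k := by ring
    linarith
  · intro hk
    have := h.2.add tendsto_two_div_two_pow
    rw [add_zero] at this
    exact ge_of_tendsto' this fun k => (hk k).le

/-- The `n`-th term of the canonical name of a real number. -/
noncomputable def realName (r : ℝ) (n : ℕ) : ℕ :=
  sInf {m | |(ratOf m : ℝ) - r| ≤ 1 / 2 ^ (n + 2)}

theorem exists_ratOf (q : ℚ) : ∃ m, ratOf m = q := by
  refine ⟨Nat.pair (Nat.pair q.num.toNat (-q.num).toNat) (q.den - 1), ?_⟩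
  have h1 : ((q.den - 1 : ℕ) : ℚ) + 1 = q.den := by
    rw [← Nat.cast_succ, Nat.succ_eq_add_one, Nat.sub_add_cancel q.den_pos]
  have h2 : ((q.num.toNat : ℕ) : ℚ) - ((-q.num).toNat : ℕ) = q.num := by
    have := Int.toNat_sub_toNat_neg q.num
    exact_mod_cast this
  simp only [ratOf, Nat.unpair_pair]
  rw [h1, h2, Rat.num_div_den]

theorem realName_spec (r : ℝ) (n : ℕ) :
    |(ratOf (realName r n) : ℝ) - r| ≤ 1 / 2 ^ (n + 2) := by
  refine Nat.sInf_mem (s := {m | |(ratOf m : ℝ) - r| ≤ 1 / 2 ^ (n + 2)}) ?_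
  obtain ⟨q, hq1, hq2⟩ := exists_rat_btwn (show r < r + 1 / 2 ^ (n + 2) by
    linarith [show (0 : ℝ) < 1 / 2 ^ (n + 2) by positivity])
  obtain ⟨m, hm⟩ := exists_ratOf q
  refine ⟨m, ?_⟩
  show |(ratOf m : ℝ) - r| ≤ _
  rw [hm, abs_le]
  constructor <;> linarith

theorem codesReal_realName (r : ℝ) : CodesReal (realName r) r := by
  constructor
  · intro n i
    rw [← Rat.cast_lt (K := ℝ)]
    push_cast
    -- Two errors of at most a quarter of `1 / 2 ^ n` each stay strictly below `1 / 2 ^ n`.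
    have h1 := abs_le.1 (realName_spec r n)
    have h2 := abs_le.1 (realName_spec r (n + i))
    have h3 : (1 : ℝ) / 2 ^ (n + i + 2) ≤ 1 / 2 ^ (n + 2) :=
      one_div_le_one_div_of_le (by positivity) (pow_le_pow_right₀ (by norm_num) (by omega))
    have h4 : (1 : ℝ) / 2 ^ n = 4 * (1 / 2 ^ (n + 2)) := by rw [pow_add]; field_simp; norm_num
    have h5 : (0 : ℝ) < 1 / 2 ^ (n + 2) := by positivity
    rw [abs_lt]
    constructor <;> linarith
  · rw [tendsto_iff_norm_sub_tendsto_zero]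
    refine squeeze_zero (fun _ => norm_nonneg _) (fun n => ?_) tendsto_two_div_two_pow
    rw [Real.norm_eq_abs]
    refine (realName_spec r n).trans ?_
    rw [div_le_div_iff₀ (by positivity) (by positivity), pow_add]
    nlinarith [show (0 : ℝ) < 2 ^ n by positivity]

/-- The canonical name of a real number, computed from an arbitrary name. -/
noncomputable def canReal (z : ℕ → ℕ) (n : ℕ) : ℕ :=
  -- The fraction equals `1 / 2 ^ (n + 2) + 2 / 2 ^ k`: the tolerance in `realName` plus the error
  -- term in `CodesReal.le_iff`.
  sInf {m | ∀ k, ratOf m < ratOf (z k) + ratOf (frac (2 ^ k + 2 ^ (n + 3)) (2 ^ (n + 2 + k))) ∧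
    ratOf (z k) < ratOf m + ratOf (frac (2 ^ k + 2 ^ (n + 3)) (2 ^ (n + 2 + k)))}

/-- The quantifier over `k` turns the condition on the name into a condition on the limit alone, so
all names of `r` give the same least code. -/
theorem canReal_eq {z : ℕ → ℕ} {r : ℝ} (h : CodesReal z r) : canReal z = realName r := by
  funext n
  refine congrArg sInf (Set.ext fun m => ?_)
  have hf : ∀ k : ℕ, (ratOf (frac (2 ^ k + 2 ^ (n + 3)) (2 ^ (n + 2 + k))) : ℝ) =
      1 / 2 ^ (n + 2) + 2 / 2 ^ k := by
    intro k
    rw [ratOf_frac _ (by positivity)]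
    push_cast
    field_simp
    ring
  show (∀ k, _) ↔ |(ratOf m : ℝ) - r| ≤ _
  have hlt : ∀ {a b c : ℚ}, a < b + c ↔ (a : ℝ) < b + c := by
    intro a b c
    rw [← Rat.cast_add, Rat.cast_lt]
  simp only [hlt, hf, abs_le, forall_and]
  rw [and_comm]
  refine and_congr ?_ ?_
  · rw [← sub_nonneg, sub_neg_eq_add]
    rw [show (0 : ℝ) ≤ ratOf m - r + 1 / 2 ^ (n + 2) ↔ r ≤ ratOf m + 1 / 2 ^ (n + 2) by
      constructor <;> intro <;> linarith, h.le_iff]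
    simp only [add_assoc]
  · rw [sub_le_comm, h.ge_iff]
    refine forall_congr' fun k => ?_
    constructor <;> intro <;> linarith

theorem isRec_canReal : IsRec (τ := Ty.one ⇒ Ty.one) canReal := by
  refine Rec.lam (RecF.lam (RecN.sInf (RecP.all ?_)))
  have hz : RecF fun ρ : TEnv [Ty.nat, Ty.nat, Ty.nat, Ty.one] => ρ.2.2.2.1 := Rec.v0.wk.wk.wk
  have hk : RecN fun ρ : TEnv [Ty.nat, Ty.nat, Ty.nat, Ty.one] => ρ.1 := Rec.v0
  have hm : RecN fun ρ : TEnv [Ty.nat, Ty.nat, Ty.nat, Ty.one] => ρ.2.1 := Rec.v0.wk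
  have hn : RecN fun ρ : TEnv [Ty.nat, Ty.nat, Ty.nat, Ty.one] => ρ.2.2.1 := Rec.v0.wk.wk
  have he := RecN.frac (hk.twoPow.add (hn.add (.const 3)).twoPow)
    ((hn.add (.const 2)).add hk).twoPow
  exact (RecP.ratLt hm (hz.app hk) he).and (RecP.ratLt (hz.app hk) hm he)

theorem ratOf_half (n : ℕ) : ratOf (frac 1 (2 ^ n)) = 1 / 2 ^ n := by
  rw [ratOf_frac _ (by positivity)]
  push_cast
  rfl

theorem abs_sub_lt_iff_lt_add (a b c : ℚ) : |a - b| < c ↔ a < b + c ∧ b < a + c := by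
  rw [abs_sub_lt_iff, sub_lt_iff_lt_add', sub_lt_iff_lt_add']

theorem isRec_isFast : IsRec (τ := Ty.two) fun x => ind (IsFast x) := by
  refine Rec.lam (RecP.of_iff (RecP.all (p := fun (ρ : TEnv [Ty.one]) n => ∀ i,
    ratOf (ρ.1 n) < ratOf ((ρ.1 : ℕ → ℕ) (n + i)) + ratOf (frac 1 (2 ^ n)) ∧
    ratOf ((ρ.1 : ℕ → ℕ) (n + i)) < ratOf (ρ.1 n) + ratOf (frac 1 (2 ^ n)))
    (RecP.all ?_)) fun ρ => ?_)
  · have hx : RecF fun ρ : TEnv [Ty.nat, Ty.nat, Ty.one] => ρ.2.2.1 := Rec.v0.wk.wk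
    have hi : RecN fun ρ : TEnv [Ty.nat, Ty.nat, Ty.one] => ρ.1 := Rec.v0
    have hn : RecN fun ρ : TEnv [Ty.nat, Ty.nat, Ty.one] => ρ.2.1 := Rec.v0.wk
    have he := RecN.frac (.const 1) hn.twoPow
    exact (RecP.ratLt (hx.app hn) (hx.app (hn.add hi)) he).and
      (RecP.ratLt (hx.app (hn.add hi)) (hx.app hn) he)
  · refine forall_congr' fun n => forall_congr' fun i => ?_
    rw [ratOf_half]
    exact (abs_sub_lt_iff_lt_add _ _ _).symm

/-- A name of a real number is a name of an element of `[0,1]`. -/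
def InUnit (z : ℕ → ℕ) : Prop :=
  ∀ k, ratOf (frac 0 1) < ratOf (z k) + ratOf (frac 2 (2 ^ k)) ∧
    ratOf (z k) < ratOf (frac 1 1) + ratOf (frac 2 (2 ^ k))

theorem isRec_inUnit : IsRec (τ := Ty.two) fun x => ind (InUnit x) := by
  refine Rec.lam (RecP.all ?_)
  have hx : RecF fun ρ : TEnv [Ty.nat, Ty.one] => ρ.2.1 := Rec.v0.wk
  have hk : RecN fun ρ : TEnv [Ty.nat, Ty.one] => ρ.1 := Rec.v0
  have he := RecN.frac (.const 2) hk.twoPow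
  exact (RecP.ratLt (.const _) (hx.app hk) he).and (RecP.ratLt (hx.app hk) (.const _) he)

theorem inUnit_iff {z : ℕ → ℕ} {r : ℝ} (h : CodesReal z r) : InUnit z ↔ r ∈ unitInterval := by
  have hlt : ∀ {a b c : ℚ}, a < b + c ↔ (a : ℝ) < b + c := by
    intro a b c
    rw [← Rat.cast_add, Rat.cast_lt]
  have hf : ∀ k : ℕ, (ratOf (frac 2 (2 ^ k)) : ℝ) = 2 / 2 ^ k := by
    intro k
    rw [ratOf_frac _ (by positivity)]
    push_cast
    rfl
  rw [unitInterval, Set.mem_Icc, h.le_iff, h.ge_iff, ← forall_and]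
  refine forall_congr' fun k => ?_
  simp only [hlt, hf, ratOf_frac _ one_pos]
  simp

/-- `⌊3 ^ n * r⌋` for a name `z` of `r ≥ 0`. -/
noncomputable def tfloor (z : ℕ → ℕ) (n : ℕ) : ℕ :=
  sInf {k | ¬ ∀ j, ratOf (frac (k + 1) (3 ^ n)) < ratOf (z j) + ratOf (frac 2 (2 ^ j))}

theorem isRec_tfloor : IsRec (τ := Ty.one ⇒ Ty.one) tfloor := by
  refine Rec.lam (RecF.lam (RecN.sInf (RecP.not (RecP.all ?_))))
  have hz : RecF fun ρ : TEnv [Ty.nat, Ty.nat, Ty.nat, Ty.one] => ρ.2.2.2.1 := Rec.v0.wk.wk.wk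
  have hj : RecN fun ρ : TEnv [Ty.nat, Ty.nat, Ty.nat, Ty.one] => ρ.1 := Rec.v0
  have hk : RecN fun ρ : TEnv [Ty.nat, Ty.nat, Ty.nat, Ty.one] => ρ.2.1 := Rec.v0.wk
  have hn : RecN fun ρ : TEnv [Ty.nat, Ty.nat, Ty.nat, Ty.one] => ρ.2.2.1 := Rec.v0.wk.wk
  exact RecP.ratLt (.frac hk.succ hn.threePow) (hz.app hj) (.frac (.const 2) hj.twoPow)

theorem RecN.tfloor {Γ : List Ty} {z : TEnv Γ → ℕ → ℕ} {n : TEnv Γ → ℕ} (hz : RecF z)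
    (hn : RecN n) : RecN fun ρ => tfloor (z ρ) (n ρ) :=
  RecF.app (Rec.app (σ := Ty.one) (τ := Ty.one) isRec_tfloor.const hz) hn

theorem tfloor_eq {z : ℕ → ℕ} {r : ℝ} (h : CodesReal z r) (hr : 0 ≤ r) (n : ℕ) :
    tfloor z n = ⌊3 ^ n * r⌋₊ := by
  have : {k | ¬ ∀ j, ratOf (frac (k + 1) (3 ^ n)) < ratOf (z j) + ratOf (frac 2 (2 ^ j))} =
      Set.Ici ⌊3 ^ n * r⌋₊ := by
    ext k
    have hlt : ∀ {a b c : ℚ}, a < b + c ↔ (a : ℝ) < b + c := by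
      intro a b c
      rw [← Rat.cast_add, Rat.cast_lt]
    have hf : ∀ k : ℕ, (ratOf (frac 2 (2 ^ k)) : ℝ) = 2 / 2 ^ k := by
      intro k
      rw [ratOf_frac _ (by positivity)]
      push_cast
      rfl
    simp only [Set.mem_ofPred_eq, Set.mem_Ici, hlt, hf]
    -- The quantified inequalities say `(k + 1) / 3 ^ n ≤ r`, so the set consists of the `k` with `3
    -- ^ n * r < k + 1`.
    rw [← h.ge_iff, not_le, ratOf_frac _ (by positivity), ← Nat.lt_succ_iff,
      Nat.floor_lt (by positivity)]
    push_cast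
    rw [lt_div_iff₀ (by positivity), mul_comm]
  rw [tfloor, this, csInf_Ici]

/-! ### Triadic names -/

/-- Appending ternary digits keeps `3 ^ i * k n ≤ k (n + i) < 3 ^ i * (k n + 1)`. -/
theorem isFast_triadic {k : ℕ → ℕ} (h1 : ∀ n, 3 * k n ≤ k (n + 1))
    (h2 : ∀ n, k (n + 1) ≤ 3 * k n + 2) : ∀ n i : ℕ,
    ratOf (frac (k n) (3 ^ n)) ≤ ratOf (frac (k (n + i)) (3 ^ (n + i))) ∧
      ratOf (frac (k (n + i)) (3 ^ (n + i))) < ratOf (frac (k n) (3 ^ n)) + 1 / 3 ^ n := by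
  intro n i
  have h3 : 3 ^ i * k n ≤ k (n + i) ∧ k (n + i) + 1 ≤ 3 ^ i * (k n + 1) := by
    induction i with
    | zero => simp
    | succ i ih =>
      have := h1 (n + i)
      have := h2 (n + i)
      rw [pow_succ, ← add_assoc]
      constructor
      · calc 3 ^ i * 3 * k n = 3 * (3 ^ i * k n) := by ring
          _ ≤ 3 * k (n + i) := by omega
          _ ≤ _ := by omega
      · calc k (n + i + 1) + 1 ≤ 3 * (k (n + i) + 1) := by omega
          _ ≤ 3 * (3 ^ i * (k n + 1)) := by omega
          _ = _ := by ring
  have h4 : ((3 : ℚ) ^ i * k n ≤ k (n + i)) ∧ ((k (n + i) : ℚ) + 1 ≤ 3 ^ i * (k n + 1)) := by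
    exact_mod_cast h3
  rw [ratOf_frac _ (by positivity), ratOf_frac _ (by positivity)]
  push_cast
  rw [pow_add, ← add_div]
  constructor
  · rw [div_le_div_iff₀ (by positivity) (by positivity)]
    nlinarith [show (0 : ℚ) < 3 ^ n by positivity]
  · rw [div_lt_div_iff₀ (by positivity) (by positivity)]
    nlinarith [show (0 : ℚ) < 3 ^ n by positivity]

/-- Truncated ternary expansions form a fast Cauchy sequence because `1 / 3 ^ n ≤ 1 / 2 ^ n`. This
produces both the embedding of the Baire space and the names of suprema. -/
theorem exists_codesReal_triadic {k : ℕ → ℕ} (h1 : ∀ n, 3 * k n ≤ k (n + 1))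
    (h2 : ∀ n, k (n + 1) ≤ 3 * k n + 2) : ∃ r : ℝ, CodesReal (fun n => frac (k n) (3 ^ n)) r ∧
      ∀ n, (k n : ℝ) ≤ 3 ^ n * r ∧ 3 ^ n * r ≤ k n + 1 := by
  have h := isFast_triadic h1 h2
  have hf : IsFast fun n => frac (k n) (3 ^ n) := by
    intro n i
    obtain ⟨h3, h4⟩ := h n i
    have h5 : (1 : ℚ) / 3 ^ n ≤ 1 / 2 ^ n :=
      one_div_le_one_div_of_le (by positivity) (pow_le_pow_left₀ (by norm_num) (by norm_num) n)
    have h6 : (0 : ℚ) < 1 / 2 ^ n := by positivity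
    rw [abs_lt]
    constructor <;> linarith
  obtain ⟨r, hr⟩ := hf.exists_codesReal
  refine ⟨r, hr, fun n => ?_⟩
  have ht := (Filter.tendsto_add_atTop_iff_nat n).2 hr.2
  have hq : (ratOf (frac (k n) (3 ^ n)) : ℝ) = k n / 3 ^ n := by
    rw [ratOf_frac _ (by positivity)]
    push_cast
    rfl
  constructor
  · have := ge_of_tendsto' ht fun i => (Rat.cast_le (K := ℝ)).2 (add_comm i n ▸ (h n i).1)
    rw [hq, div_le_iff₀ (by positivity)] at this
    linarith
  · have := le_of_tendsto' ht fun i => (Rat.cast_le (K := ℝ)).2 (add_comm i n ▸ (h n i).2.le)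
    push_cast at this
    rw [hq, ← add_div, le_div_iff₀ (by positivity)] at this
    linarith

theorem le_of_forall_three_pow {a b : ℝ} (h : ∀ n : ℕ, 3 ^ n * a ≤ 3 ^ n * b + 1) : a ≤ b := by
  by_contra! hab
  obtain ⟨n, hn⟩ := pow_unbounded_of_one_lt (1 / (a - b)) (show (1 : ℝ) < 3 by norm_num)
  rw [div_lt_iff₀ (by linarith)] at hn
  linarith [h n]

/-! ### An embedding of the Baire space into the unit interval -/

/-- The integer with ternary digits given by the first `n` values of the characteristic function
of the graph of `x`. -/
noncomputable def graphDigits (x : ℕ → ℕ) (n : ℕ) : ℕ :=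
  Nat.rec 0 (fun i a => 3 * a + ind (x i.unpair.1 = i.unpair.2)) n

theorem graphDigits_succ (x : ℕ → ℕ) (n : ℕ) :
    graphDigits x (n + 1) = 3 * graphDigits x n + ind (x n.unpair.1 = n.unpair.2) := rfl

theorem ind_le_one (p : Prop) : ind p ≤ 1 := by
  unfold ind
  split_ifs <;> simp

noncomputable def embRealName (x : ℕ → ℕ) (n : ℕ) : ℕ := frac (graphDigits x n) (3 ^ n)

theorem isRec_embRealName : IsRec (τ := Ty.one ⇒ Ty.one) embRealName := by
  refine Rec.lam (RecF.lam (RecN.frac (RecN.natRec .zero ?_ Rec.v0) (RecN.threePow Rec.v0)))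
  have hx : RecF fun ρ : TEnv [Ty.nat, Ty.nat, Ty.nat, Ty.one] => ρ.2.2.2.1 := Rec.v0.wk.wk.wk
  have hi : RecN fun ρ : TEnv [Ty.nat, Ty.nat, Ty.nat, Ty.one] => ρ.2.1 := Rec.v0.wk
  exact ((RecN.const 3).mul Rec.v0).add (RecP.eq (hx.app hi.left) hi.right)

theorem exists_embReal (x : ℕ → ℕ) : ∃ r : ℝ, CodesReal (embRealName x) r ∧
    ∀ n, (graphDigits x n : ℝ) ≤ 3 ^ n * r ∧ 3 ^ n * r ≤ graphDigits x n + 1 :=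
  exists_codesReal_triadic (fun n => by rw [graphDigits_succ]; omega)
    (fun n => by rw [graphDigits_succ]; have := ind_le_one (x n.unpair.1 = n.unpair.2); omega)

noncomputable def embReal (x : ℕ → ℕ) : ℝ := (exists_embReal x).choose

theorem codesReal_embReal (x : ℕ → ℕ) : CodesReal (embRealName x) (embReal x) :=
  (exists_embReal x).choose_spec.1

/-- All digits are `0` or `1`, so the bound for `n + 1`, divided by `3`, gives a remainder of at
most `2 / 3`. Being strictly less than `1`, it lets the floor recover the digits without ambiguity.
-/
theorem embReal_bounds (x : ℕ → ℕ) (n : ℕ) : (graphDigits x n : ℝ) ≤ 3 ^ n * embReal x ∧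
    3 ^ n * embReal x ≤ graphDigits x n + 2 / 3 := by
  refine ⟨((exists_embReal x).choose_spec.2 n).1, ?_⟩
  have h := ((exists_embReal x).choose_spec.2 (n + 1)).2
  have h1 : (graphDigits x (n + 1) : ℝ) ≤ 3 * graphDigits x n + 1 := by
    rw [graphDigits_succ]
    push_cast
    have : (ind (x n.unpair.1 = n.unpair.2) : ℝ) ≤ 1 := by exact_mod_cast ind_le_one _
    linarith
  rw [pow_succ] at h
  change 3 ^ n * 3 * embReal x ≤ _ at h
  linarith

theorem embReal_mem (x : ℕ → ℕ) : embReal x ∈ unitInterval := by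
  have h := embReal_bounds x 0
  have h0 : graphDigits x 0 = 0 := rfl
  rw [h0] at h
  norm_num at h
  constructor <;> linarith [h.1, h.2]

theorem tfloor_embReal {z x : ℕ → ℕ} (h : CodesReal z (embReal x)) (n : ℕ) :
    tfloor z n = graphDigits x n := by
  rw [tfloor_eq h (embReal_mem x).1, Nat.floor_eq_iff (by have := (embReal_mem x).1; positivity)]
  have := embReal_bounds x n
  constructor <;> linarith [this.1, this.2]

/-- Digit number `Nat.pair j m` of an embedded `x` is `1` exactly when `x j = m`, and the difference
of two consecutive floors extracts this digit. -/
noncomputable def decReal (z : ℕ → ℕ) (j : ℕ) : ℕ :=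
  sInf {m | tfloor z (Nat.pair j m + 1) - 3 * tfloor z (Nat.pair j m) = 1}

theorem isRec_decReal : IsRec (τ := Ty.one ⇒ Ty.one) decReal := by
  refine Rec.lam (RecF.lam (RecN.sInf ?_))
  have hz : RecF fun ρ : TEnv [Ty.nat, Ty.nat, Ty.one] => ρ.2.2.1 := Rec.v0.wk.wk
  have hp : RecN fun ρ : TEnv [Ty.nat, Ty.nat, Ty.one] => Nat.pair ρ.2.1 ρ.1 :=
    RecN.pair Rec.v0.wk Rec.v0
  exact RecP.eq ((RecN.tfloor hz hp.succ).sub ((RecN.const 3).mul (RecN.tfloor hz hp))) (.const 1)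

theorem decReal_eq {z x : ℕ → ℕ} (h : CodesReal z (embReal x)) : decReal z = x := by
  funext j
  have : {m | tfloor z (Nat.pair j m + 1) - 3 * tfloor z (Nat.pair j m) = 1} = {x j} := by
    ext m
    rw [Set.mem_ofPred_eq, tfloor_embReal h, tfloor_embReal h, graphDigits_succ,
      Nat.add_sub_cancel_left, ind_eq_one, Nat.unpair_pair]
    exact eq_comm
  rw [decReal, this, csInf_singleton]

/-! ### Canonical names of points, and embeddings of the Baire space -/

/-- A coding of the points of a domain by canonical names, and an embedding of the Baire space
into the domain, all computable in `∃²`. -/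
structure DomCode (D : Dom) where
  can : (ℕ → ℕ) → ℕ → ℕ
  can_rec : IsRec (τ := Ty.one ⇒ Ty.one) can
  cname : D.Pt → ℕ → ℕ
  names_cname : ∀ p, D.Names (cname p) p
  can_eq : ∀ {x p}, D.Names x p → can x = cname p
  names_unique : ∀ {x p q}, D.Names x p → D.Names x q → p = q
  isName : (ℕ → ℕ) → Prop
  isName_rec : IsRec (τ := Ty.two) fun x => ind (isName x)
  isName_iff : ∀ x, isName x ↔ ∃ p, D.Names x p
  emb : (ℕ → ℕ) → D.Pt
  embName : (ℕ → ℕ) → ℕ → ℕ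
  embName_rec : IsRec (τ := Ty.one ⇒ Ty.one) embName
  names_emb : ∀ x, D.Names (embName x) (emb x)
  dec : (ℕ → ℕ) → ℕ → ℕ
  dec_rec : IsRec (τ := Ty.one ⇒ Ty.one) dec
  dec_eq : ∀ {z x}, D.Names z (emb x) → dec z = x

theorem isRec_id : IsRec (τ := Ty.one ⇒ Ty.one) fun x => x := Rec.lam Rec.v0

def baireCode : DomCode .baire where
  can := fun x => x
  can_rec := isRec_id
  cname := fun p => p
  names_cname := fun _ => rfl
  can_eq := fun h => h
  names_unique := fun h h' => Eq.trans (Eq.symm h) h'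
  isName := fun _ => True
  isName_rec := Rec.lam ((RecN.const 1).of_eq fun _ => (ind_true trivial).symm)
  isName_iff := fun x => ⟨fun _ => ⟨x, rfl⟩, fun _ => trivial⟩
  emb := fun x => x
  embName := fun x => x
  embName_rec := isRec_id
  names_emb := fun _ => rfl
  dec := fun x => x
  dec_rec := isRec_id
  dec_eq := fun h => h

theorem toNat_injective : Function.Injective Bool.toNat := by decide

open Classical in
noncomputable def cantorCode : DomCode .cantor where
  can := fun x => x
  can_rec := isRec_id
  cname := fun (p : ℕ → Bool) n => (p n).toNat
  names_cname := fun _ _ => rfl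
  can_eq := fun h => funext h
  names_unique := fun {x} {p q : ℕ → Bool} h h' => funext fun n =>
    toNat_injective ((h n).symm.trans (h' n))
  isName := fun x => ∀ n, x n ≤ 1
  isName_rec := Rec.lam (RecP.all (RecP.le (RecF.app (f := fun ρ : TEnv [Ty.nat, Ty.one] => ρ.2.1)
    Rec.v0.wk Rec.v0) (.const 1)))
  isName_iff := fun x => by
    refine ⟨fun h => ⟨fun n => decide (x n = 1), fun n => ?_⟩, ?_⟩
    · rcases Nat.le_one_iff_eq_zero_or_eq_one.1 (h n) with h | h <;> simp [h]
    · rintro ⟨p, hp⟩ n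
      rw [hp n]
      exact Bool.toNat_le _
  emb := fun x n => decide (x n.unpair.1 = n.unpair.2)
  embName := fun x n => ind (x n.unpair.1 = n.unpair.2)
  embName_rec := Rec.lam (RecF.lam (RecP.eq (RecF.app (f := fun ρ : TEnv [Ty.nat, Ty.one] => ρ.2.1)
    Rec.v0.wk (RecN.left Rec.v0)) (RecN.right Rec.v0)))
  names_emb := fun x n => by
    by_cases h : x n.unpair.1 = n.unpair.2 <;> simp [ind, h]
  dec := fun z j => sInf {m | z (Nat.pair j m) = 1}
  dec_rec := Rec.lam (RecF.lam (RecN.sInf (RecP.eq (RecF.app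
    (f := fun ρ : TEnv [Ty.nat, Ty.nat, Ty.one] => ρ.2.2.1) Rec.v0.wk.wk
      (RecN.pair Rec.v0.wk Rec.v0)) (.const 1))))
  dec_eq := fun {z x} h => by
    funext j
    have : {m | z (Nat.pair j m) = 1} = {x j} := by
      ext m
      rw [Set.mem_ofPred_eq, h (Nat.pair j m)]
      by_cases hx : x j = m <;> simp [hx]
      exact fun h => hx h.symm
    rw [this, csInf_singleton]

noncomputable def lineCode : DomCode .line where
  can := canReal
  can_rec := isRec_canReal
  cname := realName
  names_cname := codesReal_realName
  can_eq := canReal_eq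
  names_unique := CodesReal.unique
  isName := IsFast
  isName_rec := isRec_isFast
  isName_iff := fun _ => ⟨IsFast.exists_codesReal, fun ⟨_, h⟩ => h.1⟩
  emb := embReal
  embName := embRealName
  embName_rec := isRec_embRealName
  names_emb := codesReal_embReal
  dec := decReal
  dec_rec := isRec_decReal
  dec_eq := decReal_eq

noncomputable def unitCode : DomCode .unit where
  can := canReal
  can_rec := isRec_canReal
  cname := fun p : unitInterval => realName p.1
  names_cname := fun p => codesReal_realName _
  can_eq := canReal_eq
  names_unique := fun h h' => Subtype.ext (CodesReal.unique h h')
  isName := fun x => IsFast x ∧ InUnit x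
  isName_rec := Rec.lam (RecP.and (Rec.app (σ := Ty.one) (τ := Ty.nat) isRec_isFast.const Rec.v0)
    (Rec.app (σ := Ty.one) (τ := Ty.nat) isRec_inUnit.const Rec.v0))
  isName_iff := fun x => by
    constructor
    · rintro ⟨h1, h2⟩
      obtain ⟨r, hr⟩ := h1.exists_codesReal
      exact ⟨(⟨r, (inUnit_iff hr).1 h2⟩ : unitInterval), hr⟩
    · rintro ⟨p, hp⟩
      exact ⟨hp.1, (inUnit_iff hp).2 p.2⟩
  emb := fun x => (⟨embReal x, embReal_mem x⟩ : unitInterval)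
  embName := embRealName
  embName_rec := isRec_embRealName
  names_emb := codesReal_embReal
  dec := decReal
  dec_rec := isRec_decReal
  dec_eq := decReal_eq

noncomputable def domCode : (D : Dom) → DomCode D
  | .baire => baireCode
  | .cantor => cantorCode
  | .unit => unitCode
  | .line => lineCode

/-- The characteristic function of a subset of the Baire space. -/
noncomputable def chr (X : Set (ℕ → ℕ)) (x : ℕ → ℕ) : ℕ := ind (x ∈ X)

theorem chr_injective {X Y : Set (ℕ → ℕ)} (h : chr X = chr Y) : X = Y := by
  ext x
  have := congrFun h x
  rw [← ind_eq_one (p := x ∈ X), ← ind_eq_one (p := x ∈ Y)]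
  exact Eq.congr_left this

/-! ### Transfer of sets between a domain and the Baire space -/

namespace DomCode

variable {D : Dom} (c : DomCode D)

theorem cname_injective : Function.Injective c.cname := fun p q h =>
  c.names_unique (c.names_cname p) (h ▸ c.names_cname q)

theorem dec_cname_emb (x : ℕ → ℕ) : c.dec (c.cname (c.emb x)) = x := c.dec_eq (c.names_cname _)

theorem emb_injective : Function.Injective c.emb := fun x y h => by
  rw [← c.dec_cname_emb x, h, c.dec_cname_emb]

theorem mem_range_cname (x : ℕ → ℕ) : x ∈ Set.range c.cname ↔ c.isName x ∧ c.can x = x := by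
  rw [c.isName_iff]
  constructor
  · rintro ⟨p, rfl⟩
    exact ⟨⟨p, c.names_cname p⟩, c.can_eq (c.names_cname p)⟩
  · rintro ⟨⟨p, hp⟩, hx⟩
    exact ⟨p, (c.can_eq hp).symm.trans hx⟩

/-- The characteristic function of the set of canonical names of the elements of a set. -/
noncomputable def canon (G : (ℕ → ℕ) → ℕ) (x : ℕ → ℕ) : ℕ :=
  ind ((c.isName x ∧ c.can x = x) ∧ G x = 1)

theorem isRec_canon : IsRec (τ := Ty.two ⇒ Ty.two) c.canon := by
  refine Rec.lam (Rec.lam (σ := Ty.one) ?_)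
  have hx : RecF fun ρ : TEnv [Ty.one, Ty.two] => ρ.1 := Rec.v0
  exact (RecP.and (Rec.app (σ := Ty.one) (τ := Ty.nat) c.isName_rec.const hx)
    (RecP.funEq (Rec.app (σ := Ty.one) (τ := Ty.one) c.can_rec.const hx) hx)).and
    (RecP.eq (Rec.app (σ := Ty.one) (τ := Ty.nat) (f := fun ρ : TEnv [Ty.one, Ty.two] => ρ.2.1)
      Rec.v0.wk hx) (.const 1))

theorem repSet_iff {G : Tot Ty.two} {X : Set D.Pt} :
    D.RepSet G X ↔ ∀ x p, D.Names x p → G x = ind (p ∈ X) := by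
  refine forall_congr' fun x => forall_congr' fun p => imp_congr_right fun _ => ?_
  rw [show X.indicator (fun _ => 1) p = ind (p ∈ X) by
    by_cases h : p ∈ X <;> simp [ind, h]]

/-- A representative is arbitrary off the names of points. Restricting it to canonical names removes
this freedom, and the result depends on `X` only. -/
theorem canon_eq {G : Tot Ty.two} {X : Set D.Pt} (h : D.RepSet G X) :
    c.canon G = chr (c.cname '' X) := by
  funext x
  refine ind_congr ?_
  rw [← c.mem_range_cname]
  constructor
  · rintro ⟨⟨p, rfl⟩, hG⟩
    refine ⟨p, ?_, rfl⟩
    rw [← ind_eq_one (p := p ∈ X)]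
    exact (repSet_iff.1 h _ p (c.names_cname p)).symm.trans hG
  · rintro ⟨p, hp, rfl⟩
    exact ⟨⟨p, rfl⟩, (repSet_iff.1 h _ p (c.names_cname p)).trans (ind_true hp)⟩

/-- A representative of the image of a subset of the Baire space in the domain. -/
noncomputable def push (G : (ℕ → ℕ) → ℕ) (z : ℕ → ℕ) : ℕ :=
  ind (c.can z = c.can (c.embName (c.dec z)) ∧ G (c.dec z) = 1)

theorem isRec_push : IsRec (τ := Ty.two ⇒ Ty.two) c.push := by
  refine Rec.lam (Rec.lam (σ := Ty.one) ?_)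
  have hz : RecF fun ρ : TEnv [Ty.one, Ty.two] => ρ.1 := Rec.v0
  have hd := Rec.app (σ := Ty.one) (τ := Ty.one) c.dec_rec.const hz
  exact (RecP.funEq (Rec.app (σ := Ty.one) (τ := Ty.one) c.can_rec.const hz)
    (Rec.app (σ := Ty.one) (τ := Ty.one) c.can_rec.const
      (Rec.app (σ := Ty.one) (τ := Ty.one) c.embName_rec.const hd))).and
    (RecP.eq (Rec.app (σ := Ty.one) (τ := Ty.nat) (f := fun ρ : TEnv [Ty.one, Ty.two] => ρ.2.1)
      Rec.v0.wk hd) (.const 1))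

/-- A named point lies in the range of the embedding iff decoding and embedding again returns the
same point, which is tested on canonical names. -/
theorem repSet_push (X : Set (ℕ → ℕ)) : D.RepSet (c.push (chr X)) (c.emb '' X) := by
  refine repSet_iff.2 fun z p hz => ?_
  refine ind_congr ?_
  constructor
  · rintro ⟨h1, h2⟩
    rw [c.can_eq hz, c.can_eq (c.names_emb _)] at h1
    exact ⟨c.dec z, ind_eq_one.1 h2, (c.cname_injective h1).symm⟩
  · rintro ⟨x, hx, rfl⟩
    rw [c.dec_eq hz, c.can_eq hz, c.can_eq (c.names_emb x)]
    exact ⟨rfl, ind_true hx⟩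

/-- A representative of the function `p ↦ (dec p) i` on the domain. -/
noncomputable def coord (i : ℕ) (z : ℕ → ℕ) : ℕ := c.dec (c.can z) i

theorem isRec_coord (i : ℕ) : IsRec (τ := Ty.two) (c.coord i) :=
  Rec.lam (RecF.app (Rec.app (σ := Ty.one) (τ := Ty.one) c.dec_rec.const
    (Rec.app (σ := Ty.one) (τ := Ty.one) c.can_rec.const Rec.v0)) (.const i))

/-- Off the range of the embedding `dec` could depend on the name; passing through `can` makes the
function extensional everywhere. -/
theorem repFun_coord (i : ℕ) : D.RepFun (c.coord i) fun p => c.dec (c.cname p) i :=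
  fun x p hx => by
    show c.dec (c.can x) i = _
    rw [c.can_eq hx]

end DomCode

/-! ### Closure properties for type 1 and type 2 arguments; operations on sequences -/

section Closure

variable {Γ : List Ty}

abbrev RecG {Γ : List Ty} (G : TEnv Γ → (ℕ → ℕ) → ℕ) : Prop := Rec (τ := Ty.two) G

theorem RecG.app {G : TEnv Γ → (ℕ → ℕ) → ℕ} {x : TEnv Γ → ℕ → ℕ} (hG : RecG G) (hx : RecF x) :
    RecN fun ρ => G ρ (x ρ) :=
  Rec.app (σ := Ty.one) (τ := Ty.nat) hG hx

theorem RecG.lam {G : TEnv Γ → (ℕ → ℕ) → ℕ}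
    (hG : RecN (Γ := Ty.one :: Γ) fun ρ => G ρ.2 ρ.1) : RecG G :=
  Rec.lam (σ := Ty.one) (τ := Ty.nat) hG

theorem RecF.seqApp {e : TEnv Γ → ℕ → ℕ → ℕ} {n : TEnv Γ → ℕ} (he : Rec (τ := Ty.nat ⇒ Ty.one) e)
    (hn : RecN n) : RecF fun ρ => e ρ (n ρ) :=
  Rec.app (σ := Ty.nat) (τ := Ty.one) he hn

theorem RecF.map {F : (ℕ → ℕ) → ℕ → ℕ} {x : TEnv Γ → ℕ → ℕ} (hF : IsRec (τ := Ty.one ⇒ Ty.one) F)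
    (hx : RecF x) : RecF fun ρ => F (x ρ) :=
  Rec.app (σ := Ty.one) (τ := Ty.one) hF.const hx

theorem RecG.map {F : ((ℕ → ℕ) → ℕ) → (ℕ → ℕ) → ℕ} {G : TEnv Γ → (ℕ → ℕ) → ℕ}
    (hF : IsRec (τ := Ty.two ⇒ Ty.two) F) (hG : RecG G) : RecG fun ρ => F (G ρ) :=
  Rec.app (σ := Ty.two) (τ := Ty.two) hF.const hG

theorem RecF.entry {s : TEnv Γ → ℕ → ℕ} {i : TEnv Γ → ℕ} (hs : RecF s) (hi : RecN i) :
    RecF fun ρ => entry (s ρ) (i ρ) :=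
  RecF.lam (RecF.app (f := fun ρ : TEnv (Ty.nat :: Γ) => s ρ.2) hs.wk
    (RecN.pair hi.wk Rec.v0).succ)

/-- The sequence without its first term. -/
def tail (x : ℕ → ℕ) (n : ℕ) : ℕ := x (n + 1)

theorem RecF.tail {x : TEnv Γ → ℕ → ℕ} (hx : RecF x) : RecF fun ρ => tail (x ρ) :=
  RecF.lam (RecF.app (f := fun ρ : TEnv (Ty.nat :: Γ) => x ρ.2) hx.wk (RecN.succ Rec.v0))

/-- The sequence with an additional first term. -/
def cons (a : ℕ) (x : ℕ → ℕ) : ℕ → ℕ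
  | 0 => a
  | n + 1 => x n

@[simp] theorem cons_zero (a : ℕ) (x : ℕ → ℕ) : cons a x 0 = a := rfl

theorem cons_tail (y : ℕ → ℕ) : cons (y 0) (tail y) = y := by
  funext n
  cases n <;> rfl

theorem eq_cons_iff {a : ℕ} {x y : ℕ → ℕ} : y = cons a x ↔ y 0 = a ∧ tail y = x := by
  constructor
  · rintro rfl
    exact ⟨rfl, rfl⟩
  · rintro ⟨rfl, rfl⟩
    exact (cons_tail y).symm

/-- The lexicographic order of the Baire space. -/
def LexLt (x y : ℕ → ℕ) : Prop := ∃ n, (∀ i, i < n → x i = y i) ∧ x n < y n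

theorem RecP.lexLt {x y : TEnv Γ → ℕ → ℕ} (hx : RecF x) (hy : RecF y) :
    RecP fun ρ => LexLt (x ρ) (y ρ) :=
  RecP.ex (RecP.and (RecP.all (RecP.imp (RecP.lt Rec.v0 Rec.v0.wk)
    (RecP.eq (RecF.app hx.wk.wk Rec.v0) (RecF.app hy.wk.wk Rec.v0))))
    (RecP.lt (RecF.app hx.wk Rec.v0) (RecF.app hy.wk Rec.v0)))

end Closure

/-! ### Codes of finite sets -/

/-- The set listed by the code of a finite sequence. -/
def entries (s : ℕ → ℕ) : Set (ℕ → ℕ) := {x | ∃ i, i < s 0 ∧ entry s i = x}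

/-- Codes of strictly increasing finite sequences that vanish at all irrelevant arguments. -/
def IsSorted (s : ℕ → ℕ) : Prop :=
  (∀ j, j < s 0 → ∀ i, i < j → LexLt (entry s i) (entry s j)) ∧
    ∀ k, s 0 ≤ k.unpair.1 → s (k + 1) = 0

theorem isRec_isSorted : IsRec (τ := Ty.two) fun s => ind (IsSorted s) := by
  refine RecG.lam ?_
  have hs : RecF fun ρ : TEnv [Ty.one] => ρ.1 := Rec.v0
  refine RecP.and (RecP.all (RecP.imp (RecP.lt Rec.v0 (RecF.app hs.wk .zero))
    (RecP.all (RecP.imp (RecP.lt Rec.v0 Rec.v0.wk) ?_)))) (RecP.all (RecP.imp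
      (RecP.le (RecF.app hs.wk .zero) (RecN.left Rec.v0))
      (RecP.eq (RecF.app hs.wk (RecN.succ Rec.v0)) .zero)))
  exact RecP.lexLt (RecF.entry hs.wk.wk Rec.v0) (RecF.entry hs.wk.wk Rec.v0.wk)

/-- The finite sequence with a given code. -/
def toList (s : ℕ → ℕ) : List (ℕ → ℕ) := List.ofFn fun i : Fin (s 0) => entry s i

theorem mem_toList {s x : ℕ → ℕ} : x ∈ toList s ↔ x ∈ entries s := by
  rw [toList, List.mem_ofFn]
  constructor
  · rintro ⟨i, hi⟩
    exact ⟨i, i.2, hi⟩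
  · rintro ⟨i, hi, h⟩
    exact ⟨⟨i, hi⟩, h⟩

/-- The code of a finite sequence. -/
def listCode (l : List (ℕ → ℕ)) : ℕ → ℕ
  | 0 => l.length
  | k + 1 => l.getD k.unpair.1 (fun _ => 0) k.unpair.2

theorem entry_listCode (l : List (ℕ → ℕ)) (i : ℕ) :
    entry (listCode l) i = l.getD i fun _ => 0 := by
  funext k
  simp [entry, listCode]

theorem lexLt_iff (x y : ℕ → ℕ) : LexLt x y ↔ toLex x < toLex y := Iff.rfl

theorem IsSorted.pairwise {s : ℕ → ℕ} (h : IsSorted s) : (toList s).Pairwise LexLt :=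
  List.pairwise_ofFn.2 fun i j hij => h.1 j j.2 i hij

theorem IsSorted.nodup {s : ℕ → ℕ} (h : IsSorted s) : (toList s).Nodup :=
  h.pairwise.imp fun hab => by
    rintro rfl
    exact lt_irrefl _ ((lexLt_iff _ _).1 hab)

/-- Strictly increasing lists with the same members coincide, and vanishing at irrelevant arguments
makes the codes equal as functions. Thus a finite set has a single sorted code, which can be
presented to a functional as a singleton. -/
theorem IsSorted.ext {s t : ℕ → ℕ} (hs : IsSorted s) (ht : IsSorted t)
    (h : entries s = entries t) : s = t := by
  have hl : toList s = toList t := by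
    refine List.Perm.eq_of_pairwise (le := LexLt) ?_ hs.pairwise ht.pairwise
      ((List.perm_ext_iff_of_nodup hs.nodup ht.nodup).2 fun x => by rw [mem_toList, mem_toList, h])
    intro a b _ _ hab hba
    exact absurd ((lexLt_iff _ _).1 hab) (lt_asymm ((lexLt_iff _ _).1 hba))
  have h0 : s 0 = t 0 := by
    have := congrArg List.length hl
    rwa [toList, toList, List.length_ofFn, List.length_ofFn] at this
  funext k
  cases k with
  | zero => exact h0
  | succ k =>
    by_cases hk : k.unpair.1 < s 0
    · have h1 : (toList s)[k.unpair.1]'(by simpa [toList] using hk) = entry s k.unpair.1 := by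
        simp [toList]
      have h2 : (toList t)[k.unpair.1]'(by simpa [toList] using h0 ▸ hk) = entry t k.unpair.1 := by
        simp [toList]
      have h3 : entry s k.unpair.1 = entry t k.unpair.1 := by
        rw [← h1, ← h2]
        simp only [hl]
      have h4 := congrFun h3 k.unpair.2
      simpa [entry] using h4
    · rw [hs.2 k (not_lt.1 hk), ht.2 k (h0 ▸ not_lt.1 hk)]

theorem exists_isSorted {X : Set (ℕ → ℕ)} (hX : X.Finite) :
    ∃ s, IsSorted s ∧ entries s = X := by
  let S : Finset (Lex (ℕ → ℕ)) := hX.toFinset.map toLex.toEmbedding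
  let l : List (ℕ → ℕ) := (S.sort (· ≤ ·)).map ofLex
  have hl : l.Pairwise LexLt := List.pairwise_map.2 (Finset.sortedLT_sort S).pairwise
  have hm : ∀ x, x ∈ l ↔ x ∈ X := by
    intro x
    simp [l, S]
  have h1 : ∀ i (hi : i < l.length), entry (listCode l) i = l[i] := by
    intro i hi
    rw [entry_listCode, List.getD_eq_getElem _ _ hi]
  refine ⟨listCode l, ⟨fun j hj i hij => ?_, fun k hk => ?_⟩, ?_⟩
  · rw [h1 j hj, h1 i (hij.trans hj)]
    exact List.pairwise_iff_getElem.1 hl i j (hij.trans hj) hj hij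
  · show l.getD k.unpair.1 (fun _ => 0) k.unpair.2 = 0
    rw [List.getD_eq_default _ _ hk]
  · ext x
    rw [← hm, List.mem_iff_getElem]
    constructor
    · rintro ⟨i, hi, rfl⟩
      exact ⟨i, hi, (h1 i hi).symm⟩
    · rintro ⟨i, hi, rfl⟩
      exact ⟨i, hi, h1 i hi⟩

theorem IsSorted.encard_entries {s : ℕ → ℕ} (h : IsSorted s) : (entries s).encard = s 0 := by
  classical
  have h1 : entries s = ((toList s).toFinset : Set (ℕ → ℕ)) := by
    ext x
    simp [mem_toList]
  rw [h1, Set.encard_coe_eq_coe_finsetCard, List.toFinset_card_of_nodup h.nodup, toList,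
    List.length_ofFn]

open Classical in
/-- The sorted code of a finite set. -/
noncomputable def sortCode (X : Set (ℕ → ℕ)) : ℕ → ℕ :=
  if h : X.Finite then (exists_isSorted h).choose else fun _ => 0

theorem sortCode_spec {X : Set (ℕ → ℕ)} (h : X.Finite) :
    IsSorted (sortCode X) ∧ entries (sortCode X) = X := by
  rw [sortCode, dif_pos h]
  exact (exists_isSorted h).choose_spec

theorem sortCode_zero {X : Set (ℕ → ℕ)} (h : X.Finite) : X.encard = sortCode X 0 := by
  have := (sortCode_spec h).1.encard_entries
  rwa [(sortCode_spec h).2] at this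

/-- A sorted code listing only elements of `X` lists all of them as soon as its length is `|X|`.
Once the cardinality is known, `∃²` decides this condition, with no quantifier over type 1 objects.
-/
theorem eq_sortCode_iff {X : Set (ℕ → ℕ)} (h : X.Finite) (s : ℕ → ℕ) :
    s = sortCode X ↔ IsSorted s ∧ (∀ i, i < s 0 → entry s i ∈ X) ∧ X.encard = s 0 := by
  constructor
  · rintro rfl
    refine ⟨(sortCode_spec h).1, fun i hi => ?_, sortCode_zero h⟩
    have : entry (sortCode X) i ∈ entries (sortCode X) := ⟨i, hi, rfl⟩
    rwa [(sortCode_spec h).2] at this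
  · rintro ⟨h1, h2, h3⟩
    have h4 : entries s ⊆ X := by
      rintro _ ⟨i, hi, rfl⟩
      exact h2 i hi
    have h5 : entries s = X := 
      (h.subset h4).eq_of_subset_of_encard_le h4 (by rw [h3, h1.encard_entries])
    exact h1.ext (sortCode_spec h).1 (h5.trans (sortCode_spec h).2.symm)

/-- The code of a one-element sequence. -/
def single (x : ℕ → ℕ) : ℕ → ℕ
  | 0 => 1
  | k + 1 => if k.unpair.1 = 0 then x k.unpair.2 else 0

theorem entry_single (x : ℕ → ℕ) : entry (single x) 0 = x := by
  funext k
  simp [entry, single]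

theorem sortCode_singleton (x : ℕ → ℕ) : sortCode {x} = single x := by
  refine ((eq_sortCode_iff (Set.finite_singleton x) _).2 ⟨⟨fun j hj i hi => ?_, fun k hk => ?_⟩,
    fun i hi => ?_, ?_⟩).symm
  · change j < 1 at hj
    omega
  · exact if_neg fun h => by rw [h] at hk; exact absurd hk Nat.one_pos.not_ge
  · obtain rfl : i = 0 := Nat.lt_one_iff.1 hi
    exact entry_single x
  · exact Set.encard_singleton x

theorem sortCode_empty : sortCode ∅ = fun _ => 0 :=
  ((eq_sortCode_iff Set.finite_empty _).2 ⟨⟨fun j hj => absurd hj (Nat.not_lt_zero j),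
    fun _ _ => rfl⟩, fun i hi => absurd hi (Nat.not_lt_zero i), by simp⟩).symm

theorem sortCode_zero_eq_zero {X : Set (ℕ → ℕ)} (h : X.Finite) : sortCode X 0 = 0 ↔ X = ∅ := by
  rw [← Set.encard_eq_zero, sortCode_zero h]
  norm_cast

theorem isRec_single : IsRec (τ := Ty.one ⇒ Ty.one) single := by
  refine Rec.lam (RecF.lam ?_)
  have hx : RecF fun ρ : TEnv [Ty.nat, Ty.one] => ρ.2.1 := Rec.v0.wk
  have hk : RecN fun ρ : TEnv [Ty.nat, Ty.one] => ρ.1 := Rec.v0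
  refine (RecN.cond hk (.const 1) (RecN.cond hk.pred.left (hx.app hk.pred.right) .zero)).of_eq ?_
  rintro ⟨_ | k, x, _⟩ <;> rfl

/-! ### The functionals on subsets of the Baire space -/

open Classical in
/-- The functional on subsets of the Baire space with domain `dom` and values `val`. -/
noncomputable def hub {τ : Ty} (dom : Set (ℕ → ℕ) → Prop) (val : Set (ℕ → ℕ) → Tot τ) :
    Par (Ty.two ⇒ τ) := fun G =>
  if h : ∃ X, G = chr X ∧ dom X then toPar (val h.choose) else ⊥

theorem hub_chr {τ : Ty} {dom : Set (ℕ → ℕ) → Prop} {val : Set (ℕ → ℕ) → Tot τ}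
    {X : Set (ℕ → ℕ)} (h : dom X) : hub dom val (chr X) = toPar (val X) := by
  have h' : ∃ Y, chr X = chr Y ∧ dom Y := ⟨X, rfl, h⟩
  exact (dif_pos h').trans
    (congrArg (fun Z => toPar (val Z)) (chr_injective h'.choose_spec.1).symm)

theorem exists_of_hub_ne_bot {τ : Ty} {dom : Set (ℕ → ℕ) → Prop} {val : Set (ℕ → ℕ) → Tot τ}
    {G : Tot Ty.two} (h : hub dom val G ≠ ⊥) : ∃ X, G = chr X ∧ dom X := by
  by_contra hn
  exact h (dif_neg hn)

/-- Decides whether a set with at most one element is nonempty. -/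
noncomputable def nonemptyHub : Par (Ty.two ⇒ Ty.nat) :=
  hub (fun X => X.encard ≤ 1) fun X => ind X.Nonempty

/-- Sorted codes of sets with at most one element. -/
noncomputable def subsingletonHub : Par (Ty.two ⇒ Ty.one) := hub (fun X => X.encard ≤ 1) sortCode

/-- Sorted codes of finite sets. -/
noncomputable def finiteHub : Par (Ty.two ⇒ Ty.one) := hub Set.Finite sortCode

/-- Decides whether the element of a singleton starts with `0`. -/
noncomputable def bitHub : Par (Ty.two ⇒ Ty.nat) :=
  hub (fun X => ∃ x, X = {x}) fun X => ind (∃ x ∈ X, x 0 = 0)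

open Classical in
/-- The element of a singleton. -/
noncomputable def point (X : Set (ℕ → ℕ)) : ℕ → ℕ :=
  if h : X.Nonempty then h.some else fun _ => 0

theorem point_singleton (x : ℕ → ℕ) : point {x} = x := by
  rw [point, dif_pos (Set.singleton_nonempty x)]
  exact (Set.singleton_nonempty x).some_mem

/-- The element of a singleton. -/
noncomputable def singletonHub : Par (Ty.two ⇒ Ty.one) := hub (fun X => ∃ x, X = {x}) point

/-- Query `0` asks whether `X` is nonempty; query `Nat.pair j m + 1` asks the same about the part of
`X` where `x j = m`. If `X = {x}`, the value `x j` is the only `m` with a positive answer. -/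
theorem subsingletonHub_le : ComputableModE2 subsingletonHub nonemptyHub := by
  let Q : Set (ℕ → ℕ) → ℕ → Set (ℕ → ℕ) := fun X n =>
    {x | x ∈ X ∧ (n = 0 ∨ x (n - 1).unpair.1 = (n - 1).unpair.2)}
  let prep : ((ℕ → ℕ) → ℕ) → ℕ → (ℕ → ℕ) → ℕ := fun G n x =>
    ind (G x = 1 ∧ (n = 0 ∨ x (n - 1).unpair.1 = (n - 1).unpair.2))
  let post : ((ℕ → ℕ) → ℕ) → (ℕ → ℕ) → ℕ → ℕ := fun _ y k =>
    if y 0 = 0 then 0 else single (fun j => sInf {m | y (Nat.pair j m + 1) = 1}) k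
  have hprep : IsRec (τ := Ty.two ⇒ Ty.nat ⇒ Ty.two) prep := by
    refine Rec.lam (Rec.lam (RecG.lam ?_))
    have hx : RecF fun ρ : TEnv [Ty.one, Ty.nat, Ty.two] => ρ.1 := Rec.v0
    have hn : RecN fun ρ : TEnv [Ty.one, Ty.nat, Ty.two] => ρ.2.1 := Rec.v0.wk
    have hG : RecG fun ρ : TEnv [Ty.one, Ty.nat, Ty.two] => ρ.2.2.1 := Rec.v0.wk.wk
    exact RecP.and (RecP.eq (hG.app hx) (.const 1)) (RecP.or (RecP.eq hn .zero)
      (RecP.eq (hx.app hn.pred.left) hn.pred.right))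
  have hpost : IsRec (τ := Ty.two ⇒ Ty.one ⇒ Ty.one) post := by
    refine Rec.lam (Rec.lam (RecF.lam ?_))
    have hk : RecN fun ρ : TEnv [Ty.nat, Ty.one, Ty.two] => ρ.1 := Rec.v0
    have hy : RecF fun ρ : TEnv [Ty.nat, Ty.one, Ty.two] => ρ.2.1 := Rec.v0.wk
    refine RecN.cond (hy.app .zero) .zero (RecF.app (RecF.map isRec_single (RecF.lam
      (RecN.sInf (RecP.eq (RecF.app hy.wk.wk ?_) (.const 1))))) hk)
    exact (RecN.pair Rec.v0.wk Rec.v0).succ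
  refine computable_of_queries (α := Ty.nat) hprep hpost fun G hG => ?_
  obtain ⟨X, rfl, hX⟩ := exists_of_hub_ne_bot hG
  refine ⟨fun n => ind (Q X n).Nonempty, fun n => ?_, ?_⟩
  · have h1 : prep (chr X) n = chr (Q X n) := funext fun x =>
      ind_congr (and_congr_left' ind_eq_one)
    rw [h1]
    exact hub_chr (le_trans (Set.encard_le_encard fun x hx => hx.1) hX)
  · refine (hub_chr hX).trans (congrArg (toPar (σ := Ty.one)) ?_)
    rcases Set.encard_le_one_iff_eq.1 hX with rfl | ⟨x, rfl⟩
    · rw [sortCode_empty]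
      funext k
      exact (if_pos (ind_false fun ⟨x, hx⟩ => hx.1)).symm
    · rw [sortCode_singleton]
      funext k
      refine Eq.trans ?_ (if_neg ?_).symm
      · have : (fun j => sInf {m | ind (Q {x} (Nat.pair j m + 1)).Nonempty = 1}) = x := by
          funext j
          have : {m | ind (Q {x} (Nat.pair j m + 1)).Nonempty = 1} = {x j} := by
            ext m
            rw [Set.mem_ofPred_eq, ind_eq_one]
            constructor
            · rintro ⟨_, rfl, h | h⟩
              · exact absurd h (Nat.succ_ne_zero _)
              · simpa using h.symm
            · rintro rfl
              exact ⟨x, rfl, Or.inr (by simp)⟩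
          rw [this, csInf_singleton]
        exact congrFun (congrArg single this.symm) k
      · have : (Q {x} 0).Nonempty := ⟨x, rfl, Or.inl rfl⟩
        exact fun h => ind_eq_zero.1 h this

/-- The hub is applied to the set whose only element is the sorted code of `X`, or to `∅` if `X =
∅`. Membership of `s` is decided recursively: if `s` is sorted, nonempty and lists elements of `X`,
it is the code of `X` iff its length is one more than the cardinality of `X` without the first entry
of `s`, and that cardinality is the length of the code computed for the smaller set. -/
theorem finiteHub_le : ComputableModE2 finiteHub subsingletonHub := by
  let A : ((ℕ → ℕ) → ℕ) → (ℕ → ℕ) → ℕ := fun G s =>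
    ind (s 0 ≠ 0 ∧ IsSorted s ∧ ∀ i, i < s 0 → G (entry s i) = 1)
  let rem : ((ℕ → ℕ) → ℕ) → (ℕ → ℕ) → (ℕ → ℕ) → ℕ := fun G s x =>
    ind (G x = 1 ∧ ¬ x = entry s 0)
  let B : (ℕ → ℕ) → (ℕ → ℕ) → ℕ := fun s t => ind (t 0 + 1 = s 0)
  let post : (ℕ → ℕ) → ℕ → ℕ := fun y k => if y 0 = 0 then 0 else entry y 0 k
  have hA : IsRec (τ := Ty.two ⇒ Ty.one ⇒ Ty.nat) A := by
    refine Rec.lam (RecG.lam ?_)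
    have hs : RecF fun ρ : TEnv [Ty.one, Ty.two] => ρ.1 := Rec.v0
    have hG : RecG fun ρ : TEnv [Ty.one, Ty.two] => ρ.2.1 := Rec.v0.wk
    exact RecP.and (RecP.not (RecP.eq (hs.app .zero) .zero)) (RecP.and
      (RecG.app isRec_isSorted.const hs) (RecP.all (RecP.imp (RecP.lt Rec.v0 (RecF.app hs.wk .zero))
        (RecP.eq (RecG.app hG.wk (RecF.entry hs.wk Rec.v0)) (.const 1)))))
  have hrem : IsRec (τ := Ty.two ⇒ Ty.one ⇒ Ty.two) rem := by
    refine Rec.lam (Rec.lam (RecG.lam ?_))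
    have hx : RecF fun ρ : TEnv [Ty.one, Ty.one, Ty.two] => ρ.1 := Rec.v0
    have hs : RecF fun ρ : TEnv [Ty.one, Ty.one, Ty.two] => ρ.2.1 := Rec.v0.wk
    have hG : RecG fun ρ : TEnv [Ty.one, Ty.one, Ty.two] => ρ.2.2.1 := Rec.v0.wk.wk
    exact RecP.and (RecP.eq (hG.app hx) (.const 1)) (RecP.not (RecP.funEq hx (hs.entry .zero)))
  have hB : IsRec (τ := Ty.one ⇒ Ty.one ⇒ Ty.nat) B := by
    refine Rec.lam (RecG.lam ?_)
    have ht : RecF fun ρ : TEnv [Ty.one, Ty.one] => ρ.1 := Rec.v0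
    have hs : RecF fun ρ : TEnv [Ty.one, Ty.one] => ρ.2.1 := Rec.v0.wk
    exact RecP.eq (ht.app .zero).succ (hs.app .zero)
  have hpost : IsRec (τ := Ty.one ⇒ Ty.one) post := by
    refine Rec.lam (RecF.lam ?_)
    have hy : RecF fun ρ : TEnv [Ty.nat, Ty.one] => ρ.2.1 := Rec.v0.wk
    exact RecN.cond (hy.app .zero) .zero ((hy.entry .zero).app Rec.v0)
  have hremX : ∀ X s, rem (chr X) s = chr (X \ {entry s 0}) := fun X s => funext fun x =>
    ind_congr (and_congr_left' ind_eq_one)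
  have hset : ∀ G : (ℕ → ℕ) → ℕ, ∀ X, G = chr X → {x | G x = 1} = X := by
    rintro _ X rfl
    ext x
    exact ind_eq_one
  have hAX : ∀ X s, A (chr X) s ≠ 0 ↔ s 0 ≠ 0 ∧ IsSorted s ∧ ∀ i, i < s 0 → entry s i ∈ X := by
    intro X s
    refine Iff.trans (Iff.trans (not_congr ind_eq_zero) not_not) ?_
    refine and_congr_right' (and_congr_right' (forall_congr' fun i => imp_congr_right fun _ => ?_))
    exact ind_eq_one
  refine computable_of_recursion (A := A) (B := B) (rem := rem) (post := post) hA hrem hB hpost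
    (fun G => ∃ X, G = chr X ∧ X.Finite) (fun G => {x | (G x : ℕ) = (1 : ℕ)}.ncard)
    (fun G => sortCode {x | (G x : ℕ) = (1 : ℕ)}) ?_ ?_ ?_
  · rintro _ ⟨X, rfl, hX⟩ s hs
    obtain ⟨h0, -, h2⟩ := (hAX X s).1 hs
    refine ⟨⟨X \ {entry s 0}, hremX X s, hX.sdiff⟩, ?_⟩
    show {x | rem (chr X) s x = 1}.ncard < {x | chr X x = 1}.ncard
    rw [hset _ _ (hremX X s), hset _ X rfl]
    exact Set.ncard_sdiff_singleton_lt_of_mem (h2 0 (Nat.pos_of_ne_zero h0)) hX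
  · rintro _ ⟨X, rfl, hX⟩
    -- The query built by the recursion is the characteristic function of a set with at most one
    -- element.
    have hq : (fun s => if A (chr X) s = 0 then 0 else
        B s (sortCode {x | rem (chr X) s x = 1})) = chr {s | X ≠ ∅ ∧ s = sortCode X} := by
      funext s
      have key : (A (chr X) s ≠ 0 ∧ sortCode {x | rem (chr X) s x = 1} 0 + 1 = s 0) ↔
          (X ≠ ∅ ∧ s = sortCode X) := by
        rw [hAX, eq_sortCode_iff hX, hset _ _ (hremX X s)]
        -- The recursive value delivers the cardinality of `X` required by `eq_sortCode_iff`.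
        have hd : entry s 0 ∈ X → X.encard = sortCode (X \ {entry s 0}) 0 + 1 := fun h => by
          rw [← sortCode_zero hX.sdiff, Set.encard_sdiff_singleton_add_one h]
        constructor
        · rintro ⟨⟨h0, h1, h2⟩, h3⟩
          have hm := h2 0 (Nat.pos_of_ne_zero h0)
          refine ⟨fun h => by rw [h] at hm; exact hm, h1, h2, ?_⟩
          rw [hd hm, ← h3]
          norm_cast
        · rintro ⟨h0, h1, h2, h3⟩
          have h4 : s 0 ≠ 0 := fun h => h0 (by
            rw [h] at h3
            exact Set.encard_eq_zero.1 h3)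
          have hm := h2 0 (Nat.pos_of_ne_zero h4)
          refine ⟨⟨h4, h1, h2⟩, ?_⟩
          rw [hd hm] at h3
          exact_mod_cast h3
      show _ = ind _
      rw [Set.mem_ofPred_eq, ← key]
      by_cases h : A (chr X) s = 0
      · rw [if_pos h, ind_false fun h' => h'.1 h]
      · rw [if_neg h]
        exact ind_congr ⟨fun h' => ⟨h, h'⟩, fun h' => h'.2⟩
    refine ⟨sortCode {s | X ≠ ∅ ∧ s = sortCode X}, ?_, ?_⟩
    · refine (congrArg subsingletonHub hq).trans (hub_chr ?_)
      rw [Set.encard_le_one_iff]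
      rintro a b ⟨-, rfl⟩ ⟨-, rfl⟩
      rfl
    · show sortCode {x | chr X x = 1} = _
      rw [hset _ X rfl]
      by_cases hX0 : X = ∅
      · have : {s | X ≠ ∅ ∧ s = sortCode X} = ∅ :=
          Set.eq_empty_of_forall_notMem fun s hs => hs.1 hX0
        rw [this, sortCode_empty, hX0, sortCode_empty]
        rfl
      · have : {s | X ≠ ∅ ∧ s = sortCode X} = {sortCode X} :=
          Set.ext fun s => and_iff_right hX0
        rw [this, sortCode_singleton]
        funext k
        refine Eq.symm ((if_neg one_ne_zero).trans ?_)
        rw [entry_single]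
  · intro G hG
    obtain ⟨X, rfl, hX⟩ := exists_of_hub_ne_bot hG
    refine ⟨⟨X, rfl, hX⟩, (hub_chr hX).trans ?_⟩
    show _ = toPar (σ := Ty.one) (sortCode {x | chr X x = 1})
    rw [hset _ X rfl]

/-- For each `n = Nat.pair k m` the element `x` is prefixed with `0` if `x k = m` and with `1`
otherwise. The set remains a singleton, and its bit tells whether `(k, m)` is in the graph of `x`.
-/
theorem singletonHub_le : ComputableModE2 singletonHub bitHub := by
  let prep : ((ℕ → ℕ) → ℕ) → ℕ → (ℕ → ℕ) → ℕ := fun G n y =>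
    ind (G (tail y) = 1 ∧ y 0 = ind (¬ tail y n.unpair.1 = n.unpair.2))
  let post : ((ℕ → ℕ) → ℕ) → (ℕ → ℕ) → ℕ → ℕ := fun _ y k => sInf {m | y (Nat.pair k m) = 1}
  have hprep : IsRec (τ := Ty.two ⇒ Ty.nat ⇒ Ty.two) prep := by
    refine Rec.lam (Rec.lam (RecG.lam ?_))
    have hx : RecF fun ρ : TEnv [Ty.one, Ty.nat, Ty.two] => ρ.1 := Rec.v0
    have hn : RecN fun ρ : TEnv [Ty.one, Ty.nat, Ty.two] => ρ.2.1 := Rec.v0.wk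
    have hG : RecG fun ρ : TEnv [Ty.one, Ty.nat, Ty.two] => ρ.2.2.1 := Rec.v0.wk.wk
    exact RecP.and (RecP.eq (hG.app hx.tail) (.const 1)) (RecP.eq (hx.app .zero)
      (RecP.not (RecP.eq (hx.tail.app hn.left) hn.right)))
  have hpost : IsRec (τ := Ty.two ⇒ Ty.one ⇒ Ty.one) post := by
    refine Rec.lam (Rec.lam (RecF.lam (RecN.sInf (RecP.eq (RecF.app
      (f := fun ρ : TEnv [Ty.nat, Ty.nat, Ty.one, Ty.two] => ρ.2.2.1) Rec.v0.wk.wk ?_)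
        (.const 1)))))
    exact RecN.pair Rec.v0.wk Rec.v0
  refine computable_of_queries (α := Ty.nat) hprep hpost fun G hG => ?_
  obtain ⟨X, rfl, x, rfl⟩ := exists_of_hub_ne_bot hG
  refine ⟨fun n => ind (x n.unpair.1 = n.unpair.2), fun n => ?_, ?_⟩
  · have h1 : prep (chr {x}) n = chr {cons (ind (¬ x n.unpair.1 = n.unpair.2)) x} :=
      funext fun y => ind_congr (by
        rw [Set.mem_singleton_iff, eq_cons_iff, and_comm]
        refine Iff.trans (and_congr_right' ind_eq_one) ?_
        rw [Set.mem_singleton_iff]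
        exact and_congr_left fun h => by rw [h])
    rw [h1]
    refine (hub_chr ⟨_, rfl⟩).trans (congrArg (toPar (σ := Ty.nat)) (ind_congr ?_))
    simp
  · refine (hub_chr ⟨x, rfl⟩).trans (congrArg (toPar (σ := Ty.one)) ?_)
    rw [point_singleton]
    funext k
    have : {m | ind (x (Nat.pair k m).unpair.1 = (Nat.pair k m).unpair.2) = 1} = {x k} := by
      ext m
      rw [Set.mem_ofPred_eq, ind_eq_one, Nat.unpair_pair]
      exact eq_comm
    exact (csInf_singleton (x k)).symm.trans (congrArg sInf this.symm)

/-! ### Every functional in one of the classes computes the corresponding hub -/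

variable {D : Dom}

/-- The elements of `X`, with an additional first term less than `n`. -/
def copies (X : Set (ℕ → ℕ)) (n : ℕ) : Set (ℕ → ℕ) := {y | tail y ∈ X ∧ y 0 < n}

theorem copies_empty (n : ℕ) : copies ∅ n = ∅ := Set.eq_empty_of_forall_notMem fun _ h => h.1

theorem encard_copies_singleton (x : ℕ → ℕ) (n : ℕ) : (copies {x} n).encard = n := by
  have h : copies {x} n = (fun a => cons a x) '' (Finset.range n : Set ℕ) := by
    ext y
    constructor
    · rintro ⟨h1, h2⟩
      exact ⟨y 0, Finset.mem_coe.2 (Finset.mem_range.2 h2),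
        (eq_cons_iff.2 ⟨rfl, Set.mem_singleton_iff.1 h1⟩).symm⟩
    · rintro ⟨a, ha, rfl⟩
      exact ⟨Set.mem_singleton _, Finset.mem_range.1 (Finset.mem_coe.1 ha)⟩
  have hi : Function.Injective fun a => cons a x := fun a b hab => congrFun hab 0
  rw [h, hi.encard_image, Set.encard_coe_eq_coe_finsetCard, Finset.card_range]

noncomputable def copiesChr (G : (ℕ → ℕ) → ℕ) (n : ℕ) (y : ℕ → ℕ) : ℕ :=
  ind (G (tail y) = 1 ∧ y 0 < n)

theorem copiesChr_chr (X : Set (ℕ → ℕ)) (n : ℕ) : copiesChr (chr X) n = chr (copies X n) :=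
  funext fun _ => ind_congr (and_congr_left' ind_eq_one)

theorem RecG.copiesChr {Γ : List Ty} {G : TEnv Γ → (ℕ → ℕ) → ℕ} {n : TEnv Γ → ℕ} (hG : RecG G)
    (hn : RecN n) : RecG fun ρ => copiesChr (G ρ) (n ρ) :=
  RecG.lam (RecP.and (RecP.eq (RecG.app hG.wk (RecF.tail Rec.v0)) (.const 1))
    (RecP.lt (RecF.app (f := fun ρ : TEnv (Ty.one :: Γ) => ρ.1) Rec.v0 .zero) hn.wk))

/-- The list may contain points outside `Z`; testing each entry with the representative of `Z`
discards them. -/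
theorem Dom.Lists.exists_entry_iff {Z : Set D.Pt} {s : ℕ → ℕ} {F : Tot Ty.two} (h : D.Lists Z s)
    (hF : D.RepSet F Z) {q : (ℕ → ℕ) → Prop} {q' : D.Pt → Prop}
    (hq : ∀ z p, D.Names z p → p ∈ Z → (q z ↔ q' p)) :
    (∃ i, i < s 0 ∧ F (entry s i) = (1 : ℕ) ∧ q (entry s i)) ↔ ∃ p ∈ Z, q' p := by
  obtain ⟨l, ⟨h0, h1⟩, h2⟩ := h
  constructor
  · rintro ⟨i, hi, hFi, hqi⟩
    have hn := h1 i (h0 ▸ hi)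
    have hm := ind_eq_one.1 ((DomCode.repSet_iff.1 hF _ _ hn).symm.trans hFi)
    exact ⟨_, hm, (hq _ _ hn hm).1 hqi⟩
  · rintro ⟨p, hp, hqp⟩
    obtain ⟨i, hi, rfl⟩ := List.mem_iff_getElem.1 (h2 p hp)
    exact ⟨i, h0 ▸ hi, (DomCode.repSet_iff.1 hF _ _ (h1 i hi)).trans (ind_true hp),
      (hq _ _ (h1 i hi) hp).2 hqp⟩

theorem bitHub_le_of_mem_omegaOne {Φ : Par (Ty.two ⇒ Ty.one)} (hΦ : Φ ∈ OmegaOne D) :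
    ComputableModE2 bitHub Φ := by
  let c := domCode D
  let prep : ((ℕ → ℕ) → ℕ) → ℕ → (ℕ → ℕ) → ℕ := fun G _ => c.push G
  let post : ((ℕ → ℕ) → ℕ) → (ℕ → ℕ → ℕ) → ℕ := fun _ y => ind (c.dec (y 0) 0 = 0)
  have hprep : IsRec (τ := Ty.two ⇒ Ty.nat ⇒ Ty.two) prep :=
    Rec.lam (Rec.lam (RecG.map c.isRec_push Rec.v0.wk))
  have hpost : IsRec (τ := Ty.two ⇒ (Ty.nat ⇒ Ty.one) ⇒ Ty.nat) post := by
    refine Rec.lam (Rec.lam (RecP.eq (RecF.app (RecF.map c.dec_rec ?_) .zero) .zero))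
    exact RecF.seqApp Rec.v0 .zero
  refine computable_of_queries (α := Ty.one) hprep hpost fun G hG => ?_
  obtain ⟨X, rfl, x, rfl⟩ := exists_of_hub_ne_bot hG
  obtain ⟨y, hy, p, hp, hn⟩ := (hΦ (c.push (chr {x}))).1 (c.emb '' {x}) (c.repSet_push _)
    ⟨c.emb x, Set.image_singleton⟩
  obtain rfl : c.emb x = p := by
    rw [Set.image_singleton] at hp
    exact Set.singleton_injective hp
  refine ⟨fun _ => y, fun _ => hy, (hub_chr ⟨x, rfl⟩).trans
    (congrArg (toPar (σ := Ty.nat)) (ind_congr ?_))⟩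
  rw [c.dec_eq hn]
  simp

/-- The singleton `{x}` is replaced by `n` tagged copies of `x`. The tag is coordinate `0`, so the
first value of `x` sits at coordinate `1` of any genuine entry of the output. -/
theorem bitHub_le_of_mem_omegaEq {n : ℕ} (hn : 1 ≤ n) {Φ : Par (Ty.two ⇒ Ty.one)}
    (hΦ : Φ ∈ OmegaEq n) : ComputableModE2 bitHub Φ := by
  let c := unitCode
  let prep : ((ℕ → ℕ) → ℕ) → ℕ → (ℕ → ℕ) → ℕ := fun G _ => c.push (copiesChr G n)
  let post : ((ℕ → ℕ) → ℕ) → (ℕ → ℕ → ℕ) → ℕ := fun G y =>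
    ind (∃ i, i < y 0 0 ∧ c.push (copiesChr G n) (entry (y 0) i) = 1 ∧
      c.dec (entry (y 0) i) 1 = 0)
  have hprep : IsRec (τ := Ty.two ⇒ Ty.nat ⇒ Ty.two) prep :=
    Rec.lam (Rec.lam (RecG.map c.isRec_push (RecG.copiesChr Rec.v0.wk (.const n))))
  have hpost : IsRec (τ := Ty.two ⇒ (Ty.nat ⇒ Ty.one) ⇒ Ty.nat) post := by
    refine Rec.lam (Rec.lam (RecP.ex ?_))
    have hi : RecN fun ρ : TEnv [Ty.nat, Ty.nat ⇒ Ty.one, Ty.two] => ρ.1 := Rec.v0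
    have hG : RecG fun ρ : TEnv [Ty.nat, Ty.nat ⇒ Ty.one, Ty.two] => ρ.2.2.1 := Rec.v0.wk.wk
    have hy : Rec (τ := Ty.nat ⇒ Ty.one) fun ρ : TEnv [Ty.nat, Ty.nat ⇒ Ty.one, Ty.two] => ρ.2.1 :=
      Rec.v0.wk
    have hs := RecF.seqApp hy .zero
    exact RecP.and (RecP.lt hi (hs.app .zero)) (RecP.and (RecP.eq (RecG.app
      (RecG.map c.isRec_push (RecG.copiesChr hG (.const n))) (hs.entry hi)) (.const 1))
      (RecP.eq (RecF.app (RecF.map c.dec_rec (hs.entry hi)) (.const 1)) .zero))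
  refine computable_of_queries (α := Ty.one) hprep hpost fun G hG => ?_
  obtain ⟨X, rfl, x, rfl⟩ := exists_of_hub_ne_bot hG
  have hrep := c.repSet_push (copies {x} n)
  obtain ⟨y, hy, hl⟩ := (hΦ (c.push (chr (copies {x} n)))).1 _ hrep
    (Eq.trans (c.emb_injective.encard_image _) (encard_copies_singleton x n))
  refine ⟨fun _ => y, fun _ => ?_, (hub_chr ⟨x, rfl⟩).trans
    (congrArg (toPar (σ := Ty.nat)) (ind_congr ?_))⟩
  · rw [← hy, ← copiesChr_chr]
  · rw [copiesChr_chr]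
    refine Iff.trans ?_ (hl.exists_entry_iff hrep (q := fun z => c.dec z 1 = 0)
      (q' := fun p => c.dec (c.cname p) 1 = 0) ?_).symm
    · constructor
      · rintro ⟨x', hx', h⟩
        obtain rfl := Set.mem_singleton_iff.1 hx'
        refine ⟨_, ⟨cons 0 x', ⟨rfl, hn⟩, rfl⟩, ?_⟩
        rw [c.dec_cname_emb]
        exact h
      · rintro ⟨_, ⟨y, hy, rfl⟩, h⟩
        rw [c.dec_cname_emb] at h
        refine ⟨x, rfl, ?_⟩
        rw [← Set.mem_singleton_iff.1 hy.1]
        exact h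
    · rintro z _ hz ⟨y, hy, rfl⟩
      rw [c.dec_cname_emb, c.dec_eq hz]

theorem nonemptyHub_le_of_mem_lists {dom : Set D.Pt → Prop} (hdom : ∀ X, X.encard ≤ 1 → dom X)
    {Φ : Par (Ty.two ⇒ Ty.one)} (hΦ : Φ ∈ D.SetFunctional Ty.one dom D.Lists) :
    ComputableModE2 nonemptyHub Φ := by
  let c := domCode D
  let prep : ((ℕ → ℕ) → ℕ) → ℕ → (ℕ → ℕ) → ℕ := fun G _ => c.push G
  let post : ((ℕ → ℕ) → ℕ) → (ℕ → ℕ → ℕ) → ℕ := fun G y =>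
    -- The vacuous conjunct gives the formula the shape of `Dom.Lists.exists_entry_iff`.
    ind (∃ i, i < y 0 0 ∧ c.push G (entry (y 0) i) = 1 ∧ (0 : ℕ) = 0)
  have hprep : IsRec (τ := Ty.two ⇒ Ty.nat ⇒ Ty.two) prep :=
    Rec.lam (Rec.lam (RecG.map c.isRec_push Rec.v0.wk))
  have hpost : IsRec (τ := Ty.two ⇒ (Ty.nat ⇒ Ty.one) ⇒ Ty.nat) post := by
    refine Rec.lam (Rec.lam (RecP.ex ?_))
    have hi : RecN fun ρ : TEnv [Ty.nat, Ty.nat ⇒ Ty.one, Ty.two] => ρ.1 := Rec.v0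
    have hG : RecG fun ρ : TEnv [Ty.nat, Ty.nat ⇒ Ty.one, Ty.two] => ρ.2.2.1 := Rec.v0.wk.wk
    have hy : Rec (τ := Ty.nat ⇒ Ty.one) fun ρ : TEnv [Ty.nat, Ty.nat ⇒ Ty.one, Ty.two] => ρ.2.1 :=
      Rec.v0.wk
    have hs := RecF.seqApp hy .zero
    exact RecP.and (RecP.lt hi (hs.app .zero)) (RecP.and (RecP.eq (RecG.app
      (RecG.map c.isRec_push hG) (hs.entry hi)) (.const 1)) (RecP.eq .zero .zero))
  refine computable_of_queries (α := Ty.one) hprep hpost fun G hG => ?_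
  obtain ⟨X, rfl, hX⟩ := exists_of_hub_ne_bot hG
  have hrep := c.repSet_push X
  obtain ⟨y, hy, hl⟩ := (hΦ (c.push (chr X))).1 _ hrep
    (hdom _ (by rwa [c.emb_injective.encard_image]))
  refine ⟨fun _ => y, fun _ => hy, (hub_chr hX).trans
    (congrArg (toPar (σ := Ty.nat)) (ind_congr ?_))⟩
  refine Iff.trans ?_ (hl.exists_entry_iff hrep (q := fun _ => (0 : ℕ) = 0)
    (q' := fun _ => True) fun _ _ _ _ => by simp).symm
  rw [← Set.image_nonempty (f := c.emb)]
  exact ⟨fun ⟨p, hp⟩ => ⟨p, hp, trivial⟩, fun ⟨p, hp, _⟩ => ⟨p, hp⟩⟩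

/-- Let `y n` be the bound returned for `n` tagged copies of `X`. If `X` is empty, all queries
coincide and `y` is constant; if `X` is a singleton, `n = y 0 + 1` copies force a bound larger than
`y 0`. -/
theorem nonemptyHub_le_of_mem_omegaCardBound {Φ : Par (Ty.two ⇒ Ty.nat)}
    (hΦ : Φ ∈ OmegaCardBound) : ComputableModE2 nonemptyHub Φ := by
  let c := unitCode
  let prep : ((ℕ → ℕ) → ℕ) → ℕ → (ℕ → ℕ) → ℕ := fun G n => c.push (copiesChr G n)
  let post : ((ℕ → ℕ) → ℕ) → (ℕ → ℕ) → ℕ := fun _ y => ind (¬ y (y 0 + 1) = y 0)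
  have hprep : IsRec (τ := Ty.two ⇒ Ty.nat ⇒ Ty.two) prep :=
    Rec.lam (Rec.lam (RecG.map c.isRec_push (RecG.copiesChr Rec.v0.wk Rec.v0)))
  have hpost : IsRec (τ := Ty.two ⇒ Ty.one ⇒ Ty.nat) post := by
    refine Rec.lam (Rec.lam ?_)
    have hy : RecF fun ρ : TEnv [Ty.one, Ty.two] => ρ.1 := Rec.v0
    exact RecP.not (RecP.eq (hy.app (hy.app .zero).succ) (hy.app .zero))
  refine computable_of_queries (α := Ty.nat) hprep hpost fun G hG => ?_
  obtain ⟨X, rfl, hX⟩ := exists_of_hub_ne_bot hG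
  have hX' : X = ∅ ∨ ∃ x, X = {x} := Set.encard_le_one_iff_eq.1 hX
  have hfin : ∀ n, (copies X n).Finite := by
    intro n
    rcases hX' with rfl | ⟨x, rfl⟩
    · rw [copies_empty]
      exact Set.finite_empty
    · exact Set.finite_of_encard_eq_coe (encard_copies_singleton x n)
  have hy : ∀ n, ∃ m : ℕ, Φ (c.push (chr (copies X n))) = toPar (σ := Ty.nat) m ∧
      (c.emb '' copies X n).encard ≤ m := fun n =>
    (hΦ (c.push (chr (copies X n)))).1 _ (c.repSet_push _) ((hfin n).image _)
  choose y hy1 hy2 using hy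
  refine ⟨y, fun n => ?_, (hub_chr hX).trans (congrArg (toPar (σ := Ty.nat)) (ind_congr ?_))⟩
  · exact (congrArg (fun F => Φ (c.push F)) (copiesChr_chr X n)).trans (hy1 n)
  · rcases hX' with rfl | ⟨x, rfl⟩
    · have : y (y 0 + 1) = y 0 := by
        refine toPar_injective (σ := Ty.nat) ((hy1 _).symm.trans (Eq.trans ?_ (hy1 _)))
        rw [copies_empty, copies_empty]
      simp [this]
    · have h := hy2 (y 0 + 1)
      rw [c.emb_injective.encard_image, encard_copies_singleton] at h
      have h' : y 0 + 1 ≤ y (y 0 + 1) := by exact_mod_cast h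
      exact iff_of_true (Set.singleton_nonempty x) (by omega)

/-! #### Enumeration functionals and suprema -/

theorem Dom.Enumerates.zero_eq {A : Set D.Pt} {e : ℕ → ℕ → ℕ} (h : D.Enumerates A e) :
    e 0 0 = ind A.Nonempty := by
  rcases h with ⟨x, rfl, hx⟩ | ⟨rfl, hx⟩
  · rw [ind_true (Set.range_nonempty x)]
    exact (hx 0).1
  · rw [ind_false Set.not_nonempty_empty]
    exact (hx 0).1

/-- The sequences with tail `x` are mapped bijectively onto `ℕ` by their first value, so they form
an admissible input; coordinate `1` of any enumerated element is `x 0`. -/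
theorem bitHub_le_of_mem_weakEnumeration {Φ : Par (Ty.two ⇒ Ty.two ⇒ Ty.nat ⇒ Ty.one)}
    (hΦ : Φ ∈ WeakEnumerationFunctional) : ComputableModE2 bitHub Φ := by
  let c := unitCode
  let prep : ((ℕ → ℕ) → ℕ) → (ℕ → ℕ) → ℕ := fun G =>
    c.push fun y => ind (G (tail y) = 1)
  let post : (ℕ → ℕ → ℕ) → ℕ := fun e => ind (c.dec (entry (e 0) 0) 1 = 0)
  have hprep : IsRec (τ := Ty.two ⇒ Ty.two) prep := by
    have h : RecG fun (ρ : TEnv [Ty.two]) y => ind ((ρ.1 : (ℕ → ℕ) → ℕ) (tail y) = (1 : ℕ)) :=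
      RecG.lam (RecP.eq (RecG.app (G := fun ρ : TEnv [Ty.one, Ty.two] => ρ.2.1) Rec.v0.wk
        (RecF.tail Rec.v0)) (.const 1))
    exact Rec.lam (RecG.map (F := c.push) c.isRec_push h)
  have hpost : IsRec (τ := (Ty.nat ⇒ Ty.one) ⇒ Ty.nat) post := by
    have he : Rec (τ := Ty.nat ⇒ Ty.one) fun ρ : TEnv [Ty.nat ⇒ Ty.one] => ρ.1 := Rec.v0
    exact Rec.lam (RecP.eq (RecF.app (RecF.map c.dec_rec ((RecF.seqApp he .zero).entry .zero))
      (.const 1)) .zero)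
  refine computable_of_query₂ (α := Ty.nat ⇒ Ty.one) hprep (c.isRec_coord 0) hpost fun G hG => ?_
  obtain ⟨X, rfl, x, rfl⟩ := exists_of_hub_ne_bot hG
  let Z : Set (ℕ → ℕ) := {y | tail y = x}
  have hZ : prep (chr {x}) = c.push (chr Z) :=
    congrArg c.push (funext fun y => ind_congr ind_eq_one)
  obtain ⟨e, he, hen⟩ := (hΦ (c.push (chr Z)) (c.coord 0)).1 _ _ (c.repSet_push Z)
    (c.repFun_coord 0) (by
      constructor
      · rintro _ ⟨y, hy, rfl⟩ _ ⟨y', hy', rfl⟩ h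
        simp only [c.dec_cname_emb] at h
        rw [eq_cons_iff.2 ⟨h, hy.trans (Eq.symm hy')⟩, cons_tail]
      · intro n _
        refine ⟨_, ⟨cons n x, rfl, rfl⟩, ?_⟩
        show c.dec (c.cname (c.emb (cons n x))) 0 = n
        rw [c.dec_cname_emb]
        rfl)
  refine ⟨e, (congrArg (fun F => Φ F (c.coord 0)) hZ).trans he, (hub_chr ⟨x, rfl⟩).trans
    (congrArg (toPar (σ := Ty.nat)) (ind_congr ?_))⟩
  rcases hen with ⟨p, hp, hn⟩ | ⟨h0, -⟩
  · obtain ⟨y, hy, hyp⟩ : p 0 ∈ c.emb '' Z := hp ▸ Set.mem_range_self 0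
    have h1 : Dom.unit.Names (entry (e (0 : ℕ)) 0) (c.emb y) := hyp ▸ (hn 0).2 0 Nat.one_pos
    rw [c.dec_eq h1]
    constructor
    · rintro ⟨_, rfl, h⟩
      exact (congrFun hy 0).trans h
    · intro h
      exact ⟨x, rfl, (congrFun hy 0).symm.trans h⟩
  · exact absurd h0 (Set.Nonempty.ne_empty ⟨_, cons 0 x, rfl, rfl⟩)

/-- Any function is injective on a set with at most one element, and the length of the first term
distinguishes the null sequence from a genuine enumeration. -/
theorem nonemptyHub_le_of_mem_enumeration {Φ : Par (Ty.two ⇒ Ty.two ⇒ Ty.nat ⇒ Ty.one)}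
    (hΦ : Φ ∈ EnumerationFunctional) : ComputableModE2 nonemptyHub Φ := by
  let c := unitCode
  let post : (ℕ → ℕ → ℕ) → ℕ := fun e => e 0 0
  have hpost : IsRec (τ := (Ty.nat ⇒ Ty.one) ⇒ Ty.nat) post :=
    Rec.lam (RecF.app (f := fun ρ : TEnv [Ty.nat ⇒ Ty.one] => (ρ.1 : ℕ → ℕ → ℕ) (0 : ℕ))
      (RecF.seqApp (e := fun ρ : TEnv [Ty.nat ⇒ Ty.one] => ρ.1) Rec.v0 .zero) .zero)
  refine computable_of_query₂ (α := Ty.nat ⇒ Ty.one) c.isRec_push (c.isRec_coord 0) hpost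
    fun G hG => ?_
  obtain ⟨X, rfl, hX⟩ := exists_of_hub_ne_bot hG
  obtain ⟨e, he, hen⟩ := (hΦ (c.push (chr X)) (c.coord 0)).1 _ _ (c.repSet_push X)
    (c.repFun_coord 0) (by
      rintro _ ⟨y, hy, rfl⟩ _ ⟨y', hy', rfl⟩ -
      rw [Set.encard_le_one_iff.1 hX y y' hy hy'])
  refine ⟨e, he, (hub_chr hX).trans (congrArg (toPar (σ := Ty.nat)) ?_)⟩
  rw [← Set.image_nonempty (f := c.emb)]
  exact hen.zero_eq.symm

/-- Since `0` codes the pair `(0, 0)`, the first ternary digit records whether `y 0 = 0`. With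
`embReal_le` this leaves a gap between `2 / 9` and `1 / 3`, which a supremum cannot bridge. -/
theorem embReal_ge {y : ℕ → ℕ} (hy : y 0 = 0) : 1 / 3 ≤ embReal y := by
  have h : graphDigits y 1 = 1 := by
    rw [graphDigits_succ, show (0 : ℕ).unpair = (0, 0) from rfl, ind_true hy]
    rfl
  have := (embReal_bounds y 1).1
  rw [h] at this
  norm_num at this
  linarith

theorem embReal_le {y : ℕ → ℕ} (hy : y 0 ≠ 0) : embReal y ≤ 2 / 9 := by
  have h : graphDigits y 1 = 0 := by
    rw [graphDigits_succ, show (0 : ℕ).unpair = (0, 0) from rfl, ind_false hy]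
    rfl
  have := (embReal_bounds y 1).2
  rw [h] at this
  norm_num at this
  linarith

theorem tfloor_one_eq_zero_iff {z : ℕ → ℕ} {r : ℝ} (h : CodesReal z r) (hr : 0 ≤ r) :
    tfloor z 1 = 0 ↔ r < 1 / 3 := by
  rw [tfloor_eq h hr, Nat.floor_eq_zero]
  constructor <;> intro <;> linarith

/-- The supremum of the image of a set in the unit interval tells whether some element starts
with `0`. -/
theorem NamesSup.tfloor_ne_zero_iff {Z : Set (ℕ → ℕ)} {z : ℕ → ℕ}
    (h : NamesSup (unitCode.emb '' Z) z) : ¬ tfloor z 1 = 0 ↔ ∃ y ∈ Z, y 0 = 0 := by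
  obtain ⟨p, hp, hz⟩ := h
  rw [tfloor_one_eq_zero_iff hz p.2.1, not_lt]
  constructor
  · intro h
    by_contra! hn
    have : p ≤ (⟨2 / 9, by norm_num, by norm_num⟩ : unitInterval) := hp.2 (by
      rintro _ ⟨y, hy, rfl⟩
      exact embReal_le (hn y hy))
    have : p.1 ≤ 2 / 9 := this
    linarith
  · rintro ⟨y, hy, h0⟩
    exact (embReal_ge h0).trans (hp.1 ⟨y, hy, rfl⟩)

theorem isRec_tfloor_one_ne_zero : IsRec (τ := Ty.one ⇒ Ty.nat) fun z => ind (¬ tfloor z 1 = 0) :=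
  RecG.lam (RecP.not (RecP.eq (RecN.tfloor Rec.v0 (.const 1)) .zero))

/-- The input consists of the sequences `x 0, n, x 0, x 1, …` for all `n`. Coordinate `1` maps it
bijectively onto `ℕ`, and all its elements start with `x 0`, so the supremum reveals whether `x 0 =
0`. -/
theorem bitHub_le_of_mem_weakOmegaBW {Φ : Par (Ty.two ⇒ Ty.two ⇒ Ty.one)}
    (hΦ : Φ ∈ WeakOmegaBW) : ComputableModE2 bitHub Φ := by
  let c := unitCode
  let prep : ((ℕ → ℕ) → ℕ) → (ℕ → ℕ) → ℕ := fun G =>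
    c.push fun y => ind (G (tail (tail y)) = 1 ∧ y 0 = y 2)
  have hprep : IsRec (τ := Ty.two ⇒ Ty.two) prep := by
    have hy : RecF fun ρ : TEnv [Ty.one, Ty.two] => ρ.1 := Rec.v0
    have h : RecG fun (ρ : TEnv [Ty.two]) y =>
        ind ((ρ.1 : (ℕ → ℕ) → ℕ) (tail (tail y)) = (1 : ℕ) ∧ y 0 = y 2) :=
      RecG.lam (RecP.and (RecP.eq (RecG.app (G := fun ρ : TEnv [Ty.one, Ty.two] => ρ.2.1)
        Rec.v0.wk hy.tail.tail) (.const 1)) (RecP.eq (hy.app .zero) (hy.app (.const 2))))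
    exact Rec.lam (RecG.map (F := c.push) c.isRec_push h)
  refine computable_of_query₂ (α := Ty.one) hprep (c.isRec_coord 1) isRec_tfloor_one_ne_zero
    fun G hG => ?_
  obtain ⟨X, rfl, x, rfl⟩ := exists_of_hub_ne_bot hG
  let Z : Set (ℕ → ℕ) := {y | tail (tail y) = x ∧ y 0 = y 2}
  have hZ : prep (chr {x}) = c.push (chr Z) :=
    congrArg c.push (funext fun y => ind_congr (and_congr_left' ind_eq_one))
  have h0 : ∀ y ∈ Z, y 0 = x 0 := fun y hy => hy.2.trans (congrFun hy.1 0)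
  have hmem : ∀ n, cons (x 0) (cons n x) ∈ Z := fun n => ⟨rfl, rfl⟩
  obtain ⟨z, hz, hsup⟩ := (hΦ (c.push (chr Z)) (c.coord 1)).1 _ _ (c.repSet_push Z)
    (c.repFun_coord 1) (by
      constructor
      · rintro _ ⟨y, hy, rfl⟩ _ ⟨y', hy', rfl⟩ h
        simp only [c.dec_cname_emb] at h
        have h1 : tail y = tail y' := by
          rw [← cons_tail (tail y), ← cons_tail (tail y'), hy.1, hy'.1]
          exact congrArg (cons · x) h
        rw [← cons_tail y, ← cons_tail y', h1, h0 y hy, h0 y' hy']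
      · intro n _
        refine ⟨_, ⟨_, hmem n, rfl⟩, ?_⟩
        show c.dec (c.cname (c.emb _)) 1 = n
        rw [c.dec_cname_emb]
        rfl)
  refine ⟨z, (congrArg (fun F => Φ F (c.coord 1)) hZ).trans hz, (hub_chr ⟨x, rfl⟩).trans
    (congrArg (toPar (σ := Ty.nat)) (ind_congr ?_))⟩
  refine Iff.trans ?_ hsup.tfloor_ne_zero_iff.symm
  constructor
  · rintro ⟨_, rfl, h⟩
    exact ⟨_, hmem 0, h⟩
  · rintro ⟨y, hy, h⟩
    exact ⟨x, rfl, (h0 y hy).symm.trans h⟩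

/-- Prefixing the possible element with `0` places its image at or above `1 / 3`, whereas the empty
set has supremum `0`. -/
theorem nonemptyHub_le_of_mem_omegaBW {Φ : Par (Ty.two ⇒ Ty.two ⇒ Ty.one)}
    (hΦ : Φ ∈ OmegaBW) : ComputableModE2 nonemptyHub Φ := by
  let c := unitCode
  have hprep : IsRec (τ := Ty.two ⇒ Ty.two) fun G => c.push (copiesChr G 1) :=
    Rec.lam (RecG.map c.isRec_push (RecG.copiesChr Rec.v0 (.const 1)))
  refine computable_of_query₂ (α := Ty.one) hprep (c.isRec_coord 1) isRec_tfloor_one_ne_zero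
    fun G hG => ?_
  obtain ⟨X, rfl, hX⟩ := exists_of_hub_ne_bot hG
  have h0 : ∀ y ∈ copies X 1, y 0 = 0 := fun y hy => Nat.lt_one_iff.1 hy.2
  obtain ⟨z, hz, hsup⟩ := (hΦ (c.push (chr (copies X 1))) (c.coord 1)).1 _ _ (c.repSet_push _)
    (c.repFun_coord 1) (by
      rintro _ ⟨y, hy, rfl⟩ _ ⟨y', hy', rfl⟩ -
      rw [← cons_tail y, ← cons_tail y', Set.encard_le_one_iff.1 hX _ _ hy.1 hy'.1, h0 y hy,
        h0 y' hy'])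
  refine ⟨z, (congrArg (fun F => Φ (c.push F) (c.coord 1)) (copiesChr_chr X 1)).trans hz,
    (hub_chr hX).trans (congrArg (toPar (σ := Ty.nat)) (ind_congr ?_))⟩
  refine Iff.trans ?_ hsup.tfloor_ne_zero_iff.symm
  constructor
  · rintro ⟨x, hx⟩
    exact ⟨cons 0 x, ⟨hx, Nat.one_pos⟩, rfl⟩
  · rintro ⟨y, hy, -⟩
    exact ⟨_, hy.1⟩

/-! ### Each class has an element that is computable in the corresponding hub -/

namespace DomCode

variable (c : DomCode D)

theorem setOf_canon {G : Tot Ty.two} {X : Set D.Pt} (h : D.RepSet G X) :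
    {x | c.canon G x = 1} = c.cname '' X := by
  ext x
  rw [c.canon_eq h]
  exact ind_eq_one

open Classical in
/-- The functional with domain `dom` whose value is computed by `v` from the set of canonical
names of the elements of the input. -/
noncomputable def setFunctional {τ : Ty} (dom : Set D.Pt → Prop) (v : Set (ℕ → ℕ) → Tot τ) :
    Par (Ty.two ⇒ τ) := fun G =>
  if ∃ X, D.RepSet G X ∧ dom X then toPar (v {x | c.canon G x = 1}) else ⊥

theorem setFunctional_eq {τ : Ty} {dom : Set D.Pt → Prop} {v : Set (ℕ → ℕ) → Tot τ}
    {G : Tot Ty.two} {X : Set D.Pt} (h : D.RepSet G X) (hX : dom X) :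
    c.setFunctional dom v G = toPar (v (c.cname '' X)) := by
  rw [← c.setOf_canon h]
  exact if_pos ⟨X, h, hX⟩

theorem setFunctional_mem {τ : Ty} {dom : Set D.Pt → Prop} {out : Set D.Pt → Tot τ → Prop}
    {v : Set (ℕ → ℕ) → Tot τ} (h : ∀ X, dom X → out X (v (c.cname '' X))) :
    c.setFunctional dom v ∈ D.SetFunctional τ dom out := fun _ =>
  ⟨fun X hG hX => ⟨_, c.setFunctional_eq hG hX, h X hX⟩,
    fun hn => if_neg fun ⟨X, hG, hX⟩ => hn X hG hX⟩

/-- One query at the set of canonical names suffices; the index of the query is a dummy. -/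
theorem setFunctional_le_hub {α τ : Ty} {dom : Set D.Pt → Prop} {v : Set (ℕ → ℕ) → Tot τ}
    {dom' : Set (ℕ → ℕ) → Prop} {val : Set (ℕ → ℕ) → Tot α} {post : Tot (α ⇒ τ)}
    (hpost : IsRec post) (hdom : ∀ X, dom X → dom' (c.cname '' X)) (hv : ∀ X, v X = post (val X))
    (hα : (Ty.nat ⇒ α).rank ≤ 3 := by decide) (hα' : ((Ty.nat ⇒ α) ⇒ τ).rank ≤ 3 := by decide)
    (hα'' : (Ty.two ⇒ (Ty.nat ⇒ α) ⇒ τ).rank ≤ 3 := by decide)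
    (hτ : (Ty.two ⇒ τ).rank ≤ 3 := by decide) :
    ComputableModE2 (c.setFunctional dom v) (hub dom' val) := by
  refine computable_of_queries (α := α)
    (prep := show Tot (Ty.two ⇒ Ty.nat ⇒ Ty.two) from fun G _ => c.canon G)
    (post := fun _ y => post (y (0 : ℕ)))
    (Rec.lam (Rec.lam (RecG.map c.isRec_canon Rec.v0.wk)))
    (Rec.lam (Rec.lam (Rec.app hpost.const (Rec.app (σ := Ty.nat) Rec.v0 RecN.zero)) hα') hα'')
    (fun G hG => ?_) hα hτ
  have : ∃ X, D.RepSet G X ∧ dom X := by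
    by_contra hn
    exact hG (if_neg hn)
  obtain ⟨X, hX, hd⟩ := this
  refine ⟨fun _ => val (c.cname '' X), fun _ => ?_, ?_⟩
  · exact (congrArg (hub dom' val) (c.canon_eq hX)).trans (hub_chr (hdom X hd))
  · rw [c.setFunctional_eq hX hd, hv]

open Classical in
/-- The functional with domain `dom` whose value is computed by `v` from the sets of canonical
names of the elements of `A` with a given value of `Y`. -/
noncomputable def setFunFunctional {τ : Ty} (dom : Set D.Pt → (D.Pt → ℕ) → Prop)
    (v : (ℕ → Set (ℕ → ℕ)) → Tot τ) : Par (Ty.two ⇒ Ty.two ⇒ τ) := fun G H =>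
  if ∃ A Y, D.RepSet G A ∧ D.RepFun H Y ∧ dom A Y then
    toPar (v fun n => {x | c.canon G x = 1 ∧ H x = n}) else ⊥

theorem setOf_canon_and {G H : Tot Ty.two} {A : Set D.Pt} {Y : D.Pt → ℕ} (hG : D.RepSet G A)
    (hH : D.RepFun H Y) (n : ℕ) :
    {x | c.canon G x = 1 ∧ H x = n} = c.cname '' {p | p ∈ A ∧ Y p = n} := by
  ext x
  have h1 := Set.ext_iff.1 (c.setOf_canon hG) x
  constructor
  · rintro ⟨h2, h3⟩
    obtain ⟨p, hp, rfl⟩ := h1.1 h2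
    exact ⟨p, ⟨hp, (hH _ p (c.names_cname p)).symm.trans h3⟩, rfl⟩
  · rintro ⟨p, ⟨hp, hn⟩, rfl⟩
    exact ⟨h1.2 ⟨p, hp, rfl⟩, (hH _ p (c.names_cname p)).trans hn⟩

theorem setFunFunctional_eq {τ : Ty} {dom : Set D.Pt → (D.Pt → ℕ) → Prop}
    {v : (ℕ → Set (ℕ → ℕ)) → Tot τ} {G H : Tot Ty.two} {A : Set D.Pt} {Y : D.Pt → ℕ}
    (hG : D.RepSet G A) (hH : D.RepFun H Y) (hA : dom A Y) :
    c.setFunFunctional dom v G H = toPar (v fun n => c.cname '' {p | p ∈ A ∧ Y p = n}) := by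
  rw [← funext (c.setOf_canon_and hG hH)]
  exact if_pos ⟨A, Y, hG, hH, hA⟩

theorem setFunFunctional_mem {τ : Ty} {dom : Set D.Pt → (D.Pt → ℕ) → Prop}
    {out : Set D.Pt → Tot τ → Prop} {v : (ℕ → Set (ℕ → ℕ)) → Tot τ}
    (h : ∀ A Y, dom A Y → out A (v fun n => c.cname '' {p | p ∈ A ∧ Y p = n})) :
    c.setFunFunctional dom v ∈ D.SetFunFunctional τ dom out := fun _ _ =>
  ⟨fun A Y hG hH hA => ⟨_, c.setFunFunctional_eq hG hH hA, h A Y hA⟩,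
    fun hn => if_neg fun ⟨A, Y, hG, hH, hA⟩ => hn A Y hG hH hA⟩

/-- The hub is queried once for each fibre of `Y` on `A`, and `post` combines the sequence of
answers. -/
theorem setFunFunctional_le_hub {τ : Ty} {dom : Set D.Pt → (D.Pt → ℕ) → Prop}
    {v : (ℕ → Set (ℕ → ℕ)) → Tot τ} {dom' : Set (ℕ → ℕ) → Prop}
    {val : Set (ℕ → ℕ) → Tot Ty.one} {post : Tot ((Ty.nat ⇒ Ty.one) ⇒ τ)} (hpost : IsRec post)
    (hdom : ∀ A Y, dom A Y → ∀ n, dom' (c.cname '' {p | p ∈ A ∧ Y p = n}))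
    (hv : ∀ F : ℕ → Set (ℕ → ℕ), (∀ n, dom' (F n)) → v F = post fun n => val (F n))
    (hα : ((Ty.nat ⇒ Ty.one) ⇒ τ).rank ≤ 3 := by decide)
    (hα' : (Ty.two ⇒ (Ty.nat ⇒ Ty.one) ⇒ τ).rank ≤ 3 := by decide)
    (hα'' : (Ty.two ⇒ Ty.two ⇒ (Ty.nat ⇒ Ty.one) ⇒ τ).rank ≤ 3 := by decide)
    (hτ : (Ty.two ⇒ Ty.two ⇒ τ).rank ≤ 3 := by decide)
    (hτ' : (Ty.two ⇒ τ).rank ≤ 3 := by decide) :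
    ComputableModE2 (c.setFunFunctional dom v) (hub dom' val) := by
  let prep : ((ℕ → ℕ) → ℕ) → ((ℕ → ℕ) → ℕ) → ℕ → (ℕ → ℕ) → ℕ := fun G H n x =>
    ind (c.canon G x = 1 ∧ H x = n)
  have hprep : IsRec (τ := Ty.two ⇒ Ty.two ⇒ Ty.nat ⇒ Ty.two) prep := by
    refine Rec.lam (Rec.lam (Rec.lam (RecG.lam ?_)))
    have hG : RecG fun ρ : TEnv [Ty.one, Ty.nat, Ty.two, Ty.two] => ρ.2.2.2.1 := Rec.v0.wk.wk.wk
    have hH : RecG fun ρ : TEnv [Ty.one, Ty.nat, Ty.two, Ty.two] => ρ.2.2.1 := Rec.v0.wk.wk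
    exact RecP.and (RecP.eq (RecG.app (RecG.map c.isRec_canon hG) Rec.v0) (.const 1))
      (RecP.eq (RecG.app hH Rec.v0) Rec.v0.wk)
  refine computable_of_queries₂ (α := Ty.one) hprep (post := fun _ _ y => post y)
    (Rec.lam (Rec.lam (Rec.lam (Rec.app hpost.const Rec.v0) hα) hα') hα'') (fun G H hGH => ?_)
    (by decide) hτ hτ'
  have : ∃ A Y, D.RepSet G A ∧ D.RepFun H Y ∧ dom A Y := by
    by_contra hn
    exact hGH (if_neg hn)
  obtain ⟨A, Y, hG, hH, hA⟩ := this
  refine ⟨fun n => val (c.cname '' {p | p ∈ A ∧ Y p = n}), fun n => ?_, ?_⟩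
  · have h1 : prep G H n = chr (c.cname '' {p | p ∈ A ∧ Y p = n}) :=
      congrArg chr (c.setOf_canon_and hG hH n)
    exact (congrArg (hub dom' val) h1).trans (hub_chr (hdom A Y hA n))
  · rw [c.setFunFunctional_eq hG hH hA, hv _ (hdom A Y hA)]

theorem lists_sortCode {X : Set D.Pt} (hX : X.Finite) :
    D.Lists X (sortCode (c.cname '' X)) := by
  have h := sortCode_spec (hX.image c.cname)
  have hp : ∀ i : Fin (sortCode (c.cname '' X) 0),
      ∃ p ∈ X, c.cname p = entry (sortCode (c.cname '' X)) i := by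
    intro i
    have : entry (sortCode (c.cname '' X)) i ∈ entries (sortCode (c.cname '' X)) := ⟨i, i.2, rfl⟩
    rwa [h.2] at this
  choose p hpX hp using hp
  refine ⟨List.ofFn p, ⟨List.length_ofFn.symm, fun i hi => ?_⟩, fun q hq => ?_⟩
  · rw [List.length_ofFn] at hi
    rw [List.getElem_ofFn, show entry (sortCode (c.cname '' X)) i = _ from (hp ⟨i, hi⟩).symm]
    exact c.names_cname _
  · have : c.cname q ∈ entries (sortCode (c.cname '' X)) := by
      rw [h.2]
      exact ⟨q, hq, rfl⟩
    obtain ⟨i, hi, hqi⟩ := this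
    exact List.mem_ofFn.2 ⟨⟨i, hi⟩, c.cname_injective ((hp ⟨i, hi⟩).trans hqi)⟩

end DomCode

/-- When the cardinality `n` is known in advance, `eq_sortCode_iff` exhibits the sorted code of `X`
as the element of a decidable singleton, without recursion. -/
theorem encard_eq_hub_le (n : ℕ) :
    ComputableModE2 (hub (fun X => X.encard = n) sortCode : Par (Ty.two ⇒ Ty.one))
      singletonHub := by
  let prep : ((ℕ → ℕ) → ℕ) → ℕ → (ℕ → ℕ) → ℕ := fun G _ s =>
    ind (IsSorted s ∧ (∀ i, i < s 0 → G (entry s i) = 1) ∧ s 0 = n)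
  have hprep : IsRec (τ := Ty.two ⇒ Ty.nat ⇒ Ty.two) prep := by
    refine Rec.lam (Rec.lam (RecG.lam ?_))
    have hs : RecF fun ρ : TEnv [Ty.one, Ty.nat, Ty.two] => ρ.1 := Rec.v0
    have hG : RecG fun ρ : TEnv [Ty.one, Ty.nat, Ty.two] => ρ.2.2.1 := Rec.v0.wk.wk
    exact RecP.and (RecG.app isRec_isSorted.const hs) (RecP.and (RecP.all (RecP.imp
      (RecP.lt Rec.v0 (RecF.app hs.wk .zero)) (RecP.eq (RecG.app hG.wk (RecF.entry hs.wk Rec.v0))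
        (.const 1)))) (RecP.eq (hs.app .zero) (.const n)))
  refine computable_of_queries (α := Ty.one) hprep
    (post := show Tot (Ty.two ⇒ (Ty.nat ⇒ Ty.one) ⇒ Ty.one) from fun _ y => y (0 : ℕ))
    (Rec.lam (Rec.lam (RecF.seqApp Rec.v0 .zero))) fun G hG => ?_
  obtain ⟨X, rfl, hX⟩ := exists_of_hub_ne_bot hG
  have hfin : X.Finite := Set.finite_of_encard_eq_coe hX
  refine ⟨fun _ => sortCode X, fun m => ?_, hub_chr hX⟩
  have h1 : prep (chr X) m = chr {sortCode X} := funext fun s => ind_congr (by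
    rw [Set.mem_singleton_iff, eq_sortCode_iff hfin]
    refine and_congr_right' (and_congr ?_ ?_)
    · exact forall_congr' fun i => imp_congr_right fun _ => ind_eq_one
    · rw [hX, eq_comm]
      norm_cast)
  refine (congrArg singletonHub h1).trans ((hub_chr ⟨_, rfl⟩).trans ?_)
  rw [point_singleton]

/-! #### Enumerations and suprema of well-ordered sets -/

/-- The enumeration obtained from a sequence of codes of sets with at most one element. -/
noncomputable def enumOf (e : ℕ → ℕ → ℕ) (n k : ℕ) : ℕ :=
  if e n 0 = 0 then e (sInf {m | ¬ e m 0 = 0}) k else e n k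

/-- The supremum of the real numbers whose names are listed in `e`. -/
noncomputable def supOf (e : ℕ → ℕ → ℕ) (n : ℕ) : ℕ :=
  frac (sInf {k | ∀ i, ¬ e i 0 = 0 → tfloor (entry (e i) 0) n ≤ k}) (3 ^ n)

theorem isRec_enumOf : IsRec (τ := (Ty.nat ⇒ Ty.one) ⇒ Ty.nat ⇒ Ty.one) enumOf := by
  refine Rec.lam (Rec.lam (RecF.lam ?_))
  have he : Rec (τ := Ty.nat ⇒ Ty.one) fun ρ : TEnv [Ty.nat, Ty.nat, Ty.nat ⇒ Ty.one] => ρ.2.2.1 :=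
    Rec.v0.wk.wk
  have hn : RecN fun ρ : TEnv [Ty.nat, Ty.nat, Ty.nat ⇒ Ty.one] => ρ.2.1 := Rec.v0.wk
  have hk : RecN fun ρ : TEnv [Ty.nat, Ty.nat, Ty.nat ⇒ Ty.one] => ρ.1 := Rec.v0
  exact RecN.cond (RecF.app (RecF.seqApp he hn) .zero) (RecF.app (RecF.seqApp he (RecN.sInf
    (RecP.not (RecP.eq (RecF.app (RecF.seqApp he.wk Rec.v0) .zero) .zero)))) hk)
    (RecF.app (RecF.seqApp he hn) hk)

theorem isRec_supOf : IsRec (τ := (Ty.nat ⇒ Ty.one) ⇒ Ty.one) supOf := by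
  refine Rec.lam (RecF.lam (RecN.frac (RecN.sInf (RecP.all ?_)) (RecN.threePow Rec.v0)))
  have he : Rec (τ := Ty.nat ⇒ Ty.one)
      fun ρ : TEnv [Ty.nat, Ty.nat, Ty.nat, Ty.nat ⇒ Ty.one] => ρ.2.2.2.1 := Rec.v0.wk.wk.wk
  have hei := RecF.seqApp he Rec.v0
  exact RecP.imp (RecP.not (RecP.eq (hei.app .zero) .zero))
    (RecP.le (RecN.tfloor (hei.entry .zero) Rec.v0.wk.wk) Rec.v0.wk)

/-- `singletonHub` answers with points, but `enumOf` and `supOf` expect codes of sequences; `single`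
converts between them. -/
theorem isRec_comp_single {τ : Ty} {F : Tot ((Ty.nat ⇒ Ty.one) ⇒ τ)} (hF : IsRec F)
    (hτ : ((Ty.nat ⇒ Ty.one) ⇒ τ).rank ≤ 3 := by decide) :
    IsRec (τ := (Ty.nat ⇒ Ty.one) ⇒ τ) fun y => F fun n => single (y n) :=
  Rec.lam (Rec.app (σ := Ty.nat ⇒ Ty.one) hF.const
    (Rec.lam (RecF.map isRec_single (RecF.seqApp Rec.v0.wk Rec.v0)))) hτ

/-! ### Fibres of a function that is injective on the set -/

section Inj

variable (c : DomCode D) {A : Set D.Pt} {Y : D.Pt → ℕ}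

theorem fiber_eq (hY : Set.InjOn Y A) {p : D.Pt} (hp : p ∈ A) :
    c.cname '' {q | q ∈ A ∧ Y q = Y p} = {c.cname p} := by
  have : {q | q ∈ A ∧ Y q = Y p} = {p} := by
    ext q
    constructor
    · rintro ⟨hq, h⟩
      exact hY hq hp h
    · rintro rfl
      exact ⟨hp, rfl⟩
  rw [this, Set.image_singleton]

theorem fiber_cases (hY : Set.InjOn Y A) (n : ℕ) :
    c.cname '' {q | q ∈ A ∧ Y q = n} = ∅ ∨
      ∃ p ∈ A, Y p = n ∧ c.cname '' {q | q ∈ A ∧ Y q = n} = {c.cname p} := by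
  by_cases h : ∃ p ∈ A, Y p = n
  · obtain ⟨p, hp, rfl⟩ := h
    exact Or.inr ⟨p, hp, rfl, fiber_eq c hY hp⟩
  · left
    rw [Set.image_eq_empty]
    exact Set.eq_empty_of_forall_notMem fun p hp => h ⟨p, hp.1, hp.2⟩

theorem fiber_finite (hY : Set.InjOn Y A) (n : ℕ) :
    (c.cname '' {q | q ∈ A ∧ Y q = n}).Finite := by
  rcases fiber_cases c hY n with h | ⟨p, -, -, h⟩ <;> rw [h]
  · exact Set.finite_empty
  · exact Set.finite_singleton _

/-- The sequence of the codes of the sets of canonical names of the elements of `A` with a given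
value of `Y`. -/
noncomputable def fiberCode (A : Set D.Pt) (Y : D.Pt → ℕ) (n : ℕ) : ℕ → ℕ :=
  sortCode (c.cname '' {q | q ∈ A ∧ Y q = n})

theorem fiberCode_eq (hY : Set.InjOn Y A) {p : D.Pt} (hp : p ∈ A) :
    fiberCode c A Y (Y p) = single (c.cname p) := by
  rw [fiberCode, fiber_eq c hY hp, sortCode_singleton]

theorem exists_of_fiberCode_ne_zero (hY : Set.InjOn Y A) {n : ℕ} (h : fiberCode c A Y n 0 ≠ 0) :
    ∃ p ∈ A, Y p = n := by
  rcases fiber_cases c hY n with h' | ⟨p, hp, hn, -⟩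
  · exact absurd ((sortCode_zero_eq_zero (fiber_finite c hY n)).2 h') h
  · exact ⟨p, hp, hn⟩

/-- Each fibre has at most one element, and every point of `A` appears at the index given by its
`Y`-value. Indices with an empty fibre repeat the point of the first nonempty fibre. -/
theorem enumerates_enumOf (hY : Set.InjOn Y A) :
    D.Enumerates A (enumOf (fiberCode c A Y)) := by
  have hpos : ∀ p ∈ A, enumOf (fiberCode c A Y) (Y p) = single (c.cname p) := by
    intro p hp
    funext k
    unfold enumOf
    rw [fiberCode_eq c hY hp]
    exact if_neg one_ne_zero
  rcases A.eq_empty_or_nonempty with rfl | ⟨p₀, hp₀⟩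
  · refine Or.inr ⟨rfl, fun n => ?_⟩
    have h0 : ∀ n, fiberCode c ∅ Y n = fun _ => 0 := by
      intro n
      rw [fiberCode, show {q : D.Pt | q ∈ (∅ : Set D.Pt) ∧ Y q = n} = ∅ from
        Set.eq_empty_of_forall_notMem fun q hq => hq.1, Set.image_empty, sortCode_empty]
    -- All codes are zero, so the index to which the failed search defaults is irrelevant.
    have h1 : enumOf (fiberCode c ∅ Y) n = fun _ => 0 := by
      funext k
      unfold enumOf
      simp only [h0]
      exact ite_self 0
    rw [h1]
    exact ⟨rfl, fun i hi => absurd hi (Nat.not_lt_zero i)⟩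
  · have hx : ∀ n, ∃ p ∈ A, enumOf (fiberCode c A Y) n = single (c.cname p) := by
      intro n
      by_cases hn : fiberCode c A Y n 0 = 0
      · have hm : sInf {m | ¬ fiberCode c A Y m 0 = 0} ∈ {m | ¬ fiberCode c A Y m 0 = 0} := by
          refine Nat.sInf_mem ⟨Y p₀, ?_⟩
          rw [Set.mem_ofPred_eq, fiberCode_eq c hY hp₀]
          exact one_ne_zero
        obtain ⟨p, hp, hpm⟩ := exists_of_fiberCode_ne_zero c hY hm
        refine ⟨p, hp, ?_⟩
        funext k
        unfold enumOf
        rw [if_pos hn, ← hpm, fiberCode_eq c hY hp]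
      · obtain ⟨p, hp, rfl⟩ := exists_of_fiberCode_ne_zero c hY hn
        exact ⟨p, hp, hpos p hp⟩
    choose x hxA hx using hx
    refine Or.inl ⟨x, ?_, fun n => ?_⟩
    · refine Set.Subset.antisymm (by rintro _ ⟨n, rfl⟩; exact hxA n) fun p hp => ⟨Y p, ?_⟩
      have h := (hx (Y p)).symm.trans (hpos p hp)
      apply c.cname_injective
      rw [← entry_single (c.cname p), ← h, entry_single]
    · rw [hx n]
      refine ⟨rfl, fun i hi => ?_⟩
      obtain rfl : i = 0 := Nat.lt_one_iff.1 hi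
      rw [entry_single]
      exact c.names_cname _

end Inj

/-- Let `k n` be the largest `⌊3 ^ n * p⌋` over `p ∈ A`, or `0` if `A` is empty. These numbers grow
by one ternary digit at a time and so define a real number. It bounds each `p` up to an error `1 / 3
^ n`, and exceeds any upper bound of `A` by at most that error. -/
theorem namesSup_supOf {A : Set Dom.unit.Pt} {Y : Dom.unit.Pt → ℕ} (hY : Set.InjOn Y A) :
    NamesSup A (supOf (fiberCode unitCode A Y)) := by
  let S : ℕ → Set ℕ := fun n => {k | ∀ p : unitInterval, p ∈ A → ⌊(3 : ℝ) ^ n * p.1⌋₊ ≤ k}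
  let k : ℕ → ℕ := fun n => sInf (S n)
  have hS : ∀ n, {k | ∀ i, ¬ fiberCode unitCode A Y i 0 = 0 →
      tfloor (entry (fiberCode unitCode A Y i) 0) n ≤ k} = S n := by
    intro n
    have hfl : ∀ p : unitInterval, p ∈ A → tfloor (entry (fiberCode unitCode A Y (Y p)) 0) n =
        ⌊(3 : ℝ) ^ n * p.1⌋₊ := by
      intro p hp
      rw [fiberCode_eq unitCode hY hp, entry_single]
      exact tfloor_eq (codesReal_realName _) p.2.1 n
    ext m
    constructor
    · intro h p hp
      rw [← hfl p hp]
      refine h (Y p) ?_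
      rw [fiberCode_eq unitCode hY hp]
      exact one_ne_zero
    · intro h i hi
      obtain ⟨p, hp, rfl⟩ := exists_of_fiberCode_ne_zero unitCode hY hi
      rw [hfl p hp]
      exact h p hp
  have hk : supOf (fiberCode unitCode A Y) = fun n => frac (k n) (3 ^ n) :=
    funext fun n => congrArg (fun s => frac (sInf s) (3 ^ n)) (hS n)
  have hne : ∀ n, 3 ^ n ∈ S n := by
    intro n p _
    have h1 : (3 : ℝ) ^ n * p.1 ≤ (3 ^ n : ℕ) := by
      push_cast
      exact mul_le_of_le_one_right (by positivity) p.2.2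
    exact (Nat.floor_le_floor h1).trans (Nat.floor_natCast _).le
  have hmem : ∀ n, k n ∈ S n := fun n => Nat.sInf_mem ⟨_, hne n⟩
  -- The least bound is attained because it is a natural number; the alternative `k n = 0` covers
  -- the empty set.
  have hatt : ∀ n, k n = 0 ∨ ∃ p : unitInterval, p ∈ A ∧ k n = ⌊(3 : ℝ) ^ n * p.1⌋₊ := by
    intro n
    by_cases h0 : k n = 0
    · exact Or.inl h0
    · right
      have h1 : k n - 1 ∉ S n := Nat.notMem_of_lt_sInf (Nat.sub_one_lt h0)
      simp only [S, Set.mem_ofPred_eq, not_forall, not_le] at h1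
      obtain ⟨p, hp, h1⟩ := h1
      have h2 := hmem n p hp
      exact ⟨p, hp, by omega⟩
  have hfl : ∀ (p : unitInterval) n, 3 * ⌊(3 : ℝ) ^ n * p.1⌋₊ ≤ ⌊(3 : ℝ) ^ (n + 1) * p.1⌋₊ ∧
      ⌊(3 : ℝ) ^ (n + 1) * p.1⌋₊ ≤ 3 * ⌊(3 : ℝ) ^ n * p.1⌋₊ + 2 := by
    intro p n
    have h0 : (0 : ℝ) ≤ 3 ^ n * p.1 := mul_nonneg (by positivity) p.2.1
    have h1 := Nat.floor_le h0
    have h2 := Nat.lt_floor_add_one ((3 : ℝ) ^ n * p.1)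
    have h3 : (3 : ℝ) ^ (n + 1) * p.1 = 3 * (3 ^ n * p.1) := by ring
    rw [h3]
    constructor
    · apply Nat.le_floor
      push_cast
      linarith
    · rw [← Nat.lt_succ_iff, Nat.floor_lt (by linarith)]
      push_cast
      linarith
  obtain ⟨r, hr, hb⟩ := exists_codesReal_triadic (k := k)
    (fun n => by
      rcases hatt n with h | ⟨p, hp, h⟩
      · rw [h]
        exact Nat.zero_le _
      · rw [h]
        exact (hfl p n).1.trans (hmem (n + 1) p hp))
    (fun n => Nat.sInf_le fun p hp => (hfl p n).2.trans (by have := hmem n p hp; omega))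
  have hr0 : 0 ≤ r := le_of_forall_three_pow fun n => by
    have := (hb n).1
    have : (0 : ℝ) ≤ k n := Nat.cast_nonneg _
    linarith
  have hr1 : r ≤ 1 := le_of_forall_three_pow fun n => by
    have h1 := (hb n).2
    have h2 : (k n : ℝ) ≤ 3 ^ n := by exact_mod_cast Nat.sInf_le (hne n)
    linarith
  refine ⟨⟨r, hr0, hr1⟩, ⟨fun p hp => ?_, fun u hu => ?_⟩, ?_⟩
  · refine Subtype.coe_le_coe.1 (le_of_forall_three_pow fun n => ?_)
    have h1 := (Nat.lt_floor_add_one ((3 : ℝ) ^ n * p.1)).le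
    have h2 : (⌊(3 : ℝ) ^ n * p.1⌋₊ : ℝ) ≤ k n := by exact_mod_cast hmem n p hp
    exact (h1.trans (add_le_add_left h2 1)).trans (add_le_add_left (hb n).1 1)
  · refine Subtype.coe_le_coe.1 (le_of_forall_three_pow fun n => (hb n).2.trans
      (add_le_add_left ?_ 1))
    have h0 : (0 : ℝ) ≤ 3 ^ n * u.1 := mul_nonneg (by positivity) u.2.1
    rcases hatt n with h | ⟨p, hp, h⟩
    · rw [h, Nat.cast_zero]
      exact h0
    · rw [h]
      have hpu : p.1 ≤ u.1 := hu hp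
      exact (Nat.floor_le (mul_nonneg (by positivity) p.2.1)).trans
        (mul_le_mul_of_nonneg_left hpu (by positivity))
  · rw [hk]
    exact hr

/-! ### The cluster theorem -/

/-- Any element of either class computes `lower`, hence `upper`, hence the chosen good element of
the other class. -/
theorem inCluster_of_hubs {β σ τ υ : Ty} {B : Set (Par σ)} {C : Set (Par τ)} {lower : Par β}
    {upper : Par υ} (hul : ComputableModE2 upper lower)
    (hB : ∀ b ∈ B, ComputableModE2 lower b) (hB' : ∃ b ∈ B, ComputableModE2 b upper)
    (hC : ∀ c ∈ C, ComputableModE2 lower c) (hC' : ∃ c ∈ C, ComputableModE2 c upper) :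
    InCluster B C := by
  obtain ⟨b₀, hb₀, hb₀'⟩ := hB'
  obtain ⟨c₀, hc₀, hc₀'⟩ := hC'
  have h : ∀ c ∈ C, ∃ b ∈ B, ComputableModE2 b c := fun c hc =>
    ⟨b₀, hb₀, (hb₀'.trans hul).trans (hC c hc)⟩
  exact ⟨h, c₀, hc₀, h c₀ hc₀, fun b hb => (hc₀'.trans hul).trans (hB b hb)⟩

theorem exists_omegaOne_le (D : Dom) : ∃ b ∈ OmegaOne D, ComputableModE2 b singletonHub := by
  refine ⟨(domCode D).setFunctional _ point, (domCode D).setFunctional_mem ?_,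
    (domCode D).setFunctional_le_hub (post := fun x => x) isRec_id ?_ fun _ => rfl⟩
  · rintro _ ⟨p, rfl⟩
    refine ⟨p, rfl, ?_⟩
    rw [Set.image_singleton, point_singleton]
    exact (domCode D).names_cname p
  · rintro _ ⟨p, rfl⟩
    exact ⟨_, Set.image_singleton⟩

theorem exists_lists_le {dom : Set D.Pt → Prop} (hdom : ∀ X, dom X → X.Finite) :
    ∃ b ∈ D.SetFunctional Ty.one dom D.Lists, ComputableModE2 b finiteHub :=
  ⟨(domCode D).setFunctional dom sortCode,
    (domCode D).setFunctional_mem fun X hX => (domCode D).lists_sortCode (hdom X hX),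
    (domCode D).setFunctional_le_hub (post := fun x => x) isRec_id
      (fun X hX => (hdom X hX).image _) fun _ => rfl⟩

theorem inCluster_omegaOne {τ : Ty} {C : Set (Par τ)} (D : Dom)
    (hC : ∀ c ∈ C, ComputableModE2 bitHub c) (hC' : ∃ c ∈ C, ComputableModE2 c singletonHub) :
    InCluster (OmegaOne D) C :=
  inCluster_of_hubs singletonHub_le (fun _ => bitHub_le_of_mem_omegaOne) (exists_omegaOne_le D)
    hC hC'

theorem inCluster_omega {τ : Ty} {C : Set (Par τ)} (D : Dom)
    (hC : ∀ c ∈ C, ComputableModE2 nonemptyHub c) (hC' : ∃ c ∈ C, ComputableModE2 c finiteHub) :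
    InCluster (Omega D) C :=
  inCluster_of_hubs (finiteHub_le.trans subsingletonHub_le)
    (fun _ => nonemptyHub_le_of_mem_lists fun _ h => h)
    (exists_lists_le fun _ h => Set.finite_of_encard_le_coe h) hC hC'

theorem inCluster_lists {dom : Set D.Pt → Prop} (D' : Dom) (h1 : ∀ X, X.encard ≤ 1 → dom X)
    (h2 : ∀ X, dom X → X.Finite) :
    InCluster (Omega D') (D.SetFunctional Ty.one dom D.Lists) :=
  inCluster_omega D' (fun _ => nonemptyHub_le_of_mem_lists h1) (exists_lists_le h2)

theorem exists_omegaEq_le (n : ℕ) : ∃ b ∈ OmegaEq n, ComputableModE2 b singletonHub :=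
  ⟨unitCode.setFunctional _ sortCode,
    unitCode.setFunctional_mem fun _ hX =>
      unitCode.lists_sortCode (Set.finite_of_encard_eq_coe hX),
    ComputableModE2.trans (unitCode.setFunctional_le_hub (post := fun x => x) isRec_id
      (fun _ hX => (unitCode.cname_injective.encard_image _).trans hX) fun _ => rfl)
      (encard_eq_hub_le n)⟩

theorem exists_omegaCard_le : ∃ b ∈ OmegaCard, ComputableModE2 b finiteHub := by
  refine ⟨unitCode.setFunctional _ fun X => sortCode X 0, unitCode.setFunctional_mem fun X hX => ?_,
    unitCode.setFunctional_le_hub (post := fun x : ℕ → ℕ => x 0)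
      (Rec.lam (RecF.app Rec.v0 .zero)) (fun X hX => hX.image _) fun _ => rfl⟩
  rw [← unitCode.cname_injective.encard_image]
  exact sortCode_zero (hX.image _)

/-- The exact cardinality is a bound, so the lower estimate for the larger class and the good
element of the smaller class serve both. -/
theorem omegaCard_subset_omegaCardBound : OmegaCard ⊆ OmegaCardBound := fun _ hΦ G =>
  ⟨fun X hG hX => ((hΦ G).1 X hG hX).imp fun _ h => ⟨h.1, le_of_eq h.2⟩, (hΦ G).2⟩

theorem fiber_singleton {A : Set D.Pt} {Y : D.Pt → ℕ} (c : DomCode D)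
    (h : Set.InjOn Y A ∧ Set.SurjOn Y A Set.univ) (n : ℕ) :
    ∃ x, c.cname '' {q | q ∈ A ∧ Y q = n} = {x} := by
  obtain ⟨p, hp, rfl⟩ := h.2 (Set.mem_univ n)
  exact ⟨_, fiber_eq c h.1 hp⟩

theorem sortCode_eq_single_point {F : ℕ → Set (ℕ → ℕ)} (hF : ∀ n, ∃ x, F n = {x}) :
    (fun n => sortCode (F n)) = fun n => single (point (F n)) := by
  funext n
  obtain ⟨x, hx⟩ := hF n
  rw [hx, sortCode_singleton, point_singleton]

theorem exists_weakEnumeration_le :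
    ∃ b ∈ WeakEnumerationFunctional, ComputableModE2 b singletonHub :=
  ⟨unitCode.setFunFunctional _ fun F => enumOf fun n => sortCode (F n),
    unitCode.setFunFunctional_mem fun _ _ h => enumerates_enumOf unitCode h.1,
    unitCode.setFunFunctional_le_hub (isRec_comp_single isRec_enumOf)
      (fun _ _ h => fiber_singleton unitCode h)
      fun _ hF => congrArg enumOf (sortCode_eq_single_point hF)⟩

theorem exists_weakOmegaBW_le : ∃ b ∈ WeakOmegaBW, ComputableModE2 b singletonHub :=
  ⟨unitCode.setFunFunctional _ fun F => supOf fun n => sortCode (F n),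
    unitCode.setFunFunctional_mem fun _ _ h => namesSup_supOf h.1,
    unitCode.setFunFunctional_le_hub (isRec_comp_single isRec_supOf)
      (fun _ _ h => fiber_singleton unitCode h)
      fun _ hF => congrArg supOf (sortCode_eq_single_point hF)⟩

theorem exists_enumeration_le : ∃ b ∈ EnumerationFunctional, ComputableModE2 b finiteHub :=
  ⟨unitCode.setFunFunctional _ fun F => enumOf fun n => sortCode (F n),
    unitCode.setFunFunctional_mem fun _ _ h => enumerates_enumOf unitCode h,
    unitCode.setFunFunctional_le_hub isRec_enumOf (fun _ _ h => fiber_finite unitCode h)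
      fun _ _ => rfl⟩

theorem exists_omegaBW_le : ∃ b ∈ OmegaBW, ComputableModE2 b finiteHub :=
  ⟨unitCode.setFunFunctional _ fun F => supOf fun n => sortCode (F n),
    unitCode.setFunFunctional_mem fun _ _ h => namesSup_supOf h,
    unitCode.setFunFunctional_le_hub isRec_supOf (fun _ _ h => fiber_finite unitCode h)
      fun _ _ => rfl⟩

end HigherType

theorem mainTheorem8 (D : HigherType.Dom) :
    ((∀ n : ℕ, 1 ≤ n →
        HigherType.InCluster (HigherType.OmegaOne D) (HigherType.OmegaEq n)) ∧
      HigherType.InCluster (HigherType.OmegaOne D) HigherType.WeakEnumerationFunctional ∧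
      HigherType.InCluster (HigherType.OmegaOne D) HigherType.WeakOmegaBW) ∧
    (HigherType.InCluster (HigherType.Omega D) HigherType.OmegaFin ∧
      (∀ n : ℕ, 1 ≤ n →
        HigherType.InCluster (HigherType.Omega D) (HigherType.OmegaLe n)) ∧
      HigherType.InCluster (HigherType.Omega D) HigherType.OmegaCard ∧
      HigherType.InCluster (HigherType.Omega D) HigherType.OmegaCardBound ∧
      HigherType.InCluster (HigherType.Omega D) HigherType.EnumerationFunctional ∧
      HigherType.InCluster (HigherType.Omega D) HigherType.OmegaBW) := by
  open HigherType in
  refine ⟨⟨fun n hn => ?_, ?_, ?_⟩, ?_, fun n hn => ?_, ?_, ?_, ?_, ?_⟩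
  · exact inCluster_omegaOne D (fun _ => bitHub_le_of_mem_omegaEq hn) (exists_omegaEq_le n)
  · exact inCluster_omegaOne D (fun _ => bitHub_le_of_mem_weakEnumeration)
      exists_weakEnumeration_le
  · exact inCluster_omegaOne D (fun _ => bitHub_le_of_mem_weakOmegaBW) exists_weakOmegaBW_le
  · exact inCluster_lists D (fun _ h => Set.finite_of_encard_le_coe h) fun _ h => h
  · exact inCluster_lists D (fun _ h => h.trans (by exact_mod_cast hn))
      fun _ h => Set.finite_of_encard_le_coe h
  · exact inCluster_omega D
      (fun _ h => nonemptyHub_le_of_mem_omegaCardBound (omegaCard_subset_omegaCardBound h))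
      exists_omegaCard_le
  · obtain ⟨c, hc, h⟩ := exists_omegaCard_le
    exact inCluster_omega D (fun _ => nonemptyHub_le_of_mem_omegaCardBound)
      ⟨c, omegaCard_subset_omegaCardBound hc, h⟩
  · exact inCluster_omega D (fun _ => nonemptyHub_le_of_mem_enumeration) exists_enumeration_le
  · exact inCluster_omega D (fun _ => nonemptyHub_le_of_mem_omegaBW) exists_omegaBW_le
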